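/- **Setting.** A transmitter with three antennas serves three single-antenna receivers. In slot $t$ receiver $i$ observes $Y_i(t)=H_i(t)X(t)+Z_i(t)$, where $X(t)\in\mathbb C^{3\times1}$, the noises $Z_i(t)$ are i.i.d. $\mathcal{CN}(0,1)$ and independent of the channels, and the channels $H_i(t)\in\mathbb C^{1\times 3}$ are independent over $i$ and $t$, with $H_i(t)\sim\mu_i$ for all $t$, where $\mu_i$ is a probability law absolutely continuous with respect to Lebesgue measure. All receivers know all channels. The transmitter knows $H_i(t)$ at time $t$ if it has instantaneous CSIT of receiver $i$, and only from time $t+1$ on if it has delayed CSIT of receiver $i$. A code of length $n$ has independent uniform private messages, $M_i$ of them for receiver $i$, and an encoder whose $X(t)$ depends on the messages and on the channels known at time $t$; it has power at most $P$ if $E|X_j(t)|^2\le P$ for every antenna $j$ and slot $t$. A rate triple $(R_1,R_2,R_3)$ is in the capacity region $\mathcal C(P)$ if for some sequence of codes of lengths $n\to\infty$ with power at most $P$ all error probabilities tend to $0$ and $\frac{\log M_i}{n}\to R_i$ for each $i$. The DoF region is the set of $(d_1,d_2,d_3)$ with $d_i\ge 0$ for which there are $(R_i(P))_i\in\mathcal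 C(P)$ for all $P>0$ with $R_i(P)/\log P\to d_i$ as $P\to\infty$. **Theorem.** 1. With instantaneous CSIT of receiver 1 and delayed CSIT of receivers 2 and 3 (hybrid CSIT), the triple $(1,\tfrac13,\tfrac13)$, with sum $\tfrac53$, lies in the DoF region. 2. This exceeds the sum DoF with delayed CSIT alone: $\tfrac{18}{11}<\tfrac53$; with delayed CSIT of all three receivers some triple in the DoF region has sum $\tfrac{18}{11}$; and if moreover $\mu_1=\mu_2=\mu_3$ and $E\log(1+\|H_i(t)\|)<\infty$, then every triple $d$ in that region satisfies $d_1+d_2+d_3\le\tfrac{18}{11}$. 3. In the noise-free channel the following two six-slot schemes send data symbols $u\in\mathbb C^6$ to receiver 1 and $v,w\in\mathbb C^2$ to receivers 2 and 3. They are linear in the data symbols, use only hybrid CSIT, and for almost every channel realization each receiver recovers its data symbols by a linear map of its six outputs. Put $a=(u_1,u_2,u_3)^T$ and $a'=(u_4,u_5,u_6)^T$. For each slot $t$ let $B(t),C(t)\in\mathbb C^{3\times 2}$, $q_t,p_t\in\mathbb C^3$ be any measurable functions of $H_1(t)$ such that $H_1(t)B(t)=0$, $H_1(t)C(t)=0$,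 $H_1(t)q_t=0$ always and, for Lebesgue-almost every $H_1(t)$, $B(t)$ and $C(t)$ have rank $2$, $q_t\neq0$ and $H_1(t)p_t\ne0$. Let $l_2=H_2(1)a$, $l_3=H_3(1)a$, $l_5=H_2(2)a'$, $l_6=H_3(2)a'$, $m_2=H_3(1)B(1)v$. *Scheme 1.* Put $n_1=H_2(2)B(2)w$, $k_1=H_3(3)p_3\,l_2+H_3(3)q_3\,l_5$ and $k_2=H_2(4)p_4\,l_6+H_2(4)q_4\,l_3$. Send $X(1)=a+B(1)v$, $X(2)=a'+B(2)w$, $X(3)=l_2p_3+(l_5+n_1)q_3$, $X(4)=l_6p_4+(l_3+m_2)q_4$, $X(5)=k_1p_5$, $X(6)=k_2p_6$. *Scheme 2.* Put $n_1=H_2(1)C(1)w$, $k_1=H_3(3)p_3\,l_5+H_3(3)q_3\,l_2$ and $k_2=H_2(4)p_4\,l_6+H_2(4)q_4\,l_3$. Send $X(1)=a+B(1)v+C(1)w$, $X(2)=a'$, $X(3)=l_5p_3+(l_2+n_1)q_3$, $X(4)=l_6p_4+(l_3+m_2)q_4$, $X(5)=k_1p_5$, $X(6)=k_2p_6$. 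-/

import Mathlib

open MeasureTheory ProbabilityTheory Filter Topology Matrix
open scoped ENNReal NNReal

namespace MISO

/-- A realization of the channels over `n` slots: `H t i` is the row vector of the channel from the
three transmit antennas to receiver `i` in slot `t`. Receivers `1, 2, 3` are `0, 1, 2 : Fin 3`. -/
abbrev Chan (n : ℕ) : Type := Fin n → Fin 3 → Fin 3 → ℂ

/-- Law of the channels: independent over slots and over receivers, identically distributed over
slots, `μ i` being the law of the channel vector of receiver `i`. -/
noncomputable def channelLaw (μ : Fin 3 → Measure (Fin 3 → ℂ)) (n : ℕ) : Measure (Chan n) :=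
  Measure.pi fun _ : Fin n => Measure.pi fun i : Fin 3 => μ i

/-- The circularly symmetric complex Gaussian law of variance `1`. -/
noncomputable def complexGaussian : Measure ℂ :=
  ((gaussianReal 0 (1 / 2)).prod (gaussianReal 0 (1 / 2))).map fun p : ℝ × ℝ => (⟨p.1, p.2⟩ : ℂ)

/-- Additive noise at one receiver: i.i.d. over the `n` slots. -/
noncomputable def noiseLaw (n : ℕ) : Measure (Fin n → ℂ) :=
  Measure.pi fun _ : Fin n => complexGaussian

/-- `x` is a channel-dependent transmit sequence that uses only the available CSIT: in slot `t` it
may depend on the channels of the receivers in `I` up to and including slot `t` (instantaneous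
CSIT), and on the channels of the other receivers only in the slots before `t` (delayed CSIT). -/
def RespectsCSIT {n : ℕ} (I : Set (Fin 3)) (x : Chan n → Fin n → Fin 3 → ℂ) : Prop :=
  ∀ (t : Fin n) (H H' : Chan n),
    (∀ i ∈ I, ∀ s ≤ t, H s i = H' s i) → (∀ i, ∀ s < t, H s i = H' s i) → x H t = x H' t

/-- A block code of length `n` for the three-user broadcast channel with private messages, with
instantaneous CSIT of the receivers in `I`, delayed CSIT of the others and global CSI at the
receivers. (`M i = 0` is impossible, since a decoder into `Fin (M i)` exists.) -/
structure Code (I : Set (Fin 3)) (n : ℕ) where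
  /-- number of messages for each receiver -/
  M : Fin 3 → ℕ
  /-- encoder: the transmitted vectors, given the messages and the channels -/
  enc : (∀ i, Fin (M i)) → Chan n → Fin n → Fin 3 → ℂ
  enc_measurable : ∀ m, Measurable (enc m)
  enc_causal : ∀ m, RespectsCSIT I (enc m)
  /-- decoders: each receiver knows all the channels and its own output sequence -/
  dec : ∀ i : Fin 3, Chan n × (Fin n → ℂ) → Fin (M i)
  dec_measurable : ∀ i, Measurable (dec i)

variable {I : Set (Fin 3)} {n : ℕ}

/-- The output sequence of receiver `i` with transmit sequence `x` and noise `z`. -/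
def output (H : Chan n) (i : Fin 3) (x : Fin n → Fin 3 → ℂ) (z : Fin n → ℂ) : Fin n → ℂ :=
  fun t => H t i ⬝ᵥ x t + z t

/-- Power constraint: in every slot and at every antenna the mean power, over uniformly distributed
messages and the channels, is at most `P`. -/
def Code.PowerLE (c : Code I n) (μ : Fin 3 → Measure (Fin 3 → ℂ)) (P : ℝ) : Prop :=
  ∀ (t : Fin n) (j : Fin 3),
    (∑ m, ∫⁻ H, ‖c.enc m H t j‖ₑ ^ 2 ∂channelLaw μ n) / (∏ i, (c.M i : ℝ≥0∞)) ≤ ENNReal.ofReal P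

/-- Probability, for independent uniformly distributed messages, that receiver `i` errs. -/
noncomputable def Code.errProb (c : Code I n) (μ : Fin 3 → Measure (Fin 3 → ℂ)) (i : Fin 3) :
    ℝ≥0∞ :=
  (∑ m, ((channelLaw μ n).prod (noiseLaw n))
      {ω | c.dec i (ω.1, output ω.1 i (c.enc m ω.1) ω.2) ≠ m i}) / (∏ i, (c.M i : ℝ≥0∞))

/-- The capacity region at power `P`: rate triples `R` that are the limits of `log M i / n` along
codes of length `n → ∞` obeying the power constraint, all of whose error probabilities vanish. -/
def capacityRegion (μ : Fin 3 → Measure (Fin 3 → ℂ)) (I : Set (Fin 3)) (P : ℝ) :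
    Set (Fin 3 → ℝ) :=
  {R | ∃ c : ∀ n : ℕ, Code I n,
    (∀ n, (c n).PowerLE μ P) ∧
    (∀ i, Tendsto (fun n : ℕ => Real.log ((c n).M i) / n) atTop (𝓝 (R i))) ∧
    (∀ i, Tendsto (fun n : ℕ => (c n).errProb μ i) atTop (𝓝 0))}

/-- The degrees-of-freedom region: pre-log factors of the capacity region as `P → ∞`. -/
def dofRegion (μ : Fin 3 → Measure (Fin 3 → ℂ)) (I : Set (Fin 3)) : Set (Fin 3 → ℝ) :=
  {d | (∀ i, 0 ≤ d i) ∧ ∃ R : ℝ → Fin 3 → ℝ,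
    (∀ P, 0 < P → R P ∈ capacityRegion μ I P) ∧
    ∀ i, Tendsto (fun P => R P i / Real.log P) atTop (𝓝 (d i))}

/-! ### Six-slot linear schemes -/

/-- The data symbols of one block: `u` (six, for receiver 1), `v` (two, for receiver 2) and
`w` (two, for receiver 3). -/
structure Symbols where
  u : Fin 6 → ℂ
  v : Fin 2 → ℂ
  w : Fin 2 → ℂ

/-- A six-slot scheme: the transmitted vectors, given the channels and the data symbols. -/
abbrev Scheme : Type := Chan 6 → Symbols → Fin 6 → Fin 3 → ℂ

/-- The transmitted vector of each slot is a linear function of the data symbols. -/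
def Scheme.IsLinear (X : Scheme) : Prop :=
  ∀ (H : Chan 6) (t : Fin 6),
    ∃ L : ((Fin 6 → ℂ) × (Fin 2 → ℂ) × (Fin 2 → ℂ)) →ₗ[ℂ] (Fin 3 → ℂ),
      ∀ s : Symbols, X H s t = L (s.u, s.v, s.w)

/-- For almost every channel realization each receiver recovers its own data symbols, whatever the
values of all data symbols, by a linear map of its six noise-free outputs. -/
def Scheme.Decodable (X : Scheme) (μ : Fin 3 → Measure (Fin 3 → ℂ)) : Prop :=
  ∀ᵐ H ∂channelLaw μ 6,
    ∃ (g₁ : (Fin 6 → ℂ) →ₗ[ℂ] (Fin 6 → ℂ)) (g₂ g₃ : (Fin 6 → ℂ) →ₗ[ℂ] (Fin 2 → ℂ)),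
      ∀ s : Symbols,
        g₁ (output H 0 (X H s) 0) = s.u ∧
        g₂ (output H 1 (X H s) 0) = s.v ∧
        g₃ (output H 2 (X H s) 0) = s.w

/-- Choices of transmit directions in the six slots, as measurable functions of the current channel
`h` of receiver 1. The columns of the precoders `B`, `C` and the vector `q` are zero-forced at
receiver 1, and `p` is a direction that receiver 1 hears. (Of a `3 × 3` precoding matrix applied to
a vector with first entry `0`, only the last two columns matter; they are the columns here.) -/
structure Beams where
  B : Fin 6 → (Fin 3 → ℂ) → Matrix (Fin 3) (Fin 2) ℂ
  C : Fin 6 → (Fin 3 → ℂ) → Matrix (Fin 3) (Fin 2) ℂ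
  q : Fin 6 → (Fin 3 → ℂ) → Fin 3 → ℂ
  p : Fin 6 → (Fin 3 → ℂ) → Fin 3 → ℂ
  B_measurable : ∀ t j k, Measurable fun h => B t h j k
  C_measurable : ∀ t j k, Measurable fun h => C t h j k
  q_measurable : ∀ t, Measurable (q t)
  p_measurable : ∀ t, Measurable (p t)
  B_zf : ∀ t h, h ᵥ* B t h = 0
  C_zf : ∀ t h, h ᵥ* C t h = 0
  q_zf : ∀ t h, h ⬝ᵥ q t h = 0
  B_indep : ∀ t, ∀ᵐ h, LinearIndependent ℂ (B t h).col
  C_indep : ∀ t, ∀ᵐ h, LinearIndependent ℂ (C t h).col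
  q_ne : ∀ t, ∀ᵐ h, q t h ≠ 0
  p_heard : ∀ t, ∀ᵐ h, h ⬝ᵥ p t h ≠ 0

/-- First scheme. Slots `1, …, 6` are `0, …, 5`. -/
def scheme₁ (b : Beams) : Scheme := fun H s =>
  let a : Fin 3 → ℂ := ![s.u 0, s.u 1, s.u 2]
  let a' : Fin 3 → ℂ := ![s.u 3, s.u 4, s.u 5]
  let l₂ := H 0 1 ⬝ᵥ a
  let l₃ := H 0 2 ⬝ᵥ a
  let l₅ := H 1 1 ⬝ᵥ a'
  let l₆ := H 1 2 ⬝ᵥ a'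
  let m₂ := H 0 2 ⬝ᵥ (b.B 0 (H 0 0) *ᵥ s.v)
  let n₁ := H 1 1 ⬝ᵥ (b.B 1 (H 1 0) *ᵥ s.w)
  let k₁ := (H 2 2 ⬝ᵥ b.p 2 (H 2 0)) * l₂ + (H 2 2 ⬝ᵥ b.q 2 (H 2 0)) * l₅
  let k₂ := (H 3 1 ⬝ᵥ b.p 3 (H 3 0)) * l₆ + (H 3 1 ⬝ᵥ b.q 3 (H 3 0)) * l₃
  ![a + b.B 0 (H 0 0) *ᵥ s.v,
    a' + b.B 1 (H 1 0) *ᵥ s.w,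
    l₂ • b.p 2 (H 2 0) + (l₅ + n₁) • b.q 2 (H 2 0),
    l₆ • b.p 3 (H 3 0) + (l₃ + m₂) • b.q 3 (H 3 0),
    k₁ • b.p 4 (H 4 0),
    k₂ • b.p 5 (H 5 0)]

/-- Second scheme: all symbols of receivers 2 and 3 are sent in the first slot. -/
def scheme₂ (b : Beams) : Scheme := fun H s =>
  let a : Fin 3 → ℂ := ![s.u 0, s.u 1, s.u 2]
  let a' : Fin 3 → ℂ := ![s.u 3, s.u 4, s.u 5]
  let l₂ := H 0 1 ⬝ᵥ a
  let l₃ := H 0 2 ⬝ᵥ a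
  let l₅ := H 1 1 ⬝ᵥ a'
  let l₆ := H 1 2 ⬝ᵥ a'
  let m₂ := H 0 2 ⬝ᵥ (b.B 0 (H 0 0) *ᵥ s.v)
  let n₁ := H 0 1 ⬝ᵥ (b.C 0 (H 0 0) *ᵥ s.w)
  let k₁ := (H 2 2 ⬝ᵥ b.p 2 (H 2 0)) * l₅ + (H 2 2 ⬝ᵥ b.q 2 (H 2 0)) * l₂
  let k₂ := (H 3 1 ⬝ᵥ b.p 3 (H 3 0)) * l₆ + (H 3 1 ⬝ᵥ b.q 3 (H 3 0)) * l₃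
  ![a + b.B 0 (H 0 0) *ᵥ s.v + b.C 0 (H 0 0) *ᵥ s.w,
    a',
    l₅ • b.p 2 (H 2 0) + (l₂ + n₁) • b.q 2 (H 2 0),
    l₆ • b.p 3 (H 3 0) + (l₃ + m₂) • b.q 3 (H 3 0),
    k₁ • b.p 4 (H 4 0),
    k₂ • b.p 5 (H 5 0)]

end MISO

namespace MISO

section

/-! ### Generic channels -/

/-! Achievability rests on one principle, `LinScheme.Resolves.mem_dofRegion`: if a causal linear
scheme over `T` slots lets every receiver determine its own `κ i > 0` symbols from its noise-free
outputs for almost every channel, then the triple `κ i / T` lies in the DoF region. The channels are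
not bounded away from degeneracy, so a finite constellation is used over one block. Outside a set of
channels and noises of small probability, chosen before the power, minimum distance decoding is
correct. An outer code over many independent blocks, from the Gilbert-Varshamov bound, then corrects
the remaining block errors. Scaling each transmitted vector by a causally known gain gives the power
constraint pointwise, so no moments of the channel laws are needed.

The hybrid scheme delivers `6 + 2 + 2` symbols in six slots. Symbols of receivers 2 and 3 are
zero-forced at receiver 1, which lacks two equations about each of its triples `a`, `a'`. These were
overheard by receivers 2 and 3, and retransmitting them both completes receiver 1 and removes
interference at the others (`scheme₁_resolves`, `scheme₂_resolves`). For delayed CSIT alone, the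
same use of overheard equations in three phases delivers `18` symbols in `11` slots
(`delayedScheme_resolves`).

The converse for delayed CSIT and equal laws compares entropies of the outputs. The input of a slot
is independent of that slot's channels, so given the past the receivers' current outputs are
exchangeable. Together with submodularity (`Code.isSymmSubmodular`) this makes the entropy per
receiver nonincreasing as receivers are added: `h(Y_i,Y_j) ≤ 2 h(Y_i)` and `2 h(Y_i,Y_j,Y_k) ≤ 3
h(Y_i,Y_j)`, also given messages. Fano's inequality (`condEnt_insert_add_log_card_le`) for receivers
enhanced to see `Y_i`, then `(Y_i,Y_j)`, then all outputs, and successively more messages, yields a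
telescoping sum with weights `1, 1/2, 1/3`. Since `h(Y_i)` is at most `n log P + O(n)`
(`meanEnt_le`), it follows that `d_i + d_j/2 + d_k/3 ≤ 1`; summing over cyclic permutations gives
`18/11`. -/

lemma ae_dotProduct_ne_zero {v : Fin 3 → ℂ} (hv : v ≠ 0) :
    ∀ᵐ h : Fin 3 → ℂ, h ⬝ᵥ v ≠ 0 := by
  -- The kernel of the functional is taken as a real subspace because the volume is a Haar measure
  -- of the underlying real vector space, where proper subspaces are null.
  let S : Submodule ℝ (Fin 3 → ℂ) :=
    { carrier := {h | h ⬝ᵥ v = 0}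
      add_mem' := fun {a b} ha hb => by
        simp only [Set.mem_ofPred_eq] at *
        rw [add_dotProduct, ha, hb, add_zero]
      zero_mem' := by simp
      smul_mem' := fun c x hx => by
        simp only [Set.mem_ofPred_eq] at *
        rw [smul_dotProduct, hx, smul_zero] }
  have hS : S ≠ ⊤ := by
    intro h
    apply hv
    have : ∀ x : Fin 3 → ℂ, x ⬝ᵥ v = 0 := fun x => by
      have : x ∈ S := h ▸ Submodule.mem_top
      exact this
    funext j
    simpa using this (Pi.single j 1)
  have := Measure.addHaar_submodule (volume : Measure (Fin 3 → ℂ)) S hS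
  rw [ae_iff]
  simpa [S] using this

section

variable {α : Type*} [MeasurableSpace α] (μ : Fin 3 → Measure α) [∀ i, IsProbabilityMeasure (μ i)]

/-- Two different coordinates are independent, so their joint law is a product and Fubini applies.
-/
lemma ae_pi_of_ae_ae {i j : Fin 3} (hij : i ≠ j) {p : α → α → Prop}
    (hp : MeasurableSet {x : α × α | p x.1 x.2}) (h : ∀ᵐ a ∂μ i, ∀ᵐ b ∂μ j, p a b) :
    ∀ᵐ x ∂Measure.pi μ, p (x i) (x j) := by
  have hind : IndepFun (fun x : Fin 3 → α => x i) (fun x => x j) (Measure.pi μ) :=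
    (iIndepFun_pi (μ := μ) (X := fun _ => id) (fun _ => aemeasurable_id)).indepFun hij
  have hmap := (indepFun_iff_map_prod_eq_prod_map_map (measurable_pi_apply i).aemeasurable
    (measurable_pi_apply j).aemeasurable).1 hind
  rw [(measurePreserving_eval μ i).map_eq, (measurePreserving_eval μ j).map_eq] at hmap
  have h2 : ∀ᵐ x ∂(μ i).prod (μ j), p x.1 x.2 := (Measure.ae_prod_iff_ae_ae hp).2 h
  rw [← hmap] at h2
  exact ae_of_ae_map (by fun_prop) h2

lemma pi_fin_three_eq_map :
    Measure.pi μ = ((μ 0).prod ((μ 1).prod (μ 2))).map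
      fun x : α × α × α => (![x.1, x.2.1, x.2.2] : Fin 3 → α) := by
  have hm : Measurable fun x : α × α × α => (![x.1, x.2.1, x.2.2] : Fin 3 → α) := by
    refine measurable_pi_iff.2 fun i => ?_
    fin_cases i <;> simp <;> fun_prop
  refine Measure.pi_eq fun s hs => ?_
  rw [Measure.map_apply hm (MeasurableSet.univ_pi hs)]
  have : (fun x : α × α × α => (![x.1, x.2.1, x.2.2] : Fin 3 → α)) ⁻¹' Set.univ.pi s
      = s 0 ×ˢ (s 1 ×ˢ s 2) := by
    ext x
    simp [Set.mem_pi, Fin.forall_fin_succ]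
  rw [this, Measure.prod_prod, Measure.prod_prod, Fin.prod_univ_three, mul_assoc]

lemma ae_pi_of_ae_ae_ae {p : (Fin 3 → α) → Prop} (hp : MeasurableSet {x | p x})
    (h : ∀ᵐ a ∂μ 0, ∀ᵐ b ∂μ 1, ∀ᵐ c ∂μ 2, p ![a, b, c]) : ∀ᵐ x ∂Measure.pi μ, p x := by
  have hm : Measurable fun x : α × α × α => (![x.1, x.2.1, x.2.2] : Fin 3 → α) := by
    refine measurable_pi_iff.2 fun i => ?_
    fin_cases i <;> simp <;> fun_prop
  rw [pi_fin_three_eq_map, ae_map_iff hm.aemeasurable hp]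
  refine (Measure.ae_prod_iff_ae_ae (hm hp)).2 ?_
  filter_upwards [h] with a ha
  exact (Measure.ae_prod_iff_ae_ae (measurable_prodMk_left (hm hp))).2 ha

end

variable {μ : Fin 3 → Measure (Fin 3 → ℂ)} [∀ i, IsProbabilityMeasure (μ i)]

instance {n : ℕ} : IsProbabilityMeasure (channelLaw μ n) := by
  unfold channelLaw; infer_instance

lemma ae_channelLaw_of_ae_pi {n : ℕ} {p : (Fin 3 → Fin 3 → ℂ) → Prop}
    (h : ∀ᵐ x ∂Measure.pi μ, p x) : ∀ᵐ H ∂channelLaw μ n, ∀ t, p (H t) := by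
  refine ae_all_iff.2 fun t => ?_
  exact (Measure.tendsto_eval_ae_ae (μ := fun _ : Fin n => Measure.pi fun i => μ i)
    (i := t)).eventually h

lemma ae_pi_of_ae {p : (Fin 3 → ℂ) → Prop} (hμ : ∀ i, μ i ≪ volume) (i : Fin 3)
    (h : ∀ᵐ x, p x) : ∀ᵐ x ∂Measure.pi μ, p (x i) :=
  (Measure.tendsto_eval_ae_ae (μ := μ) (i := i)).eventually ((hμ i).ae_le h)

lemma measurable_dotProduct {α : Type*} [MeasurableSpace α] {f g : α → Fin 3 → ℂ}
    (hf : Measurable f) (hg : Measurable g) : Measurable fun x => f x ⬝ᵥ g x := by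
  simp only [dotProduct]
  fun_prop

lemma ae_pi_dotProduct_ne_zero (hμ : ∀ i, μ i ≪ volume) {i j : Fin 3} (hij : i ≠ j)
    {f : (Fin 3 → ℂ) → Fin 3 → ℂ} (hf : Measurable f) (h : ∀ᵐ x, f x ≠ 0) :
    ∀ᵐ x ∂Measure.pi μ, x j ⬝ᵥ f (x i) ≠ 0 := by
  refine ae_pi_of_ae_ae μ hij (p := fun a b => b ⬝ᵥ f a ≠ 0) ?_ ?_
  · exact (measurable_dotProduct measurable_snd (hf.comp measurable_fst))
      (measurableSet_singleton 0).compl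
  · filter_upwards [(hμ i).ae_le h] with a ha
    exact (hμ j).ae_le (ae_dotProduct_ne_zero ha)

lemma ae_apply_zero_ne_zero : ∀ᵐ h : Fin 3 → ℂ, h 0 ≠ 0 := by
  have := ae_dotProduct_ne_zero (v := Pi.single 0 1) (by simp)
  simpa using this

lemma ae_pi_minor_ne_zero (hμ : ∀ i, μ i ≪ volume) {i j : Fin 3} (hij : i ≠ j) :
    ∀ᵐ x ∂Measure.pi μ, x i 0 * x j 1 - x i 1 * x j 0 ≠ 0 := by
  have := ae_pi_dotProduct_ne_zero hμ hij (f := fun h => ![-h 1, h 0, 0])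
    (measurable_pi_iff.2 fun k => by fin_cases k <;> simp <;> fun_prop)
    (by
      filter_upwards [ae_apply_zero_ne_zero] with h hh h0
      exact hh (by simpa using congrFun h0 1))
  filter_upwards [this] with x hx h0
  apply hx
  simp [dotProduct, Fin.sum_univ_three]
  linear_combination h0

/-- The determinant of rows `a, b, c` is `c` paired with the cross product of `a` and `b`. That
product is nonzero for almost every `b`, since its last entry is a `2 × 2` minor linear in `b`;
almost every `c` then avoids the null plane. -/
lemma ae_pi_independent (hμ : ∀ i, μ i ≪ volume) :
    ∀ᵐ x ∂Measure.pi μ, ∀ a : Fin 3 → ℂ, (∀ i, x i ⬝ᵥ a = 0) → a = 0 := by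
  have hdet : ∀ᵐ x ∂Measure.pi μ, (Matrix.of x).det ≠ 0 := by
    refine ae_pi_of_ae_ae_ae μ ?_ ?_
    · have : Measurable fun x : Fin 3 → Fin 3 → ℂ => (Matrix.of x).det := by
        simp only [Matrix.det_fin_three, Matrix.of_apply]
        fun_prop
      exact this (measurableSet_singleton 0).compl
    · filter_upwards [(hμ 0).ae_le ae_apply_zero_ne_zero] with a ha
      have h1 := (hμ 1).ae_le (ae_dotProduct_ne_zero (v := ![-a 1, a 0, 0])
        fun h0 => ha (by simpa using congrFun h0 1))
      filter_upwards [h1] with b hb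
      have h2 := (hμ 2).ae_le (ae_dotProduct_ne_zero (v := crossProduct a b) fun h0 => hb (by
        have := congrFun h0 2
        simp [cross_apply] at this
        simp [dotProduct, Fin.sum_univ_three]
        linear_combination this))
      filter_upwards [h2] with c hc h0
      apply hc
      rw [← h0]
      simp [cross_apply, Matrix.det_fin_three, dotProduct, Fin.sum_univ_three]
      ring
  filter_upwards [hdet] with x hx a ha
  by_contra hne
  apply hx
  exact Matrix.exists_mulVec_eq_zero_iff.1 ⟨a, hne, funext fun i => ha i⟩

/-- A map that vanishes on the kernel of `A` factors through the range of `A` and extends to the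
whole target. This turns "the outputs determine the symbols" into a linear decoder. -/
lemma exists_linearMap_comp_eq {V V' V'' : Type*} [AddCommGroup V] [Module ℂ V] [AddCommGroup V']
    [Module ℂ V'] [AddCommGroup V''] [Module ℂ V''] (A : V →ₗ[ℂ] V') (p : V →ₗ[ℂ] V'')
    (h : ∀ s, A s = 0 → p s = 0) : ∃ g : V' →ₗ[ℂ] V'', ∀ s, g (A s) = p s := by
  obtain ⟨C, hC⟩ := A.rangeRestrict.exists_rightInverse_of_surjective A.range_rangeRestrict
  obtain ⟨g, hg⟩ := (p ∘ₗ C).exists_extend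
  refine ⟨g, fun s => ?_⟩
  have h1 : g (A s) = p (C (A.rangeRestrict s)) := by
    have := LinearMap.congr_fun hg (A.rangeRestrict s)
    simpa using this
  rw [h1, ← sub_eq_zero, ← map_sub]
  apply h
  have h2 : A.rangeRestrict (C (A.rangeRestrict s)) = A.rangeRestrict s :=
    LinearMap.congr_fun hC (A.rangeRestrict s)
  rw [map_sub, sub_eq_zero]
  exact congrArg Subtype.val h2

end

section

/-! ### The two six-slot schemes -/

variable {μ : Fin 3 → Measure (Fin 3 → ℂ)} [∀ i, IsProbabilityMeasure (μ i)]

/-- The channel realizations for which the beams do their job. -/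
structure Beams.Good (b : Beams) (H : Chan 6) : Prop where
  indep : ∀ t a, (∀ i, H t i ⬝ᵥ a = 0) → a = 0
  B_inj : ∀ t v, b.B t (H t 0) *ᵥ v = 0 → v = 0
  C_inj : ∀ t v, b.C t (H t 0) *ᵥ v = 0 → v = 0
  p_ne : ∀ t i, H t i ⬝ᵥ b.p t (H t 0) ≠ 0
  q_ne : ∀ t, ∀ i ≠ 0, H t i ⬝ᵥ b.q t (H t 0) ≠ 0

lemma mulVec_eq_zero_of_linearIndependent {A : Matrix (Fin 3) (Fin 2) ℂ}
    (h : LinearIndependent ℂ A.col) (v : Fin 2 → ℂ) (hv : A *ᵥ v = 0) : v = 0 :=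
  (Matrix.mulVec_injective_iff.2 h) (by rw [hv, mulVec_zero])

lemma Beams.ae_good (b : Beams) (hμ : ∀ i, μ i ≪ volume) : ∀ᵐ H ∂channelLaw μ 6, b.Good H := by
  have key : ∀ t : Fin 6, ∀ᵐ x ∂Measure.pi μ, (∀ a, (∀ i, x i ⬝ᵥ a = 0) → a = 0) ∧
      (∀ v, b.B t (x 0) *ᵥ v = 0 → v = 0) ∧ (∀ v, b.C t (x 0) *ᵥ v = 0 → v = 0) ∧
      (∀ i, x i ⬝ᵥ b.p t (x 0) ≠ 0) ∧ (∀ i ≠ 0, x i ⬝ᵥ b.q t (x 0) ≠ 0) := by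
    intro t
    have hp : ∀ᵐ h, b.p t h ≠ 0 := by
      filter_upwards [b.p_heard t] with h hh h0
      exact hh (by rw [h0, dotProduct_zero])
    filter_upwards [ae_pi_independent hμ, ae_pi_of_ae hμ 0 (b.B_indep t),
      ae_pi_of_ae hμ 0 (b.C_indep t), ae_pi_of_ae hμ 0 (b.p_heard t),
      ae_pi_dotProduct_ne_zero hμ (show (0 : Fin 3) ≠ 1 by decide) (b.p_measurable t) hp,
      ae_pi_dotProduct_ne_zero hμ (show (0 : Fin 3) ≠ 2 by decide) (b.p_measurable t) hp,
      ae_pi_dotProduct_ne_zero hμ (show (0 : Fin 3) ≠ 1 by decide) (b.q_measurable t) (b.q_ne t),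
      ae_pi_dotProduct_ne_zero hμ (show (0 : Fin 3) ≠ 2 by decide) (b.q_measurable t) (b.q_ne t)]
      with x h1 h2 h3 h4 h5 h6 h7 h8
    refine ⟨h1, mulVec_eq_zero_of_linearIndependent h2, mulVec_eq_zero_of_linearIndependent h3,
      fun i => ?_, fun i hi => ?_⟩
    · fin_cases i <;> assumption
    · fin_cases i
      · exact absurd rfl hi
      · exact h7
      · exact h8
  have : ∀ᵐ H ∂channelLaw μ 6, ∀ t, _ := ae_all_iff.2 fun t =>
    (ae_channelLaw_of_ae_pi (n := 6) (key t)).mono fun H h => h t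
  filter_upwards [this] with H h
  exact ⟨fun t => (h t).1, fun t => (h t).2.1, fun t => (h t).2.2.1, fun t => (h t).2.2.2.1,
    fun t => (h t).2.2.2.2⟩

lemma Beams.dot_B (b : Beams) (t : Fin 6) (h : Fin 3 → ℂ) (v : Fin 2 → ℂ) :
    h ⬝ᵥ (b.B t h *ᵥ v) = 0 := by
  rw [dotProduct_mulVec, b.B_zf, zero_dotProduct]

lemma Beams.dot_C (b : Beams) (t : Fin 6) (h : Fin 3 → ℂ) (v : Fin 2 → ℂ) :
    h ⬝ᵥ (b.C t h *ᵥ v) = 0 := by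
  rw [dotProduct_mulVec, b.C_zf, zero_dotProduct]

/-- The linear combination `c • s + s'` of data symbols. -/
def Symbols.comb (c : ℂ) (s s' : Symbols) : Symbols :=
  ⟨c • s.u + s'.u, c • s.v + s'.v, c • s.w + s'.w⟩

lemma vec_comb (c : ℂ) (x y : Fin 6 → ℂ) (i j k : Fin 6) :
    (![(c • x + y) i, (c • x + y) j, (c • x + y) k] : Fin 3 → ℂ)
      = c • ![x i, x j, x k] + ![y i, y j, y k] := by
  funext l; fin_cases l <;> rfl

lemma scheme₁_comb (b : Beams) (H : Chan 6) (c : ℂ) (s s' : Symbols) (t : Fin 6) :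
    scheme₁ b H (.comb c s s') t = c • scheme₁ b H s t + scheme₁ b H s' t := by
  simp only [scheme₁, Symbols.comb, vec_comb, mulVec_add, mulVec_smul, dotProduct_add,
    dotProduct_smul, smul_eq_mul]
  fin_cases t <;> simp only [Fin.reduceFinMk, Matrix.cons_val, Fin.zero_eta, Fin.mk_one] <;>
    funext j <;> simp only [Pi.add_apply, Pi.smul_apply, smul_eq_mul] <;> ring

lemma scheme₂_comb (b : Beams) (H : Chan 6) (c : ℂ) (s s' : Symbols) (t : Fin 6) :
    scheme₂ b H (.comb c s s') t = c • scheme₂ b H s t + scheme₂ b H s' t := by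
  simp only [scheme₂, Symbols.comb, vec_comb, mulVec_add, mulVec_smul, dotProduct_add,
    dotProduct_smul, smul_eq_mul]
  fin_cases t <;> simp only [Fin.reduceFinMk, Matrix.cons_val, Fin.zero_eta, Fin.mk_one] <;>
    funext j <;> simp only [Pi.add_apply, Pi.smul_apply, smul_eq_mul] <;> ring

lemma linearMap_of_comb {V W : Type*} [AddCommGroup V] [Module ℂ V] [AddCommGroup W] [Module ℂ W]
    (f : V → W) (h : ∀ (c : ℂ) x y, f (c • x + y) = c • f x + f y) :
    ∃ L : V →ₗ[ℂ] W, ∀ x, L x = f x := by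
  have h0 : f 0 = 0 := by
    have := h 1 0 0
    simpa using this
  exact ⟨{ toFun := f
           map_add' := fun x y => by simpa using h 1 x y
           map_smul' := fun c x => by simpa [h0] using h c x 0 }, fun _ => rfl⟩

lemma Scheme.isLinear_of_comb {X : Scheme}
    (h : ∀ H c s s' t, X H (.comb c s s') t = c • X H s t + X H s' t) : X.IsLinear := by
  intro H t
  obtain ⟨L, hL⟩ := linearMap_of_comb
    (fun x : (Fin 6 → ℂ) × (Fin 2 → ℂ) × (Fin 2 → ℂ) => X H ⟨x.1, x.2.1, x.2.2⟩ t)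
    fun c x y => h H c ⟨x.1, x.2.1, x.2.2⟩ ⟨y.1, y.2.1, y.2.2⟩ t
  exact ⟨L, fun s => (hL (s.u, s.v, s.w)).symm⟩

/-- Noise-free outputs determine the own data symbols at every receiver, in the form suited to
linear schemes. -/
structure Scheme.Resolves (X : Scheme) (H : Chan 6) : Prop where
  u : ∀ s, (∀ t, H t 0 ⬝ᵥ X H s t = 0) → s.u = 0
  v : ∀ s, (∀ t, H t 1 ⬝ᵥ X H s t = 0) → s.v = 0
  w : ∀ s, (∀ t, H t 2 ⬝ᵥ X H s t = 0) → s.w = 0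

omit [∀ i, IsProbabilityMeasure (μ i)] in
lemma Scheme.decodable_of_resolves {X : Scheme}
    (hX : ∀ H c s s' t, X H (.comb c s s') t = c • X H s t + X H s' t)
    (h : ∀ᵐ H ∂channelLaw μ 6, X.Resolves H) : X.Decodable μ := by
  filter_upwards [h] with H hH
  have key : ∀ i : Fin 3, ∃ A : ((Fin 6 → ℂ) × (Fin 2 → ℂ) × (Fin 2 → ℂ)) →ₗ[ℂ] (Fin 6 → ℂ),
      ∀ x, A x = output H i (X H ⟨x.1, x.2.1, x.2.2⟩) 0 := fun i =>
    linearMap_of_comb _ fun c x y => by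
      funext t
      have := hX H c ⟨x.1, x.2.1, x.2.2⟩ ⟨y.1, y.2.1, y.2.2⟩ t
      simp only [Symbols.comb] at this
      simp only [output, Pi.zero_apply, add_zero, Pi.add_apply, Pi.smul_apply, Prod.fst_add,
        Prod.snd_add, Prod.smul_fst, Prod.smul_snd, this, dotProduct_add, dotProduct_smul]
  have zero : ∀ i s, output H i (X H s) 0 = 0 → ∀ t, H t i ⬝ᵥ X H s t = 0 := fun i s h t => by
    simpa [output] using congrFun h t
  obtain ⟨A₁, h₁⟩ := key 0
  obtain ⟨A₂, h₂⟩ := key 1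
  obtain ⟨A₃, h₃⟩ := key 2
  obtain ⟨g₁, e₁⟩ := exists_linearMap_comp_eq A₁ (LinearMap.fst ℂ _ _) fun x hx =>
    hH.u ⟨x.1, x.2.1, x.2.2⟩ (zero 0 _ ((h₁ x).symm.trans hx))
  obtain ⟨g₂, e₂⟩ := exists_linearMap_comp_eq A₂ (LinearMap.fst ℂ _ _ ∘ₗ LinearMap.snd ℂ _ _)
    fun x hx => hH.v ⟨x.1, x.2.1, x.2.2⟩ (zero 1 _ ((h₂ x).symm.trans hx))
  obtain ⟨g₃, e₃⟩ := exists_linearMap_comp_eq A₃ (LinearMap.snd ℂ _ _ ∘ₗ LinearMap.snd ℂ _ _)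
    fun x hx => hH.w ⟨x.1, x.2.1, x.2.2⟩ (zero 2 _ ((h₃ x).symm.trans hx))
  refine ⟨g₁, g₂, g₃, fun s => ⟨?_, ?_, ?_⟩⟩
  · have := e₁ (s.u, s.v, s.w); rw [h₁] at this; exact this
  · have := e₂ (s.u, s.v, s.w); rw [h₂] at this; exact this
  · have := e₃ (s.u, s.v, s.w); rw [h₃] at this; exact this

lemma eq_zero_of_vec_eq_zero {u : Fin 6 → ℂ} (h : (![u 0, u 1, u 2] : Fin 3 → ℂ) = 0)
    (h' : (![u 3, u 4, u 5] : Fin 3 → ℂ) = 0) : u = 0 := by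
  funext k
  fin_cases k
  exacts [congrFun h 0, congrFun h 1, congrFun h 2, congrFun h' 0, congrFun h' 1, congrFun h' 2]

lemma forall_fin_three {P : Fin 3 → Prop} (h0 : P 0) (h1 : P 1) (h2 : P 2) : ∀ i, P i := by
  intro i; fin_cases i <;> assumption

lemma of_forall_fin_six {P : Fin 6 → Prop} (h : ∀ t, P t) :
    P 0 ∧ P 1 ∧ P 2 ∧ P 3 ∧ P 4 ∧ P 5 := ⟨h 0, h 1, h 2, h 3, h 4, h 5⟩

/-- Receiver 1 hears nothing along `B` and `q`, so slots 3 and 4 give it `l₂` and `l₆`; `k₁` and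
`k₂` then give `l₅` and `l₃`, which completes three independent equations for each of `a` and `a'`.
Receiver 2 has `l₅ + n₁` from slot 2, extracts `l₂` from slot 3 and cleans slot 1. Its output in
slot 4 is `k₂` plus a nonzero multiple of `m₂`, so slot 6 isolates `m₂`, the second equation for
`v`; zero-forcing at receiver 1 is the third. Receiver 3 acts symmetrically. -/
lemma scheme₁_resolves (b : Beams) {H : Chan 6} (hH : b.Good H) : (scheme₁ b).Resolves H := by
  have ex := fun s i (h : ∀ t, H t i ⬝ᵥ scheme₁ b H s t = 0) => of_forall_fin_six h
  simp only [scheme₁, Matrix.cons_val, dotProduct_add, dotProduct_smul, smul_eq_mul] at ex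
  constructor
  · intro s h
    obtain ⟨e0, e1, e2, e3, e4, e5⟩ := ex s 0 h
    simp only [b.dot_B, b.q_zf, mul_zero, add_zero, mul_eq_zero, hH.p_ne, or_false] at e0 e1 e2 e3 e4 e5
    simp only [e2, e3, mul_zero, zero_add, mul_eq_zero, hH.q_ne _ 1 (by decide),
      hH.q_ne _ 2 (by decide), false_or] at e4 e5
    exact eq_zero_of_vec_eq_zero (hH.indep 0 _ (forall_fin_three e0 e2 e5))
      (hH.indep 1 _ (forall_fin_three e1 e4 e3))
  · intro s h
    obtain ⟨e0, e1, e2, e3, e4, e5⟩ := ex s 1 h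
    simp only [mul_eq_zero, hH.p_ne, or_false] at e5
    rw [e1, zero_mul, add_zero, mul_eq_zero, or_iff_left (hH.p_ne _ _)] at e2
    rw [e2, zero_add] at e0
    have e6 : H 0 2 ⬝ᵥ b.B 0 (H 0 0) *ᵥ s.v = 0 := by
      have : H 0 2 ⬝ᵥ b.B 0 (H 0 0) *ᵥ s.v * H 3 1 ⬝ᵥ b.q 3 (H 3 0) = 0 := by
        linear_combination e3 - e5
      exact (mul_eq_zero.1 this).resolve_right (hH.q_ne _ _ (by decide))
    exact hH.B_inj 0 _ (hH.indep 0 _ (forall_fin_three (b.dot_B _ _ _) e0 e6))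
  · intro s h
    obtain ⟨e0, e1, e2, e3, e4, e5⟩ := ex s 2 h
    simp only [mul_eq_zero, hH.p_ne, or_false] at e4
    rw [e0, zero_mul, add_zero, mul_eq_zero, or_iff_left (hH.p_ne _ _)] at e3
    rw [e3, zero_add] at e1
    have e6 : H 1 1 ⬝ᵥ b.B 1 (H 1 0) *ᵥ s.w = 0 := by
      have : H 1 1 ⬝ᵥ b.B 1 (H 1 0) *ᵥ s.w * H 2 2 ⬝ᵥ b.q 2 (H 2 0) = 0 := by
        linear_combination e2 - e4
      exact (mul_eq_zero.1 this).resolve_right (hH.q_ne _ _ (by decide))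
    exact hH.B_inj 1 _ (hH.indep 1 _ (forall_fin_three (b.dot_B _ _ _) e6 e1))

/-- Here slot 1 mixes all symbols. Receiver 2 knows `l₅` from slot 2, so slot 3 gives it the whole
interference `l₂ + n₁` of slot 1; receiver 3 similarly obtains `l₃ + m₂` from slot 4. The remaining
equations come as in the first scheme. -/
lemma scheme₂_resolves (b : Beams) {H : Chan 6} (hH : b.Good H) : (scheme₂ b).Resolves H := by
  have ex := fun s i (h : ∀ t, H t i ⬝ᵥ scheme₂ b H s t = 0) => of_forall_fin_six h
  simp only [scheme₂, Matrix.cons_val, dotProduct_add, dotProduct_smul, smul_eq_mul] at ex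
  constructor
  · intro s h
    obtain ⟨e0, e1, e2, e3, e4, e5⟩ := ex s 0 h
    simp only [b.dot_B, b.dot_C, b.q_zf, mul_zero, add_zero, mul_eq_zero, hH.p_ne, or_false]
      at e0 e1 e2 e3 e4 e5
    simp only [e2, e3, mul_zero, zero_add, mul_eq_zero, hH.q_ne _ 1 (by decide),
      hH.q_ne _ 2 (by decide), false_or] at e4 e5
    exact eq_zero_of_vec_eq_zero (hH.indep 0 _ (forall_fin_three e0 e4 e5))
      (hH.indep 1 _ (forall_fin_three e1 e2 e3))
  · intro s h
    obtain ⟨e0, e1, e2, e3, e4, e5⟩ := ex s 1 h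
    simp only [mul_eq_zero, hH.p_ne, or_false] at e5
    rw [e1, zero_mul, zero_add, mul_eq_zero, or_iff_left (hH.q_ne _ _ (by decide))] at e2
    have e7 : H 0 1 ⬝ᵥ b.B 0 (H 0 0) *ᵥ s.v = 0 := by linear_combination e0 - e2
    have e6 : H 0 2 ⬝ᵥ b.B 0 (H 0 0) *ᵥ s.v = 0 := by
      have : H 0 2 ⬝ᵥ b.B 0 (H 0 0) *ᵥ s.v * H 3 1 ⬝ᵥ b.q 3 (H 3 0) = 0 := by
        linear_combination e3 - e5
      exact (mul_eq_zero.1 this).resolve_right (hH.q_ne _ _ (by decide))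
    exact hH.B_inj 0 _ (hH.indep 0 _ (forall_fin_three (b.dot_B _ _ _) e7 e6))
  · intro s h
    obtain ⟨e0, e1, e2, e3, e4, e5⟩ := ex s 2 h
    simp only [mul_eq_zero, hH.p_ne, or_false] at e4
    rw [e1, zero_mul, zero_add, mul_eq_zero, or_iff_left (hH.q_ne _ _ (by decide))] at e3
    have e7 : H 0 2 ⬝ᵥ b.C 0 (H 0 0) *ᵥ s.w = 0 := by linear_combination e0 - e3
    have e6 : H 0 1 ⬝ᵥ b.C 0 (H 0 0) *ᵥ s.w = 0 := by
      have : H 0 1 ⬝ᵥ b.C 0 (H 0 0) *ᵥ s.w * H 2 2 ⬝ᵥ b.q 2 (H 2 0) = 0 := by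
        linear_combination e2 - e4
      exact (mul_eq_zero.1 this).resolve_right (hH.q_ne _ _ (by decide))
    exact hH.C_inj 0 _ (hH.indep 0 _ (forall_fin_three (b.dot_C _ _ _) e6 e7))

/-! ### Causality of the six-slot schemes. -/

lemma scheme₁_respectsCSIT (b : Beams) (s : Symbols) :
    RespectsCSIT {0} (fun H => scheme₁ b H s) := by
  intro t H H' h0 h
  have h0' : ∀ r ≤ t, H r 0 = H' r 0 := h0 0 rfl
  fin_cases t
  · have := h0' 0 (by decide)
    simp [scheme₁, this]
  · have := h0' 1 (by decide)
    simp [scheme₁, this]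
  · simp [scheme₁, h0' 2 (by decide), h0' 1 (by decide), h _ 0 (by decide), h _ 1 (by decide)]
  · simp [scheme₁, h0' 3 (by decide), h _ 0 (by decide), h _ 1 (by decide), h _ 2 (by decide)]
  · simp [scheme₁, h0' 4 (by decide), h _ 0 (by decide), h _ 1 (by decide), h _ 2 (by decide)]
  · simp [scheme₁, h0' 5 (by decide), h _ 0 (by decide), h _ 1 (by decide), h _ 3 (by decide)]

lemma scheme₂_respectsCSIT (b : Beams) (s : Symbols) :
    RespectsCSIT {0} (fun H => scheme₂ b H s) := by
  intro t H H' h0 h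
  have h0' : ∀ r ≤ t, H r 0 = H' r 0 := h0 0 rfl
  fin_cases t
  · have := h0' 0 (by decide)
    simp [scheme₂, this]
  · simp [scheme₂]
  · simp [scheme₂, h0' 2 (by decide), h _ 0 (by decide), h _ 1 (by decide)]
  · simp [scheme₂, h0' 3 (by decide), h _ 0 (by decide), h _ 1 (by decide)]
  · simp [scheme₂, h0' 4 (by decide), h _ 0 (by decide), h _ 1 (by decide), h _ 2 (by decide)]
  · simp [scheme₂, h0' 5 (by decide), h _ 0 (by decide), h _ 1 (by decide), h _ 3 (by decide)]

theorem six_slot_schemes (hμ : ∀ i, μ i ≪ volume) (b : Beams) :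
    ∀ X ∈ ({scheme₁ b, scheme₂ b} : Set Scheme),
      X.IsLinear ∧ (∀ s, RespectsCSIT {0} (fun H => X H s)) ∧ X.Decodable μ := by
  rintro X (rfl | rfl)
  · exact ⟨Scheme.isLinear_of_comb (scheme₁_comb b), scheme₁_respectsCSIT b,
      Scheme.decodable_of_resolves (scheme₁_comb b)
        ((b.ae_good hμ).mono fun _ h => scheme₁_resolves b h)⟩
  · exact ⟨Scheme.isLinear_of_comb (scheme₂_comb b), scheme₂_respectsCSIT b,
      Scheme.decodable_of_resolves (scheme₂_comb b)
        ((b.ae_good hμ).mono fun _ h => scheme₂_resolves b h)⟩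

end

section

/-! ### Linear schemes -/

/-- The data symbols of one block, `κ i` of them for receiver `i`. -/
abbrev Sym (κ : Fin 3 → ℕ) : Type := (i : Fin 3) → Fin (κ i) → ℂ

/-- A linear scheme over `T` slots, with `κ i` data symbols for receiver `i`. -/
structure LinScheme (I : Set (Fin 3)) (T : ℕ) (κ : Fin 3 → ℕ) where
  X : Chan T → Sym κ → Fin T → Fin 3 → ℂ
  comb : ∀ H (c : ℂ) s s' t, X H (c • s + s') t = c • X H s t + X H s' t
  meas : ∀ s, Measurable fun H => X H s
  causal : ∀ s, RespectsCSIT I fun H => X H s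

/-- At almost every channel realization, the noise-free outputs of each receiver determine its own
data symbols. -/
def LinScheme.Resolves {I : Set (Fin 3)} {T : ℕ} {κ : Fin 3 → ℕ} (S : LinScheme I T κ)
    (μ : Fin 3 → Measure (Fin 3 → ℂ)) : Prop :=
  ∀ i, ∀ᵐ H ∂channelLaw μ T, ∀ s, (∀ t, H t i ⬝ᵥ S.X H s t = 0) → s i = 0

lemma measurable_vec_three {α : Type*} [MeasurableSpace α] {f g h : α → ℂ} (hf : Measurable f)
    (hg : Measurable g) (hh : Measurable h) : Measurable fun x => (![f x, g x, h x] : Fin 3 → ℂ) :=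
  measurable_pi_iff.2 fun i => by fin_cases i <;> assumption

open scoped ComplexOrder in
/-- Zero-forcing beams given by explicit formulas. -/
noncomputable def explicitBeams : Beams where
  B _ h := !![-h 1, -h 2; h 0, 0; 0, h 0]
  C _ h := !![-h 1, -h 2; h 0, 0; 0, h 0]
  q _ h := ![-h 1, h 0, 0]
  p _ h := star h
  B_measurable _ j k := by fin_cases j <;> fin_cases k <;> simp <;> fun_prop
  C_measurable _ j k := by fin_cases j <;> fin_cases k <;> simp <;> fun_prop
  q_measurable _ := measurable_vec_three (by fun_prop) (by fun_prop) (by fun_prop)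
  p_measurable _ := continuous_star.measurable
  B_zf _ h := by
    funext k
    fin_cases k <;> simp [vecMul, dotProduct, Fin.sum_univ_three] <;> ring
  C_zf _ h := by
    funext k
    fin_cases k <;> simp [vecMul, dotProduct, Fin.sum_univ_three] <;> ring
  q_zf _ h := by
    simp [dotProduct, Fin.sum_univ_three]; ring
  B_indep _ := by
    filter_upwards [ae_apply_zero_ne_zero] with h hh
    rw [← Matrix.mulVec_injective_iff]
    refine (injective_iff_map_eq_zero (Matrix.mulVecLin _)).2 fun v hv => ?_
    have h1 := congrFun hv 1
    have h2 := congrFun hv 2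
    simp [mulVec, dotProduct, hh] at h1 h2
    funext k; fin_cases k <;> assumption
  C_indep _ := by
    filter_upwards [ae_apply_zero_ne_zero] with h hh
    rw [← Matrix.mulVec_injective_iff]
    refine (injective_iff_map_eq_zero (Matrix.mulVecLin _)).2 fun v hv => ?_
    have h1 := congrFun hv 1
    have h2 := congrFun hv 2
    simp [mulVec, dotProduct, hh] at h1 h2
    funext k; fin_cases k <;> assumption
  q_ne _ := by
    filter_upwards [ae_apply_zero_ne_zero] with h hh h0
    exact hh (by simpa using congrFun h0 1)
  p_heard _ := by
    filter_upwards [ae_apply_zero_ne_zero] with h hh h0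
    rw [dotProduct_comm, dotProduct_star_self_eq_zero] at h0
    exact hh (congrFun h0 0)

lemma measurable_mulVec {α : Type*} [MeasurableSpace α] {A : α → Matrix (Fin 3) (Fin 2) ℂ}
    (hA : ∀ j k, Measurable fun x => A x j k) (v : Fin 2 → ℂ) :
    Measurable fun x => A x *ᵥ v := by
  refine measurable_pi_iff.2 fun j => ?_
  simp only [mulVec, dotProduct]
  exact Finset.measurable_sum _ fun k _ => (hA j k).mul_const _

lemma scheme₁_measurable (b : Beams) (s : Symbols) : Measurable fun H => scheme₁ b H s := by
  have hH : ∀ t i, Measurable fun H : Chan 6 => H t i := fun t i => by fun_prop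
  have hB : ∀ t v, Measurable fun H : Chan 6 => b.B t (H t 0) *ᵥ v := fun t v =>
    (measurable_mulVec (b.B_measurable t) v).comp (hH t 0)
  have hp : ∀ t, Measurable fun H : Chan 6 => b.p t (H t 0) := fun t =>
    (b.p_measurable t).comp (hH t 0)
  have hq : ∀ t, Measurable fun H : Chan 6 => b.q t (H t 0) := fun t =>
    (b.q_measurable t).comp (hH t 0)
  have hd : ∀ t i (v : Fin 3 → ℂ), Measurable fun H : Chan 6 => H t i ⬝ᵥ v := fun t i v =>
    measurable_dotProduct (hH t i) measurable_const
  have hdB : ∀ t i v, Measurable fun H : Chan 6 => H t i ⬝ᵥ (b.B t (H t 0) *ᵥ v) := fun t i v =>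
    measurable_dotProduct (hH t i) (hB t v)
  have hdp : ∀ t i, Measurable fun H : Chan 6 => H t i ⬝ᵥ b.p t (H t 0) := fun t i =>
    measurable_dotProduct (hH t i) (hp t)
  have hdq : ∀ t i, Measurable fun H : Chan 6 => H t i ⬝ᵥ b.q t (H t 0) := fun t i =>
    measurable_dotProduct (hH t i) (hq t)
  refine measurable_pi_iff.2 fun t => ?_
  fin_cases t
  · exact measurable_const.add (hB 0 _)
  · exact measurable_const.add (hB 1 _)
  · exact ((hd 0 1 _).smul (hp 2)).add (((hd 1 1 _).add (hdB 1 1 _)).smul (hq 2))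
  · exact ((hd 1 2 _).smul (hp 3)).add (((hd 0 2 _).add (hdB 0 2 _)).smul (hq 3))
  · exact (((hdp 2 2).mul (hd 0 1 _)).add ((hdq 2 2).mul (hd 1 1 _))).smul (hp 4)
  · exact (((hdp 3 1).mul (hd 1 2 _)).add ((hdq 3 1).mul (hd 0 2 _))).smul (hp 5)

/-- The first six-slot scheme with explicit beams. -/
noncomputable def hybridScheme : LinScheme {0} 6 ![6, 2, 2] where
  X H s := scheme₁ explicitBeams H ⟨s 0, s 1, s 2⟩
  comb H c s s' t := scheme₁_comb explicitBeams H c ⟨s 0, s 1, s 2⟩ ⟨s' 0, s' 1, s' 2⟩ t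
  meas _ := scheme₁_measurable _ _
  causal _ := scheme₁_respectsCSIT _ _

lemma hybridScheme_resolves {μ : Fin 3 → Measure (Fin 3 → ℂ)} [∀ i, IsProbabilityMeasure (μ i)]
    (hμ : ∀ i, μ i ≪ volume) : hybridScheme.Resolves μ := by
  intro i
  filter_upwards [explicitBeams.ae_good hμ] with H hH s hs
  have := scheme₁_resolves _ hH
  fin_cases i
  · exact this.u ⟨s 0, s 1, s 2⟩ hs
  · exact this.v ⟨s 0, s 1, s 2⟩ hs
  · exact this.w ⟨s 0, s 1, s 2⟩ hs

/-! ### The eleven-slot scheme for delayed CSIT -/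

/-- The transmitted vectors. In slots `0` to `5` three symbols of one receiver are sent; slots `6`
to `8` serve pairs of receivers with sums of overheard equations, and the last two slots serve all
three receivers. -/
def delayedX (H : Chan 11) (s : Sym fun _ => 6) : Fin 11 → Fin 3 → ℂ :=
  let a : Fin 3 → Fin 3 → ℂ := fun i => ![s i 0, s i 1, s i 2]
  let a' : Fin 3 → Fin 3 → ℂ := fun i => ![s i 3, s i 4, s i 5]
  let x₆ : Fin 3 → ℂ := ![H 0 1 ⬝ᵥ a 0 + H 1 0 ⬝ᵥ a 1, H 3 1 ⬝ᵥ a' 0 + H 4 0 ⬝ᵥ a' 1, 0]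
  let x₇ : Fin 3 → ℂ := ![H 0 2 ⬝ᵥ a 0 + H 2 0 ⬝ᵥ a 2, H 3 2 ⬝ᵥ a' 0 + H 5 0 ⬝ᵥ a' 2, 0]
  let x₈ : Fin 3 → ℂ := ![H 1 2 ⬝ᵥ a 1 + H 2 1 ⬝ᵥ a 2, H 4 2 ⬝ᵥ a' 1 + H 5 1 ⬝ᵥ a' 2, 0]
  ![a 0, a 1, a 2, a' 0, a' 1, a' 2, x₆, x₇, x₈,
    ![H 8 0 ⬝ᵥ x₈ + H 7 1 ⬝ᵥ x₇ + H 6 2 ⬝ᵥ x₆, 0, 0],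
    ![H 8 0 ⬝ᵥ x₈ + 2 * H 7 1 ⬝ᵥ x₇ + 3 * H 6 2 ⬝ᵥ x₆, 0, 0]]

lemma vec_three_comb (c x y z x' y' z' : ℂ) :
    (![c * x + x', c * y + y', c * z + z'] : Fin 3 → ℂ) = c • ![x, y, z] + ![x', y', z'] := by
  funext l; fin_cases l <;> rfl

lemma delayedX_comb (H : Chan 11) (c : ℂ) (s s' : Sym fun _ => 6) (t : Fin 11) :
    delayedX H (c • s + s') t = c • delayedX H s t + delayedX H s' t := by
  simp only [delayedX, Pi.add_apply, Pi.smul_apply, smul_eq_mul, vec_three_comb, dotProduct_add,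
    dotProduct_smul]
  fin_cases t <;> simp only [Fin.reduceFinMk, Matrix.cons_val, Fin.zero_eta, Fin.mk_one] <;>
    funext j <;> fin_cases j <;>
    simp [dotProduct, Fin.sum_univ_three] <;> ring

lemma delayedX_measurable (s : Sym fun _ => 6) : Measurable fun H => delayedX H s := by
  have hH : ∀ t i, Measurable fun H : Chan 11 => H t i := fun t i => by fun_prop
  have hd : ∀ t i (v : Fin 3 → ℂ), Measurable fun H : Chan 11 => H t i ⬝ᵥ v := fun t i v =>
    measurable_dotProduct (hH t i) measurable_const
  have h6 : Measurable fun H => delayedX H s 6 :=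
    measurable_vec_three ((hd 0 1 _).add (hd 1 0 _)) ((hd 3 1 _).add (hd 4 0 _)) measurable_const
  have h7 : Measurable fun H => delayedX H s 7 :=
    measurable_vec_three ((hd 0 2 _).add (hd 2 0 _)) ((hd 3 2 _).add (hd 5 0 _)) measurable_const
  have h8 : Measurable fun H => delayedX H s 8 :=
    measurable_vec_three ((hd 1 2 _).add (hd 2 1 _)) ((hd 4 2 _).add (hd 5 1 _)) measurable_const
  have o0 := measurable_dotProduct (hH 8 0) h8
  have o1 := measurable_dotProduct (hH 7 1) h7
  have o2 := measurable_dotProduct (hH 6 2) h6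
  refine measurable_pi_iff.2 fun t => ?_
  fin_cases t
  iterate 6 exact measurable_const
  · exact h6
  · exact h7
  · exact h8
  · exact measurable_vec_three ((o0.add o1).add o2) measurable_const measurable_const
  · exact measurable_vec_three ((o0.add (o1.const_mul 2)).add (o2.const_mul 3)) measurable_const
      measurable_const

lemma delayedX_six (H : Chan 11) (s : Sym fun _ => 6) : delayedX H s 6 =
    ![H 0 1 ⬝ᵥ ![s 0 0, s 0 1, s 0 2] + H 1 0 ⬝ᵥ ![s 1 0, s 1 1, s 1 2],
      H 3 1 ⬝ᵥ ![s 0 3, s 0 4, s 0 5] + H 4 0 ⬝ᵥ ![s 1 3, s 1 4, s 1 5], 0] := rfl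

lemma delayedX_seven (H : Chan 11) (s : Sym fun _ => 6) : delayedX H s 7 =
    ![H 0 2 ⬝ᵥ ![s 0 0, s 0 1, s 0 2] + H 2 0 ⬝ᵥ ![s 2 0, s 2 1, s 2 2],
      H 3 2 ⬝ᵥ ![s 0 3, s 0 4, s 0 5] + H 5 0 ⬝ᵥ ![s 2 3, s 2 4, s 2 5], 0] := rfl

lemma delayedX_eight (H : Chan 11) (s : Sym fun _ => 6) : delayedX H s 8 =
    ![H 1 2 ⬝ᵥ ![s 1 0, s 1 1, s 1 2] + H 2 1 ⬝ᵥ ![s 2 0, s 2 1, s 2 2],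
      H 4 2 ⬝ᵥ ![s 1 3, s 1 4, s 1 5] + H 5 1 ⬝ᵥ ![s 2 3, s 2 4, s 2 5], 0] := rfl

lemma delayedX_nine (H : Chan 11) (s : Sym fun _ => 6) : delayedX H s 9 =
    ![H 8 0 ⬝ᵥ delayedX H s 8 + H 7 1 ⬝ᵥ delayedX H s 7 + H 6 2 ⬝ᵥ delayedX H s 6, 0, 0] := rfl

lemma delayedX_ten (H : Chan 11) (s : Sym fun _ => 6) : delayedX H s 10 =
    ![H 8 0 ⬝ᵥ delayedX H s 8 + 2 * H 7 1 ⬝ᵥ delayedX H s 7 + 3 * H 6 2 ⬝ᵥ delayedX H s 6,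
      0, 0] := rfl

lemma forall_fin_eleven {P : Fin 11 → Prop} (h0 : P 0) (h1 : P 1) (h2 : P 2) (h3 : P 3) (h4 : P 4)
    (h5 : P 5) (h6 : P 6) (h7 : P 7) (h8 : P 8) (h9 : P 9) (h10 : P 10) : ∀ t, P t := by
  intro t; fin_cases t <;> assumption

lemma delayedX_respectsCSIT (s : Sym fun _ => 6) : RespectsCSIT ∅ fun H => delayedX H s := by
  suffices ∀ t (H H' : Chan 11), (∀ r < t, H r = H' r) → delayedX H s t = delayedX H' s t from
    fun t H H' _ h => this t H H' fun r hr => funext fun i => h i r hr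
  have h6 : ∀ H H' : Chan 11, (∀ r < 6, H r = H' r) → delayedX H s 6 = delayedX H' s 6 :=
    fun H H' h' => by
    rw [delayedX_six, delayedX_six, h' 0 (by decide), h' 1 (by decide), h' 3 (by decide),
      h' 4 (by decide)]
  have h7 : ∀ H H' : Chan 11, (∀ r < 7, H r = H' r) → delayedX H s 7 = delayedX H' s 7 :=
    fun H H' h' => by
    rw [delayedX_seven, delayedX_seven, h' 0 (by decide), h' 2 (by decide), h' 3 (by decide),
      h' 5 (by decide)]
  have h8 : ∀ H H' : Chan 11, (∀ r < 8, H r = H' r) → delayedX H s 8 = delayedX H' s 8 :=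
    fun H H' h' => by
    rw [delayedX_eight, delayedX_eight, h' 1 (by decide), h' 2 (by decide), h' 4 (by decide),
      h' 5 (by decide)]
  have e0 : ∀ H, delayedX H s 0 = ![s 0 0, s 0 1, s 0 2] := fun _ => rfl
  have e1 : ∀ H, delayedX H s 1 = ![s 1 0, s 1 1, s 1 2] := fun _ => rfl
  have e2 : ∀ H, delayedX H s 2 = ![s 2 0, s 2 1, s 2 2] := fun _ => rfl
  have e3 : ∀ H, delayedX H s 3 = ![s 0 3, s 0 4, s 0 5] := fun _ => rfl
  have e4 : ∀ H, delayedX H s 4 = ![s 1 3, s 1 4, s 1 5] := fun _ => rfl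
  have e5 : ∀ H, delayedX H s 5 = ![s 2 3, s 2 4, s 2 5] := fun _ => rfl
  refine forall_fin_eleven (fun H H' _ => by rw [e0, e0]) (fun H H' _ => by rw [e1, e1])
    (fun H H' _ => by rw [e2, e2]) (fun H H' _ => by rw [e3, e3]) (fun H H' _ => by rw [e4, e4])
    (fun H H' _ => by rw [e5, e5]) h6 h7 h8 (fun H H' h => ?_) (fun H H' h => ?_)
  · rw [delayedX_nine, delayedX_nine, h6 H H' fun r hr => h r (hr.trans (by decide)),
      h7 H H' fun r hr => h r (hr.trans (by decide)),
      h8 H H' fun r hr => h r (hr.trans (by decide)), h 6 (by decide), h 7 (by decide),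
      h 8 (by decide)]
  · rw [delayedX_ten, delayedX_ten, h6 H H' fun r hr => h r (hr.trans (by decide)),
      h7 H H' fun r hr => h r (hr.trans (by decide)),
      h8 H H' fun r hr => h r (hr.trans (by decide)), h 6 (by decide), h 7 (by decide),
      h 8 (by decide)]

/-- The eleven-slot scheme. -/
def delayedScheme : LinScheme ∅ 11 fun _ => 6 where
  X := delayedX
  comb := delayedX_comb
  meas := delayedX_measurable
  causal := delayedX_respectsCSIT

lemma dotProduct_vec_three (h : Fin 3 → ℂ) (x y z : ℂ) :
    h ⬝ᵥ ![x, y, z] = h 0 * x + h 1 * y + h 2 * z := by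
  simp [dotProduct, Fin.sum_univ_three]

lemma eq_zero_of_minor_ne_zero {a b c d x y : ℂ} (h : a * d - b * c ≠ 0)
    (h1 : a * x + b * y = 0) (h2 : c * x + d * y = 0) : x = 0 ∧ y = 0 := by
  constructor
  · exact (mul_eq_zero.1 (show (a * d - b * c) * x = 0 by
      linear_combination d * h1 - b * h2)).resolve_left h
  · exact (mul_eq_zero.1 (show (a * d - b * c) * y = 0 by
      linear_combination a * h2 - c * h1)).resolve_left h

/-- The phases are undone backwards. Of the three quantities mixed in slots `9` and `10`, each
receiver heard one itself, so two combinations give it the other two. Each of these is a second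
equation about a two-entry vector of slots `6` to `8`. An entry of a vector meant for a pair is a
sum of an equation wanted and one already received, so each vector yields one missing equation per
triple. -/
lemma delayedScheme_resolves {μ : Fin 3 → Measure (Fin 3 → ℂ)} [∀ i, IsProbabilityMeasure (μ i)]
    (hμ : ∀ i, μ i ≪ volume) : delayedScheme.Resolves μ := by
  have hminor : ∀ᵐ x ∂Measure.pi μ, ∀ i j, i ≠ j → x i 0 * x j 1 - x i 1 * x j 0 ≠ 0 := by
    simp only [ae_all_iff]
    exact fun i j hij => ae_pi_minor_ne_zero hμ hij
  have hzero : ∀ᵐ x ∂Measure.pi μ, ∀ i, x i 0 ≠ 0 :=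
    ae_all_iff.2 fun i => ae_pi_of_ae hμ i ae_apply_zero_ne_zero
  intro i
  filter_upwards [ae_channelLaw_of_ae_pi hminor, ae_channelLaw_of_ae_pi hzero,
    ae_channelLaw_of_ae_pi (ae_pi_independent hμ)] with H hm h0 hi s hs
  have e9 : H 9 i ⬝ᵥ delayedX H s 9 = 0 := hs 9
  have e10 : H 10 i ⬝ᵥ delayedX H s 10 = 0 := hs 10
  have e6 : H 6 i ⬝ᵥ delayedX H s 6 = 0 := hs 6
  have e7 : H 7 i ⬝ᵥ delayedX H s 7 = 0 := hs 7
  have e8 : H 8 i ⬝ᵥ delayedX H s 8 = 0 := hs 8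
  have e0 : H 0 i ⬝ᵥ ![s 0 0, s 0 1, s 0 2] = 0 := hs 0
  have e1 : H 1 i ⬝ᵥ ![s 1 0, s 1 1, s 1 2] = 0 := hs 1
  have e2 : H 2 i ⬝ᵥ ![s 2 0, s 2 1, s 2 2] = 0 := hs 2
  have e3 : H 3 i ⬝ᵥ ![s 0 3, s 0 4, s 0 5] = 0 := hs 3
  have e4 : H 4 i ⬝ᵥ ![s 1 3, s 1 4, s 1 5] = 0 := hs 4
  have e5 : H 5 i ⬝ᵥ ![s 2 3, s 2 4, s 2 5] = 0 := hs 5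
  rw [delayedX_nine, dotProduct_vec_three, mul_zero, mul_zero, add_zero, add_zero, mul_eq_zero,
    or_iff_right (h0 _ _)] at e9
  rw [delayedX_ten, dotProduct_vec_three, mul_zero, mul_zero, add_zero, add_zero, mul_eq_zero,
    or_iff_right (h0 _ _)] at e10
  clear hs
  obtain rfl | rfl | rfl : i = 0 ∨ i = 1 ∨ i = 2 := by fin_cases i <;> decide
  -- The coefficient rows `(1, 1, 1)` and `(1, 2, 3)` have all `2 × 2` minors nonzero, so whichever
  -- of the three summands is known, the other two can be solved for.
  · have o2 : H 6 2 ⬝ᵥ delayedX H s 6 = 0 := by linear_combination (e10 - 2 * e9 + e8)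
    have o1 : H 7 1 ⬝ᵥ delayedX H s 7 = 0 := by linear_combination e9 - e8 - o2
    simp only [delayedX_six, delayedX_seven, dotProduct_vec_three (H 6 _),
      dotProduct_vec_three (H 7 _), mul_zero, add_zero, e1, e2, e4, e5] at e6 e7 o1 o2
    obtain ⟨a1, a1'⟩ := eq_zero_of_minor_ne_zero (hm 6 0 2 (by decide)) e6 o2
    obtain ⟨a2, a2'⟩ := eq_zero_of_minor_ne_zero (hm 7 0 1 (by decide)) e7 o1
    exact eq_zero_of_vec_eq_zero (hi 0 _ (forall_fin_three e0 a1 a2))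
      (hi 3 _ (forall_fin_three e3 a1' a2'))
  · have o2 : H 6 2 ⬝ᵥ delayedX H s 6 = 0 := by linear_combination (e10 - e9 - e7) / 2
    have o0 : H 8 0 ⬝ᵥ delayedX H s 8 = 0 := by linear_combination e9 - e7 - o2
    simp only [delayedX_six, delayedX_eight, dotProduct_vec_three (H 6 _),
      dotProduct_vec_three (H 8 _), mul_zero, add_zero, e0, e2, e3, e5, zero_add] at e6 e8 o0 o2
    obtain ⟨a0, a0'⟩ := eq_zero_of_minor_ne_zero (hm 6 1 2 (by decide)) e6 o2
    obtain ⟨a2, a2'⟩ := eq_zero_of_minor_ne_zero (hm 8 1 0 (by decide)) e8 o0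
    exact eq_zero_of_vec_eq_zero (hi 1 _ (forall_fin_three a0 e1 a2))
      (hi 4 _ (forall_fin_three a0' e4 a2'))
  · have o1 : H 7 1 ⬝ᵥ delayedX H s 7 = 0 := by linear_combination e10 - e9 - 2 * e6
    have o0 : H 8 0 ⬝ᵥ delayedX H s 8 = 0 := by linear_combination e9 - e6 - o1
    simp only [delayedX_seven, delayedX_eight, dotProduct_vec_three (H 7 _),
      dotProduct_vec_three (H 8 _), mul_zero, add_zero, e0, e1, e3, e4, zero_add] at e7 e8 o0 o1
    obtain ⟨a0, a0'⟩ := eq_zero_of_minor_ne_zero (hm 7 2 1 (by decide)) e7 o1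
    obtain ⟨a1, a1'⟩ := eq_zero_of_minor_ne_zero (hm 8 2 0 (by decide)) e8 o0
    exact eq_zero_of_vec_eq_zero (hi 2 _ (forall_fin_three a0 a1 e2))
      (hi 5 _ (forall_fin_three a0' a1' e5))

end

/-! ### Codes with large Hamming distance -/

section Hamming

variable {A : Type*} [DecidableEq A] {N : ℕ}

/-- A word of the ball is fixed by a set of at most `r` positions, of which there are at most `2 ^
N`, and the letters there. The crude factor `2 ^ N` costs only a constant in rate per block,
negligible for large alphabets. -/
lemma card_hammingBall_le [Fintype A] [Nonempty A] (x : Fin N → A) (r : ℕ) :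
    (Finset.univ.filter fun y => hammingDist x y ≤ r).card ≤ 2 ^ N * Fintype.card A ^ r := by
  let C : Finset (Fin N) → Finset (Fin N → A) := fun S =>
    Fintype.piFinset fun i => if i ∈ S then Finset.univ else {x i}
  have hsub : (Finset.univ.filter fun y => hammingDist x y ≤ r) ⊆
      (Finset.univ.filter fun S : Finset (Fin N) => S.card ≤ r).biUnion C := by
    intro y hy
    simp only [Finset.mem_filter, Finset.mem_univ, true_and] at hy
    simp only [Finset.mem_biUnion, Finset.mem_filter, Finset.mem_univ, true_and, C,
      Fintype.mem_piFinset]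
    refine ⟨Finset.univ.filter fun i => x i ≠ y i, hy, fun i => ?_⟩
    by_cases h : x i = y i <;> simp [h]
  have hC : ∀ S ∈ Finset.univ.filter fun S : Finset (Fin N) => S.card ≤ r,
      (C S).card ≤ Fintype.card A ^ r := by
    intro S hS
    have : (C S).card = Fintype.card A ^ S.card := by
      simp only [C, Fintype.card_piFinset, apply_ite Finset.card, Finset.card_univ,
        Finset.card_singleton, Finset.prod_ite, Finset.prod_const, one_pow, mul_one]
      simp
    rw [this]
    exact Nat.pow_le_pow_right Fintype.card_pos (Finset.mem_filter.1 hS).2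
  calc _ ≤ _ := Finset.card_le_card hsub
    _ ≤ (Finset.univ.filter fun S : Finset (Fin N) => S.card ≤ r).card * Fintype.card A ^ r :=
        Finset.card_biUnion_le_card_mul _ _ _ hC
    _ ≤ _ := Nat.mul_le_mul_right _ (by
        refine (Finset.card_le_univ _).trans ?_
        simp)

/-- The Gilbert-Varshamov bound. -/
lemma exists_code_of_card_le [Fintype A] [Nonempty A] (r M : ℕ)
    (h : M * (2 ^ N * Fintype.card A ^ r) ≤ Fintype.card A ^ N) :
    ∃ f : Fin M → Fin N → A, ∀ i j, i ≠ j → r < hammingDist (f i) (f j) := by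
  induction M with
  | zero => exact ⟨fun i => i.elim0, fun i => i.elim0⟩
  | succ k ih =>
    have hpos : 0 < 2 ^ N * Fintype.card A ^ r := Nat.mul_pos (by positivity)
      (pow_pos Fintype.card_pos _)
    have hlt : k * (2 ^ N * Fintype.card A ^ r) < Fintype.card A ^ N := by
      refine lt_of_lt_of_le ?_ h
      exact Nat.mul_lt_mul_of_pos_right (Nat.lt_succ_self k) hpos
    obtain ⟨f, hf⟩ := ih hlt.le
    -- Greedy choice: the balls around the `k` words found so far are too small to cover the whole
    -- space.
    obtain ⟨x, hx⟩ : ∃ x, x ∉ Finset.univ.biUnion fun i : Fin k =>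
        Finset.univ.filter fun y => hammingDist (f i) y ≤ r := by
      by_contra! hcon
      have h1 := Finset.card_biUnion_le_card_mul Finset.univ
        (fun i : Fin k => Finset.univ.filter fun y => hammingDist (f i) y ≤ r) _
        (fun i _ => card_hammingBall_le (f i) r)
      rw [Finset.eq_univ_iff_forall.2 hcon] at h1
      simp only [Finset.card_univ, Fintype.card_pi, Finset.prod_const, Fintype.card_fin] at h1
      exact absurd h1 hlt.not_ge
    simp only [Finset.mem_biUnion, Finset.mem_univ, Finset.mem_filter, true_and, not_exists,
      not_le] at hx
    refine ⟨Fin.cons x f, fun i j => ?_⟩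
    refine Fin.cases ?_ (fun i => ?_) i <;> refine Fin.cases ?_ (fun j => ?_) j
    · simp
    · intro _
      simpa [hammingDist_comm x] using hx j
    · intro _
      simpa using hx i
    · intro hij
      simpa using hf i j fun h => hij (by rw [h])

open Classical in
/-- Decoding within half the distance `r`. -/
noncomputable def nearest {M : ℕ} [NeZero M] (f : Fin M → Fin N → A) (r : ℕ) (y : Fin N → A) :
    Fin M :=
  if h : ∃ m, 2 * hammingDist (f m) y ≤ r then h.choose else 0

lemma nearest_eq {M : ℕ} [NeZero M] {f : Fin M → Fin N → A} {r : ℕ}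
    (hf : ∀ i j, i ≠ j → r < hammingDist (f i) (f j)) {m : Fin M} {y : Fin N → A}
    (h : 2 * hammingDist (f m) y ≤ r) : nearest f r y = m := by
  have hex : ∃ m, 2 * hammingDist (f m) y ≤ r := ⟨m, h⟩
  rw [nearest, dif_pos hex]
  by_contra hne
  have h1 := hf _ _ hne
  have h2 := hex.choose_spec
  have h3 := hammingDist_triangle_right (f hex.choose) (f m) y
  omega

end Hamming

/-! ### Blocks of slots -/

section Blocks

lemma block_lt {n T : ℕ} (b : Fin (n / T)) (s : Fin T) : b.1 * T + s.1 < n := by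
  have h1 : (b.1 + 1) * T ≤ n / T * T := Nat.mul_le_mul_right _ b.2
  have h2 := Nat.div_mul_le_self n T
  have h3 := s.2
  nlinarith

/-- Slot `s` of block `b`. -/
def slot {n T : ℕ} (b : Fin (n / T)) (s : Fin T) : Fin n := ⟨b.1 * T + s.1, block_lt b s⟩

lemma slot_injective {n T : ℕ} :
    Function.Injective fun p : Fin (n / T) × Fin T => slot p.1 p.2 := by
  rintro ⟨b, s⟩ ⟨b', s'⟩ h
  have h : b.1 * T + s.1 = b'.1 * T + s'.1 := congrArg Fin.val h
  have hT : 0 < T := s.pos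
  have h1 : b.1 = b'.1 := by
    have := congrArg (· / T) h
    simpa [Nat.add_comm (_ * T), Nat.add_mul_div_right _ _ hT, Nat.div_eq_of_lt s.2,
      Nat.div_eq_of_lt s'.2] using this
  have h2 : s.1 = s'.1 := by rw [h1] at h; omega
  exact Prod.ext (Fin.ext h1) (Fin.ext h2)

/-- Selecting distinct coordinates of an i.i.d. family gives an i.i.d. family. It serves for cutting
time into blocks, for relabelling receivers and for marginals of the noise. -/
lemma pi_map_comp_injective {ι κ X : Type*} [Fintype ι] [Fintype κ] [MeasurableSpace X]
    (ν : Measure X) [IsProbabilityMeasure ν] {e : κ → ι} (he : Function.Injective e) :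
    MeasurePreserving (fun (x : ι → X) k => x (e k)) (Measure.pi fun _ => ν)
      (Measure.pi fun _ => ν) := by
  refine ⟨by fun_prop, ?_⟩
  have h : iIndepFun (fun i (x : ι → X) => x i) (Measure.pi fun _ : ι => ν) :=
    iIndepFun_pi (X := fun _ => id) (fun _ => aemeasurable_id)
  have h' := h.precomp he
  rw [iIndepFun_iff_map_fun_eq_pi_map (fun k => (measurable_pi_apply _).aemeasurable)] at h'
  rw [h']
  congr 1
  funext k
  exact (measurePreserving_eval (fun _ : ι => ν) (e k)).map_eq

lemma measurePreserving_slot {n T : ℕ} {X : Type*} [MeasurableSpace X] (ν : Measure X)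
    [IsProbabilityMeasure ν] :
    MeasurePreserving (fun (x : Fin n → X) (b : Fin (n / T)) (s : Fin T) => x (slot b s))
      (Measure.pi fun _ => ν) (Measure.pi fun _ => Measure.pi fun _ => ν) := by
  have h1 := pi_map_comp_injective ν (slot_injective (n := n) (T := T))
  have h2 : MeasurePreserving (MeasurableEquiv.curry (Fin (n / T)) (Fin T) X)
      (Measure.pi fun _ => ν) (Measure.pi fun _ => Measure.pi fun _ => ν) := by
    refine ⟨MeasurableEquiv.measurable _, ?_⟩
    have := Measure.infinitePi_map_curry (fun (_ : Fin (n / T)) (_ : Fin T) => ν)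
    simpa only [Measure.infinitePi_eq_pi] using this
  exact h2.comp h1

instance : IsProbabilityMeasure complexGaussian := by
  unfold complexGaussian
  exact Measure.isProbabilityMeasure_map (by
    apply Measurable.aemeasurable
    exact Complex.measurableEquivRealProd.symm.measurable)

instance {n : ℕ} : IsProbabilityMeasure (noiseLaw n) := by
  unfold noiseLaw; infer_instance

variable {μ : Fin 3 → Measure (Fin 3 → ℂ)} [∀ i, IsProbabilityMeasure (μ i)]

/-- Channels and noise of different blocks are independent with the law of a single block, and the
leftover slots are dropped. The block errors of a concatenated code thereby become events in the
factors of a product measure. -/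
lemma measurePreserving_blocks (n T : ℕ) :
    MeasurePreserving
      (fun (ω : Chan n × (Fin n → ℂ)) (b : Fin (n / T)) =>
        ((fun s => ω.1 (slot b s), fun s => ω.2 (slot b s)) : Chan T × (Fin T → ℂ)))
      ((channelLaw μ n).prod (noiseLaw n))
      (Measure.pi fun _ => (channelLaw μ T).prod (noiseLaw T)) := by
  have h1 := measurePreserving_slot (n := n) (T := T) (Measure.pi fun i => μ i)
  have h2 := measurePreserving_slot (n := n) (T := T) complexGaussian
  have h3 := (measurePreserving_arrowProdEquivProdArrow (Chan T) (Fin T → ℂ) (Fin (n / T))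
    (fun _ => channelLaw μ T) (fun _ => noiseLaw T)).symm
  exact h3.comp (h1.prod h2)

/-- Many simultaneous rare events in independent blocks are unlikely. -/
lemma measure_many_le {X : Type*} [MeasurableSpace X] (ν : Measure X) [IsProbabilityMeasure ν]
    {N : ℕ} (E : Fin N → Set X) {ε : ℝ≥0∞} (hE : ∀ b, ν (E b) ≤ ε) (hε : ε ≤ 1) (k : ℕ)
    {B : Set (Fin N → X)}
    (hB : ∀ x ∈ B, ∃ S : Finset (Fin N), k ≤ S.card ∧ ∀ b ∈ S, x b ∈ E b) :
    (Measure.pi fun _ => ν) B ≤ 2 ^ N * ε ^ k := by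
  classical
  let F : Finset (Finset (Fin N)) := Finset.univ.filter fun S => k ≤ S.card
  -- Union bound over the set `S` of blocks where the rare event occurs; for fixed `S` the
  -- probability factors.
  have hsub : B ⊆ ⋃ S ∈ F, Set.univ.pi fun b => if b ∈ S then E b else Set.univ := by
    intro x hx
    obtain ⟨S, hS, h⟩ := hB x hx
    simp only [Set.mem_iUnion, F, Finset.mem_filter, Finset.mem_univ, true_and, exists_prop]
    refine ⟨S, hS, fun b _ => ?_⟩
    by_cases hb : b ∈ S
    · simpa [hb] using h b hb
    · simp [hb]
  have hS : ∀ S ∈ F, (Measure.pi fun _ => ν)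
      (Set.univ.pi fun b => if b ∈ S then E b else Set.univ) ≤ ε ^ k := by
    intro S hS
    rw [Measure.pi_pi]
    calc ∏ b, ν (if b ∈ S then E b else Set.univ) ≤ ∏ b, (if b ∈ S then ε else 1) := by
          refine Finset.prod_le_prod' fun b _ => ?_
          split_ifs
          · exact hE b
          · simp
      _ = ε ^ S.card := by simp
      _ ≤ ε ^ k := pow_le_pow_right_of_le_one' hε (Finset.mem_filter.1 hS).2
  calc _ ≤ _ := measure_mono hsub
    _ ≤ ∑ S ∈ F, _ := measure_biUnion_finset_le _ _
    _ ≤ ∑ S ∈ F, ε ^ k := Finset.sum_le_sum hS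
    _ = F.card * ε ^ k := by simp
    _ ≤ 2 ^ N * ε ^ k := by
        gcongr
        have : F.card ≤ 2 ^ N := (Finset.card_le_univ _).trans (by simp)
        exact_mod_cast this

end Blocks

section

/-! ### Concatenated codes -/

variable {I : Set (Fin 3)} {T : ℕ} {A : Fin 3 → Type}

/-- A code of fixed length `T` for symbols from finite alphabets. -/
structure InnerCode (I : Set (Fin 3)) (T : ℕ) (A : Fin 3 → Type) where
  enc : (∀ i, A i) → Chan T → Fin T → Fin 3 → ℂ
  enc_measurable : ∀ a, Measurable (enc a)
  enc_causal : ∀ a, RespectsCSIT I (enc a)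
  dec : ∀ i : Fin 3, Chan T × (Fin T → ℂ) → A i
  dec_measurable : ∀ i a, MeasurableSet (dec i ⁻¹' {a})

/-- The event that receiver `i` misses its symbol. -/
def InnerCode.errSet (c : InnerCode I T A) (a : ∀ i, A i) (i : Fin 3) :
    Set (Chan T × (Fin T → ℂ)) :=
  {ω | c.dec i (ω.1, output ω.1 i (c.enc a ω.1) ω.2) ≠ a i}

/-- The channels in block `b`. -/
def chanBlock {n T : ℕ} (H : Chan n) (b : Fin (n / T)) : Chan T := fun s => H (slot b s)

lemma measurable_chanBlock {n T : ℕ} (b : Fin (n / T)) :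
    Measurable fun H : Chan n => chanBlock H b := by
  unfold chanBlock; fun_prop

/-- The transmit sequence that uses the inner code in every complete block and is silent in the
remaining slots. -/
def blockEnc (c : InnerCode I T A) {n : ℕ} (x : Fin (n / T) → ∀ i, A i) (H : Chan n) (t : Fin n) :
    Fin 3 → ℂ :=
  if h : t.1 / T < n / T ∧ 0 < T then
    c.enc (x ⟨t.1 / T, h.1⟩) (chanBlock H ⟨t.1 / T, h.1⟩) ⟨t.1 % T, Nat.mod_lt _ h.2⟩
  else 0

lemma blockEnc_slot (c : InnerCode I T A) {n : ℕ} (x : Fin (n / T) → ∀ i, A i) (H : Chan n)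
    (b : Fin (n / T)) (s : Fin T) :
    blockEnc c x H (slot b s) = c.enc (x b) (chanBlock H b) s := by
  have hT : 0 < T := s.pos
  have h1 : (slot b s : Fin n).1 / T = b.1 := by
    simp [slot, Nat.add_comm (_ * T), Nat.add_mul_div_right _ _ hT, Nat.div_eq_of_lt s.2]
  have h2 : (slot b s : Fin n).1 % T = s.1 := by
    simp [slot, Nat.add_comm (_ * T), Nat.mod_eq_of_lt s.2]
  rw [blockEnc, dif_pos ⟨h1 ▸ b.2, hT⟩]
  simp only [h1, h2]

lemma blockEnc_measurable (c : InnerCode I T A) {n : ℕ} (x : Fin (n / T) → ∀ i, A i) :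
    Measurable (blockEnc c x) := by
  refine measurable_pi_iff.2 fun t => ?_
  unfold blockEnc
  split_ifs with h
  · exact (measurable_pi_iff.1 (c.enc_measurable _) _).comp (measurable_chanBlock _)
  · exact measurable_const

/-- Slots of a block keep their order in time, so what the inner code may use inside the block is
also known to the transmitter on the full time axis. -/
lemma blockEnc_causal (c : InnerCode I T A) {n : ℕ} (x : Fin (n / T) → ∀ i, A i) :
    RespectsCSIT I (blockEnc c x) := by
  intro t H H' h h'
  unfold blockEnc
  split_ifs with ht
  · have key : ∀ s : Fin T, (slot (⟨t.1 / T, ht.1⟩ : Fin (n / T)) s : Fin n).1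
        = t.1 - t.1 % T + s.1 := fun s => by
      have := Nat.div_add_mod' t.1 T
      simp only [slot]
      omega
    have hmod : t.1 % T ≤ t.1 := Nat.mod_le _ _
    refine c.enc_causal _ _ _ _ (fun i hi s hs => h i hi _ ?_) (fun i s hs => h' i _ ?_)
    · have hs : s.1 ≤ t.1 % T := hs
      rw [Fin.le_def, key]
      omega
    · have hs : s.1 < t.1 % T := hs
      rw [Fin.lt_def, key]
      omega
  · rfl

variable [∀ i, Fintype (A i)] [∀ i, DecidableEq (A i)]

/-- Codewords over the blocks for each receiver, combined with an inner code. -/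
noncomputable def concatCode (c : InnerCode I T A) (n : ℕ) (M : Fin 3 → ℕ) [∀ i, NeZero (M i)]
    (f : ∀ i, Fin (M i) → Fin (n / T) → A i) (r : ℕ) : Code I n where
  M := M
  enc m := blockEnc c fun b i => f i (m i) b
  enc_measurable _ := blockEnc_measurable _ _
  enc_causal _ := blockEnc_causal _ _
  dec i ω := nearest (f i) r fun b => c.dec i (chanBlock ω.1 b, fun s => ω.2 (slot b s))
  dec_measurable i := by
    let _ : MeasurableSpace (A i) := ⊤
    have h1 : Measurable fun y : Fin (n / T) → A i => nearest (f i) r y := measurable_of_finite _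
    have h2 : Measurable (c.dec i) := measurable_to_countable' fun a => c.dec_measurable i a
    refine h1.comp (measurable_pi_iff.2 fun b => h2.comp ?_)
    exact ((measurable_chanBlock b).comp measurable_fst).prodMk (by fun_prop)

variable {μ : Fin 3 → Measure (Fin 3 → ℂ)} [∀ i, IsProbabilityMeasure (μ i)]

lemma average_le {ι : Type*} [Fintype ι] {K : ℝ≥0∞} {M : ℝ≥0∞} (hM : (Fintype.card ι : ℝ≥0∞) = M)
    {g : ι → ℝ≥0∞} (hg : ∀ m, g m ≤ K) : (∑ m, g m) / M ≤ K := by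
  refine ENNReal.div_le_of_le_mul ?_
  calc ∑ m, g m ≤ ∑ _m : ι, K := Finset.sum_le_sum fun m _ => hg m
    _ = K * M := by rw [Finset.sum_const, Finset.card_univ, nsmul_eq_mul, hM, mul_comm]

lemma card_messages (M : Fin 3 → ℕ) :
    (Fintype.card (∀ i, Fin (M i)) : ℝ≥0∞) = ∏ i, (M i : ℝ≥0∞) := by
  simp

lemma Code.powerLE_of_enc_le {n : ℕ} (c : Code I n) {P : ℝ}
    (h : ∀ m H t j, ‖c.enc m H t j‖ ^ 2 ≤ P) : c.PowerLE μ P := by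
  intro t j
  refine average_le (card_messages c.M) fun m => ?_
  calc _ ≤ ∫⁻ _H, ENNReal.ofReal P ∂channelLaw μ n := by
        refine lintegral_mono fun H => ?_
        rw [← ofReal_norm, ← ENNReal.ofReal_pow (norm_nonneg _)]
        exact ENNReal.ofReal_le_ofReal (h m H t j)
    _ = _ := by simp

lemma concatCode_powerLE (c : InnerCode I T A) (n : ℕ) (M : Fin 3 → ℕ) [∀ i, NeZero (M i)]
    (f : ∀ i, Fin (M i) → Fin (n / T) → A i) (r : ℕ) {P : ℝ} (hP : 0 ≤ P)
    (h : ∀ a H t j, ‖c.enc a H t j‖ ^ 2 ≤ P) : (concatCode c n M f r).PowerLE μ P := by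
  refine Code.powerLE_of_enc_le _ fun m H t j => ?_
  simp only [concatCode, blockEnc]
  split_ifs
  · exact h _ _ _ _
  · simpa using hP

/-- Decoding within half the distance fails only if at least `k` blocks are wrong. The bound `ε`
holds for every tuple of inner symbols, so the codewords sent to the other receivers play no role
and `measure_many_le` applies message by message. -/
lemma concatCode_errProb_le (c : InnerCode I T A) (n : ℕ) (M : Fin 3 → ℕ) [∀ i, NeZero (M i)]
    (f : ∀ i, Fin (M i) → Fin (n / T) → A i) (r k : ℕ) (hk : 2 * (k - 1) ≤ r)
    (i : Fin 3) (hf : ∀ m m', m ≠ m' → r < hammingDist (f i m) (f i m')) {ε : ℝ≥0∞} (hε : ε ≤ 1)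
    (herr : ∀ a, ((channelLaw μ T).prod (noiseLaw T)) (c.errSet a i) ≤ ε) :
    (concatCode c n M f r).errProb μ i ≤ 2 ^ (n / T) * ε ^ k := by
  refine average_le (card_messages M) fun m => ?_
  let x : Fin (n / T) → ∀ i, A i := fun b i => f i (m i) b
  let B : Set (Fin (n / T) → Chan T × (Fin T → ℂ)) :=
    {y | nearest (f i) r (fun b => c.dec i ((y b).1, output (y b).1 i (c.enc (x b) (y b).1) (y b).2))
      ≠ m i}
  have hB : ∀ y ∈ B, ∃ S : Finset (Fin (n / T)), k ≤ S.card ∧ ∀ b ∈ S, y b ∈ c.errSet (x b) i := by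
    intro y hy
    refine ⟨Finset.univ.filter fun b => f i (m i) b ≠
      c.dec i ((y b).1, output (y b).1 i (c.enc (x b) (y b).1) (y b).2), ?_, fun b hb => ?_⟩
    · by_contra hcon
      apply hy
      refine nearest_eq hf ?_
      simp only [hammingDist]
      omega
    · exact (Finset.mem_filter.1 hb).2.symm
  refine le_trans (measure_mono ?_) ((measurePreserving_blocks (μ := μ) n T).measure_preimage_le B
    |>.trans (measure_many_le _ (fun b => c.errSet (x b) i) (fun b => herr _) hε k hB))
  intro ω hω hcon
  refine hω (Eq.trans ?_ hcon)
  change nearest (f i) r _ = nearest (f i) r _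
  congr 1
  funext b
  congr 2
  funext s
  exact congrArg (fun v => ω.1 (slot b s) i ⬝ᵥ v + ω.2 (slot b s)) (blockEnc_slot c x ω.1 b s)

/-! ### Rates and error exponents of concatenated codes. -/

/-- The code that conveys nothing. -/
def silentCode (I : Set (Fin 3)) (n : ℕ) : Code I n where
  M _ := 1
  enc _ _ _ := 0
  enc_measurable _ := measurable_const
  enc_causal _ _ _ _ _ _ := rfl
  dec _ _ := 0
  dec_measurable _ := measurable_const

omit [∀ i, IsProbabilityMeasure (μ i)] in
lemma silentCode_errProb (n : ℕ) (i : Fin 3) : (silentCode I n).errProb μ i = 0 := by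
  have : ∀ m : ∀ i, Fin ((silentCode I n).M i), {ω : Chan n × (Fin n → ℂ) | (silentCode I n).dec i
      (ω.1, output ω.1 i ((silentCode I n).enc m ω.1) ω.2) ≠ m i} = ∅ := fun m =>
    Set.eq_empty_of_forall_notMem fun ω h => h (Subsingleton.elim (α := Fin 1) _ _)
  simp [Code.errProb, this]

lemma silentCode_powerLE (n : ℕ) {P : ℝ} (hP : 0 ≤ P) : (silentCode I n).PowerLE μ P :=
  Code.powerLE_of_enc_le _ fun m H t j => by simpa [silentCode] using hP

lemma zero_mem_capacityRegion {P : ℝ} (hP : 0 ≤ P) : (0 : Fin 3 → ℝ) ∈ capacityRegion μ I P :=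
  ⟨silentCode I, fun n => silentCode_powerLE n hP, fun i => by simp [silentCode],
    fun i => by simp [silentCode_errProb]⟩

lemma tendsto_log_ceil_exp_div {R : ℝ} (hR : 0 ≤ R) :
    Tendsto (fun n : ℕ => Real.log (⌈Real.exp (n * R)⌉₊ : ℝ) / n) atTop (𝓝 R) := by
  have hlow : ∀ᶠ n : ℕ in atTop, R ≤ Real.log (⌈Real.exp (n * R)⌉₊ : ℝ) / n := by
    filter_upwards [eventually_gt_atTop 0] with n hn
    rw [le_div_iff₀ (by exact_mod_cast hn), mul_comm,
      Real.le_log_iff_exp_le (lt_of_lt_of_le (Real.exp_pos _) (Nat.le_ceil _))]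
    exact Nat.le_ceil _
  have hup : ∀ᶠ n : ℕ in atTop, Real.log (⌈Real.exp (n * R)⌉₊ : ℝ) / n ≤ R + Real.log 2 / n := by
    filter_upwards [eventually_gt_atTop 0] with n hn
    have hn' : (0 : ℝ) < n := by exact_mod_cast hn
    have h1 : (⌈Real.exp (n * R)⌉₊ : ℝ) ≤ 2 * Real.exp (n * R) := by
      have := Nat.ceil_lt_add_one (Real.exp_pos (n * R)).le
      have h2 : 1 ≤ Real.exp (n * R) := Real.one_le_exp (by positivity)
      linarith
    have h3 := Real.log_le_log (lt_of_lt_of_le (Real.exp_pos _) (Nat.le_ceil _)) h1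
    rw [Real.log_mul two_ne_zero (Real.exp_pos _).ne', Real.log_exp] at h3
    rw [div_le_iff₀ hn', add_mul, div_mul_cancel₀ _ hn'.ne']
    linarith
  refine tendsto_of_tendsto_of_tendsto_of_le_of_le' tendsto_const_nhds ?_ hlow hup
  simpa using tendsto_const_nhds.add (tendsto_const_div_atTop_nhds_zero_nat (Real.log 2))

/-- The Gilbert-Varshamov condition in logarithmic form, with `N = n / T` complete blocks and
distance about `2θN`. The terms `log 2` and `T * R` on the left of the hypothesis pay for rounding
up the number of messages and for the incomplete last block. -/
lemma ceil_exp_mul_le {n T q : ℕ} (hT : 0 < T) (hq : 0 < q) {R θ : ℝ} (hR : 0 ≤ R) (hθ : 0 ≤ θ)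
    (h : Real.log 2 + T * R ≤ (n / T : ℕ) * ((1 - 2 * θ) * Real.log q - Real.log 2 - T * R)) :
    ⌈Real.exp (n * R)⌉₊ * (2 ^ (n / T) * q ^ (2 * ⌊θ * (n / T : ℕ)⌋₊)) ≤ q ^ (n / T) := by
  set N := n / T with hN
  have hq' : (0 : ℝ) < q := by exact_mod_cast hq
  have hlogq : 0 ≤ Real.log q := Real.log_natCast_nonneg q
  have h1 : (⌈Real.exp (n * R)⌉₊ : ℝ) ≤ 2 * Real.exp (n * R) := by
    have := Nat.ceil_lt_add_one (Real.exp_pos (n * R)).le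
    have h2 : 1 ≤ Real.exp (n * R) := Real.one_le_exp (by positivity)
    linarith
  have hn : (n : ℝ) ≤ N * T + T := by
    have h2 : n < N * T + T := by
      have := Nat.lt_div_mul_add hT (a := n)
      simpa [hN] using this
    exact_mod_cast h2.le
  have hfl : (⌊θ * N⌋₊ : ℝ) ≤ θ * N := Nat.floor_le (by positivity)
  have key : (⌈Real.exp (n * R)⌉₊ : ℝ) * (2 ^ N * q ^ (2 * ⌊θ * N⌋₊)) ≤ q ^ N := by
    have e2 : (2 : ℝ) ^ N = Real.exp (N * Real.log 2) := by
      rw [Real.exp_nat_mul, Real.exp_log two_pos]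
    have eq : ∀ k : ℕ, (q : ℝ) ^ k = Real.exp (k * Real.log q) := fun k => by
      rw [Real.exp_nat_mul, Real.exp_log hq']
    calc (⌈Real.exp (n * R)⌉₊ : ℝ) * (2 ^ N * q ^ (2 * ⌊θ * N⌋₊))
        ≤ (2 * Real.exp (n * R)) * (2 ^ N * q ^ (2 * ⌊θ * N⌋₊)) := by gcongr
      _ = Real.exp (Real.log 2 + n * R + (N * Real.log 2
            + ((2 * ⌊θ * N⌋₊ : ℕ) : ℝ) * Real.log q)) := by
          rw [e2, eq, Real.exp_add, Real.exp_add, Real.exp_add, Real.exp_log two_pos]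
      _ ≤ Real.exp (N * Real.log q) := by
          apply Real.exp_le_exp.2
          push_cast
          have t1 := mul_le_mul_of_nonneg_right hn hR
          have t2 := mul_le_mul_of_nonneg_right hfl hlogq
          nlinarith
      _ = q ^ N := (eq N).symm
  exact_mod_cast key

/-- With `r = 2⌊θN⌋` over `N` blocks an error needs `⌊θN⌋ + 1` wrong blocks, of probability at most
`(2 ε ^ θ) ^ N`. So a small fixed block error probability suffices, at the price of the factor `1 -
2θ` and one `log 2` per block in the rate. The silent code fills in the short lengths. -/
lemma mem_capacityRegion_of_innerCode [∀ i, Nonempty (A i)] (hT : 0 < T) (c : InnerCode I T A)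
    {P θ : ℝ} (hP : 0 ≤ P) (hpow : ∀ a H t j, ‖c.enc a H t j‖ ^ 2 ≤ P) (hθ : 0 < θ) {ε : ℝ≥0∞}
    (hε : ε ≤ 1) (hε2 : 2 * ε ^ θ < 1)
    (herr : ∀ a i, ((channelLaw μ T).prod (noiseLaw T)) (c.errSet a i) ≤ ε) {R : Fin 3 → ℝ}
    (hR0 : ∀ i, 0 ≤ R i)
    (hR : ∀ i, T * R i < (1 - 2 * θ) * Real.log (Fintype.card (A i)) - Real.log 2) :
    R ∈ capacityRegion μ I P := by
  have hNtop : Tendsto (fun n : ℕ => n / T) atTop atTop := Nat.tendsto_div_const_atTop hT.ne'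
  have hNtop' : Tendsto (fun n : ℕ => ((n / T : ℕ) : ℝ)) atTop atTop :=
    tendsto_natCast_atTop_atTop.comp hNtop
  have hev : ∀ᶠ n : ℕ in atTop, ∀ i, Real.log 2 + T * R i ≤
      (n / T : ℕ) * ((1 - 2 * θ) * Real.log (Fintype.card (A i)) - Real.log 2 - T * R i) :=
    eventually_all.2 fun i => (hNtop'.atTop_mul_const (by linarith [hR i])).eventually_ge_atTop _
  obtain ⟨n₀, hn₀⟩ := eventually_atTop.1 hev
  have hcode : ∀ n, ∃ C : Code I n, C.PowerLE μ P ∧ (n₀ ≤ n →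
      (∀ i, C.M i = ⌈Real.exp (n * R i)⌉₊) ∧ ∀ i, C.errProb μ i ≤ (2 * ε ^ θ) ^ (n / T)) := by
    intro n
    by_cases hn : n₀ ≤ n
    · choose f hf using fun i => exists_code_of_card_le (A := A i) (N := n / T)
        (2 * ⌊θ * (n / T : ℕ)⌋₊) ⌈Real.exp (n * R i)⌉₊
        (ceil_exp_mul_le hT Fintype.card_pos (hR0 i) hθ.le (hn₀ n hn i))
      have : ∀ i, NeZero ⌈Real.exp (n * R i)⌉₊ := fun i =>
        ⟨(Nat.ceil_pos.2 (Real.exp_pos _)).ne'⟩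
      refine ⟨concatCode c n (fun i => ⌈Real.exp (n * R i)⌉₊) f (2 * ⌊θ * (n / T : ℕ)⌋₊),
        concatCode_powerLE _ _ _ _ _ hP hpow, fun _ => ⟨fun i => rfl, fun i => ?_⟩⟩
      refine (concatCode_errProb_le c n _ f _ (⌊θ * (n / T : ℕ)⌋₊ + 1) (by simp) i (hf i) hε
        fun a => herr a i).trans ?_
      rw [mul_pow, ← ENNReal.rpow_natCast (ε ^ θ), ← ENNReal.rpow_mul, ← ENNReal.rpow_natCast ε]
      gcongr 2 ^ (n / T) * ?_
      refine ENNReal.rpow_le_rpow_of_exponent_ge hε ?_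
      push_cast
      exact (Nat.lt_floor_add_one _).le
    · exact ⟨silentCode I n, silentCode_powerLE n hP, fun h => absurd h hn⟩
  choose C hC1 hC2 using hcode
  refine ⟨C, hC1, fun i => ?_, fun i => ?_⟩
  · refine (tendsto_log_ceil_exp_div (hR0 i)).congr' ?_
    filter_upwards [eventually_ge_atTop n₀] with n hn
    rw [(hC2 n hn).1 i]
  · have h0 : Tendsto (fun n : ℕ => (2 * ε ^ θ) ^ (n / T)) atTop (𝓝 0) :=
      (ENNReal.tendsto_pow_atTop_nhds_zero_of_lt_one hε2).comp hNtop
    refine tendsto_of_tendsto_of_tendsto_of_le_of_le' tendsto_const_nhds h0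
      (Eventually.of_forall fun _ => zero_le) ?_
    filter_upwards [eventually_ge_atTop n₀] with n hn
    exact (hC2 n hn).2 i

end

section

/-! ### Quantized linear schemes -/

variable {I : Set (Fin 3)} {T : ℕ} {κ : Fin 3 → ℕ} {μ : Fin 3 → Measure (Fin 3 → ℂ)}

/-- The unit vectors of the space of data symbols. -/
def Sym.unit (i : Fin 3) (k : Fin (κ i)) : Sym κ := Pi.single i (Pi.single k 1)

lemma Sym.eq_sum (s : Sym κ) : s = ∑ i, ∑ k, s i k • (Sym.unit i k : Sym κ) := by
  funext i k
  simp only [Finset.sum_apply, Pi.smul_apply, smul_eq_mul, Sym.unit]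
  rw [Finset.sum_eq_single i]
  · simp [Pi.single_apply]
  · intro j _ hj
    simp [Pi.single_eq_of_ne hj.symm]
  · simp

/-- A bound for the transmitted vector when all data symbols are at most `1`. -/
noncomputable def LinScheme.gain (S : LinScheme I T κ) (H : Chan T) (t : Fin T) : ℝ :=
  1 + ∑ i, ∑ k, ‖S.X H (Sym.unit i k) t‖

lemma LinScheme.gain_pos (S : LinScheme I T κ) (H : Chan T) (t : Fin T) : 0 < S.gain H t := by
  unfold gain; positivity

lemma LinScheme.exists_linearMap (S : LinScheme I T κ) (H : Chan T) (t : Fin T) :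
    ∃ L : Sym κ →ₗ[ℂ] (Fin 3 → ℂ), ∀ s, L s = S.X H s t :=
  linearMap_of_comb (fun s => S.X H s t) fun c x y => S.comb H c x y t

lemma LinScheme.norm_X_le (S : LinScheme I T κ) (H : Chan T) (t : Fin T) {s : Sym κ} {B : ℝ}
    (hB : 0 ≤ B) (hs : ∀ i k, ‖s i k‖ ≤ B) : ‖S.X H s t‖ ≤ B * S.gain H t := by
  obtain ⟨L, hL⟩ := S.exists_linearMap H t
  have h1 : S.X H s t = ∑ i, ∑ k, s i k • S.X H (Sym.unit i k) t := by
    simp only [← hL]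
    conv_lhs => rw [Sym.eq_sum s]
    simp only [map_sum, map_smul]
  rw [h1]
  calc _ ≤ ∑ i, ∑ k, ‖s i k • S.X H (Sym.unit i k) t‖ :=
        (norm_sum_le _ _).trans (Finset.sum_le_sum fun i _ => norm_sum_le _ _)
    _ ≤ ∑ i, ∑ k, B * ‖S.X H (Sym.unit i k) t‖ := by
        gcongr with i _ k _
        rw [norm_smul]
        gcongr
        exact hs i k
    _ = B * ∑ i, ∑ k, ‖S.X H (Sym.unit i k) t‖ := by simp only [Finset.mul_sum]
    _ ≤ B * S.gain H t := by unfold gain; gcongr; linarith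

/-- The scheme with the transmitted vectors scaled down by their gains. -/
noncomputable def LinScheme.normalize (S : LinScheme I T κ) : LinScheme I T κ where
  X H s t := (S.gain H t : ℂ)⁻¹ • S.X H s t
  comb H c s s' t := by rw [S.comb, smul_add, smul_comm]
  meas s := by
    have : ∀ t, Measurable fun H => S.gain H t := fun t => by
      unfold gain
      refine measurable_const.add (Finset.measurable_sum _ fun i _ => Finset.measurable_sum _
        fun k _ => ?_)
      exact (measurable_pi_iff.1 (S.meas _) t).norm
    refine measurable_pi_iff.2 fun t => ?_
    exact (Complex.measurable_ofReal.comp (this t)).inv.smul (measurable_pi_iff.1 (S.meas s) t)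
  -- The gain in slot `t` is computed from the vectors that the scheme would send in slot `t` for
  -- unit data, hence from channels that the transmitter knows by then.
  causal s := by
    intro t H H' h h'
    have hX : ∀ s, S.X H s t = S.X H' s t := fun s => S.causal s t H H' h h'
    simp only [gain, hX]

/-- The bound holds at every channel realization, not just on average. This makes the power
constraint independent of the channel laws. -/
lemma LinScheme.norm_normalize_le (S : LinScheme I T κ) (H : Chan T) (t : Fin T) {s : Sym κ} {B : ℝ}
    (hB : 0 ≤ B) (hs : ∀ i k, ‖s i k‖ ≤ B) : ‖S.normalize.X H s t‖ ≤ B := by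
  simp only [normalize, norm_smul, norm_inv, Complex.norm_real, Real.norm_eq_abs,
    abs_of_pos (S.gain_pos H t)]
  rw [inv_mul_le_iff₀ (S.gain_pos H t), mul_comm]
  exact S.norm_X_le H t hB hs

lemma LinScheme.Resolves.normalize {S : LinScheme I T κ} (h : S.Resolves μ) :
    S.normalize.Resolves μ := by
  intro i
  filter_upwards [h i] with H hH s hs
  refine hH s fun t => ?_
  have := hs t
  simp only [LinScheme.normalize, dotProduct_smul, smul_eq_mul, mul_eq_zero, inv_eq_zero,
    Complex.ofReal_eq_zero, (S.gain_pos H t).ne', false_or] at this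
  exact this

/-! ### Separation of Gaussian integer data by the noise-free outputs. -/

/-- Data symbols with Gaussian integer values. -/
def gaussInt (z : (i : Fin 3) → Fin (κ i) → ℤ × ℤ) : Sym κ :=
  fun i k => (z i k).1 + (z i k).2 * Complex.I

lemma one_le_norm_gaussInt {p : ℤ × ℤ} (hp : p ≠ 0) : 1 ≤ ‖(p.1 + p.2 * Complex.I : ℂ)‖ := by
  have h1 := Complex.abs_re_le_norm (p.1 + p.2 * Complex.I : ℂ)
  have h2 := Complex.abs_im_le_norm (p.1 + p.2 * Complex.I : ℂ)
  simp only [Complex.add_re, Complex.intCast_re, Complex.mul_re, Complex.I_re, mul_zero,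
    Complex.intCast_im, Complex.I_im, mul_one, sub_self, add_zero, Complex.add_im, Complex.mul_im,
    zero_add] at h1 h2
  by_cases h : p.1 = 0
  · have : p.2 ≠ 0 := fun h' => hp (Prod.ext h h')
    refine le_trans ?_ h2
    exact_mod_cast Int.one_le_abs this
  · refine le_trans ?_ h1
    exact_mod_cast Int.one_le_abs h

/-- The scheme separates Gaussian integer data of receiver `i` by at least `1 / K`. -/
def LinScheme.Separates (S : LinScheme I T κ) (K : ℝ) (i : Fin 3) (H : Chan T) : Prop :=
  ∀ z : (i : Fin 3) → Fin (κ i) → ℤ × ℤ, z i ≠ 0 →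
    ∃ t, 1 ≤ K * ‖H t i ⬝ᵥ S.X H (gaussInt z) t‖

lemma LinScheme.Separates.mono {S : LinScheme I T κ} {K K' : ℝ} (h : K ≤ K') {i : Fin 3}
    {H : Chan T} (hK : S.Separates K i H) : S.Separates K' i H := fun z hz => by
  obtain ⟨t, ht⟩ := hK z hz
  exact ⟨t, ht.trans (by gcongr)⟩

lemma LinScheme.measurableSet_separates (S : LinScheme I T κ) (K : ℝ) (i : Fin 3) :
    MeasurableSet {H | S.Separates K i H} := by
  have : {H | S.Separates K i H} = ⋂ z : (i : Fin 3) → Fin (κ i) → ℤ × ℤ, ⋂ _ : z i ≠ 0,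
      ⋃ t, {H : Chan T | 1 ≤ K * ‖H t i ⬝ᵥ S.X H (gaussInt z) t‖} := by
    ext H
    simp [LinScheme.Separates]
  rw [this]
  refine MeasurableSet.iInter fun z => MeasurableSet.iInter fun _ => MeasurableSet.iUnion fun t => ?_
  refine measurableSet_le measurable_const (measurable_const.mul (Measurable.norm ?_))
  exact measurable_dotProduct (by fun_prop) (measurable_pi_iff.1 (S.meas _) t)

/-- A linear left inverse `g` recovers the symbols of receiver `i` from its outputs. A nonzero
Gaussian integer has modulus at least `1`, so some output has modulus at least `1 / K` once `K`
bounds the norm of `g`. The constant depends on the channel but not on the size of the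
constellation. -/
lemma LinScheme.Resolves.exists_separates {S : LinScheme I T κ} (h : S.Resolves μ) (i : Fin 3) :
    ∀ᵐ H ∂channelLaw μ T, ∃ K : ℕ, S.Separates K i H := by
  filter_upwards [h i] with H hH
  obtain ⟨A, hA⟩ : ∃ A : Sym κ →ₗ[ℂ] (Fin T → ℂ), ∀ s, A s = fun t => H t i ⬝ᵥ S.X H s t :=
    linearMap_of_comb _ fun c x y => by
      funext t
      simp only [S.comb, dotProduct_add, dotProduct_smul, Pi.add_apply, Pi.smul_apply]
  obtain ⟨g, hg⟩ := exists_linearMap_comp_eq A (LinearMap.proj i : Sym κ →ₗ[ℂ] (Fin (κ i) → ℂ))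
    fun s hs => hH s fun t => by rw [hA] at hs; exact congrFun hs t
  let g' := LinearMap.toContinuousLinearMap g
  obtain ⟨K, hK⟩ := exists_nat_ge ‖g'‖
  refine ⟨K, fun z hz => ?_⟩
  obtain ⟨k, hk⟩ := Function.ne_iff.1 hz
  have h1 : 1 ≤ ‖g' (A (gaussInt z))‖ := by
    have h2 : g' (A (gaussInt z)) = gaussInt z i := hg _
    rw [h2]
    exact (one_le_norm_gaussInt hk).trans (norm_le_pi_norm (gaussInt z i) k)
  by_contra! hcon
  have hKpos : (0 : ℝ) < K := by
    rcases Nat.eq_zero_or_pos K with h0 | h0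
    · have : ‖g'‖ = 0 := le_antisymm (hK.trans_eq (by simp [h0])) (norm_nonneg _)
      rw [norm_eq_zero.1 this] at h1
      simp at h1
      exact absurd h1 (by norm_num)
    · exact_mod_cast h0
  have h3 : ‖A (gaussInt z)‖ < (K : ℝ)⁻¹ := by
    rw [pi_norm_lt_iff (by positivity)]
    intro t
    have := hcon t
    rw [hA]
    rwa [← lt_div_iff₀' hKpos, one_div] at this
  have h4 := g'.le_opNorm (A (gaussInt z))
  have h5 : ‖g'‖ * ‖A (gaussInt z)‖ < K * (K : ℝ)⁻¹ :=
    mul_lt_mul' hK h3 (norm_nonneg _) hKpos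
  rw [mul_inv_cancel₀ hKpos.ne'] at h5
  linarith

variable [∀ i, IsProbabilityMeasure (μ i)]

/-- Channel realizations and noise sequences at which the scheme is not safe at level `K`. -/
def LinScheme.unsafeSet (S : LinScheme I T κ) (K : ℕ) : Set (Chan T × (Fin T → ℂ)) :=
  {ω | (∃ i, ¬ S.Separates K i ω.1) ∨ ∃ t, (K : ℝ) ≤ ‖ω.2 t‖}

lemma LinScheme.measurableSet_unsafeSet (S : LinScheme I T κ) (K : ℕ) :
    MeasurableSet (S.unsafeSet K) := by
  have : S.unsafeSet K = (⋃ i, Prod.fst ⁻¹' {H | S.Separates K i H}ᶜ) ∪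
      ⋃ t, {ω : Chan T × (Fin T → ℂ) | (K : ℝ) ≤ ‖ω.2 t‖} := by
    ext ω
    simp [unsafeSet]
  rw [this]
  refine (MeasurableSet.iUnion fun i => ?_).union (MeasurableSet.iUnion fun t => ?_)
  · exact measurable_fst (S.measurableSet_separates K i).compl
  · exact measurableSet_le measurable_const (by fun_prop)

/-- The unsafe sets decrease with `K` to a null set, so continuity from above applies. The level `K`
is fixed by `ε` alone; afterwards the power may grow. -/
lemma LinScheme.Resolves.exists_unsafeSet_le {S : LinScheme I T κ} (h : S.Resolves μ) {ε : ℝ≥0∞}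
    (hε : 0 < ε) : ∃ K : ℕ, ((channelLaw μ T).prod (noiseLaw T)) (S.unsafeSet K) ≤ ε := by
  have hanti : Antitone S.unsafeSet := by
    rintro K K' hK ω (⟨i, hi⟩ | ⟨t, ht⟩)
    · exact Or.inl ⟨i, fun h' => hi (h'.mono (by exact_mod_cast hK))⟩
    · exact Or.inr ⟨t, le_trans (by exact_mod_cast hK) ht⟩
  have hnull : ((channelLaw μ T).prod (noiseLaw T)) (⋂ K, S.unsafeSet K) = 0 := by
    have hae : ∀ᵐ ω ∂(channelLaw μ T).prod (noiseLaw T), ∀ i, ∃ K : ℕ, S.Separates K i ω.1 :=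
      ae_all_iff.2 fun i => Measure.quasiMeasurePreserving_fst.ae (h.exists_separates i)
    have hae' : ∀ᵐ ω ∂(channelLaw μ T).prod (noiseLaw T), ω ∉ ⋂ K, S.unsafeSet K := by
      filter_upwards [hae] with ω hω
      choose K hK using hω
      obtain ⟨K', hK'⟩ := exists_nat_gt (∑ t, ‖ω.2 t‖)
      simp only [Set.mem_iInter, not_forall]
      refine ⟨K' + ∑ i, K i, ?_⟩
      rintro (⟨i, hi⟩ | ⟨t, ht⟩)
      · refine hi ((hK i).mono ?_)
        have := Finset.single_le_sum (f := K) (fun _ _ => Nat.zero_le _) (Finset.mem_univ i)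
        exact_mod_cast this.trans (Nat.le_add_left _ _)
      · have h1 := Finset.single_le_sum (f := fun t => ‖ω.2 t‖) (fun _ _ => norm_nonneg _)
          (Finset.mem_univ t)
        have h2 : (K' : ℝ) ≤ (K' + ∑ i, K i : ℕ) := by exact_mod_cast Nat.le_add_right _ _
        linarith
    exact measure_eq_zero_iff_ae_notMem.2 hae'
  have htend := tendsto_measure_iInter_atTop (μ := (channelLaw μ T).prod (noiseLaw T))
    (fun K => (S.measurableSet_unsafeSet K).nullMeasurableSet) hanti ⟨0, measure_ne_top _ _⟩
  rw [hnull] at htend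
  exact ((htend.eventually (gt_mem_nhds hε)).mono fun _ h => h.le).exists

/-- The alphabet of receiver `i`: `κ i` symbols from a `Q × Q` constellation. -/
abbrev Alphabet (κ : Fin 3 → ℕ) (Q : ℕ) (i : Fin 3) : Type := Fin (κ i) → Fin Q × Fin Q

/-- Data symbols from a square constellation of spacing `Δ`. -/
noncomputable def qam {Q : ℕ} (Δ : ℝ) (a : ∀ i, Alphabet κ Q i) : Sym κ :=
  (Δ : ℂ) • gaussInt fun i k => (((a i k).1.1 : ℤ), ((a i k).2.1 : ℤ))

lemma norm_qam_le {Q : ℕ} {Δ : ℝ} (hΔ : 0 ≤ Δ) (a : ∀ i, Alphabet κ Q i) (i : Fin 3)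
    (k : Fin (κ i)) : ‖qam Δ a i k‖ ≤ Δ * (2 * Q) := by
  have h1 : ‖((a i k).1.1 : ℂ) + ((a i k).2.1 : ℂ) * Complex.I‖ ≤ 2 * Q := by
    refine (norm_add_le _ _).trans ?_
    rw [norm_mul, Complex.norm_I, mul_one, Complex.norm_natCast, Complex.norm_natCast, two_mul]
    have e1 : ((a i k).1.1 : ℝ) ≤ Q := by exact_mod_cast (a i k).1.2.le
    have e2 : ((a i k).2.1 : ℝ) ≤ Q := by exact_mod_cast (a i k).2.2.le
    linarith
  simp only [qam, Pi.smul_apply, gaussInt, smul_eq_mul, norm_mul, Complex.norm_real,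
    Real.norm_eq_abs, abs_of_nonneg hΔ, Int.cast_natCast]
  gcongr

lemma qam_sub {Q : ℕ} (Δ : ℝ) (a a' : ∀ i, Alphabet κ Q i) :
    qam Δ a - qam Δ a' = (Δ : ℂ) • gaussInt fun i k =>
      (((a i k).1.1 : ℤ) - ((a' i k).1.1 : ℤ), ((a i k).2.1 : ℤ) - ((a' i k).2.1 : ℤ)) := by
  rw [qam, qam, ← smul_sub]
  congr 1
  funext i k
  simp only [gaussInt, Pi.sub_apply]
  push_cast
  ring

/-- The symbols whose noise-free outputs are closer than `K` to the received ones. -/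
def LinScheme.candidates (S : LinScheme I T κ) (Q K : ℕ) (Δ : ℝ) (i : Fin 3)
    (ω : Chan T × (Fin T → ℂ)) : Set (∀ i, Alphabet κ Q i) :=
  {a | ∀ t, ‖ω.2 t - ω.1 t i ⬝ᵥ S.X ω.1 (qam Δ a) t‖ < K}

open Classical in
/-- The scheme with data symbols from a square constellation. -/
noncomputable def LinScheme.innerCode (S : LinScheme I T κ) (Q K : ℕ) [NeZero Q] (Δ : ℝ) :
    InnerCode I T (Alphabet κ Q) where
  enc a H := S.X H (qam Δ a)
  enc_measurable _ := S.meas _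
  enc_causal _ := S.causal _
  dec i ω := if h : (S.candidates Q K Δ i ω).Nonempty then h.choose i else fun _ => 0
  dec_measurable i a := by
    -- The decoder depends on its input only through the set of candidates, which takes finitely
    -- many values, each on a measurable set.
    let pick : Set (∀ i, Alphabet κ Q i) → Alphabet κ Q i := fun C =>
      if h : C.Nonempty then h.choose i else fun _ => 0
    have hm : ∀ a, MeasurableSet {ω | a ∈ S.candidates Q K Δ i ω} := fun a => by
      have : {ω | a ∈ S.candidates Q K Δ i ω} =
          ⋂ t, {ω | ‖ω.2 t - ω.1 t i ⬝ᵥ S.X ω.1 (qam Δ a) t‖ < K} := by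
        ext ω; simp [LinScheme.candidates]
      rw [this]
      refine MeasurableSet.iInter fun t => measurableSet_lt (Measurable.norm ?_) measurable_const
      refine Measurable.sub (by fun_prop) (measurable_dotProduct (by fun_prop) ?_)
      exact (measurable_pi_iff.1 (S.meas _) t).comp measurable_fst
    have hC : ∀ C, MeasurableSet {ω | S.candidates Q K Δ i ω = C} := fun C => by
      have : {ω | S.candidates Q K Δ i ω = C} =
          ⋂ a, {ω | a ∈ S.candidates Q K Δ i ω ↔ a ∈ C} := by
        ext ω; simp [Set.ext_iff]
      rw [this]
      exact MeasurableSet.iInter fun a => (hm a).iff (MeasurableSet.const _)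
    have : (fun ω => pick (S.candidates Q K Δ i ω)) ⁻¹' {a} =
        ⋃ C ∈ {C | pick C = a}, {ω | S.candidates Q K Δ i ω = C} := by
      ext ω; simp
    exact this ▸ MeasurableSet.biUnion (Set.to_countable _) fun C _ => hC C

/-- At a safe point the noise is below `K` in every slot, so the noise-free outputs of two
candidates differ by less than `2K`. Different symbols of receiver `i` force a difference of at
least `Δ / K ≥ 2K` in some slot. Candidates may disagree about the other receivers' data without
harm. -/
lemma LinScheme.innerCode_errSet_subset (S : LinScheme I T κ) {Q K : ℕ} [NeZero Q] {Δ : ℝ}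
    (hΔ : 2 * (K : ℝ) * K ≤ Δ) (hΔ0 : 0 < Δ) (a : ∀ i, Alphabet κ Q i) (i : Fin 3) :
    (S.innerCode Q K Δ).errSet a i ⊆ S.unsafeSet K := by
  intro ω hω
  by_contra hsafe
  simp only [unsafeSet, Set.mem_ofPred_eq, not_or, not_exists, not_not, not_le] at hsafe
  obtain ⟨hsep, hz⟩ := hsafe
  apply hω
  have hmem : a ∈ S.candidates Q K Δ i (ω.1, output ω.1 i (S.X ω.1 (qam Δ a)) ω.2) := by
    intro t
    simpa [output] using hz t
  have hne : (S.candidates Q K Δ i (ω.1, output ω.1 i (S.X ω.1 (qam Δ a)) ω.2)).Nonempty :=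
    ⟨a, hmem⟩
  have hdec : (S.innerCode Q K Δ).dec i (ω.1, output ω.1 i ((S.innerCode Q K Δ).enc a ω.1) ω.2)
      = hne.choose i := dif_pos hne
  rw [hdec]
  by_contra hdiff
  set a' := hne.choose with ha'
  have hmem' : a' ∈ S.candidates Q K Δ i (ω.1, output ω.1 i (S.X ω.1 (qam Δ a)) ω.2) :=
    hne.choose_spec
  obtain ⟨t, ht⟩ := hsep i (fun i k =>
    (((a i k).1.1 : ℤ) - ((a' i k).1.1 : ℤ), ((a i k).2.1 : ℤ) - ((a' i k).2.1 : ℤ))) (by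
      intro h0
      apply hdiff
      funext k
      have := congrFun h0 k
      simp only [Pi.zero_apply, Prod.mk_eq_zero, sub_eq_zero, Nat.cast_inj] at this
      exact (Prod.ext (Fin.ext this.1) (Fin.ext this.2)).symm)
  have h1 := hmem t
  have h2 := hmem' t
  simp only at h1 h2
  obtain ⟨L, hL⟩ := S.exists_linearMap ω.1 t
  have h3 : ω.1 t i ⬝ᵥ S.X ω.1 (qam Δ a) t - ω.1 t i ⬝ᵥ S.X ω.1 (qam Δ a') t =
      (Δ : ℂ) * ω.1 t i ⬝ᵥ S.X ω.1 (gaussInt fun i k => (((a i k).1.1 : ℤ) - ((a' i k).1.1 : ℤ),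
        ((a i k).2.1 : ℤ) - ((a' i k).2.1 : ℤ))) t := by
    rw [← dotProduct_sub, ← hL, ← hL, ← map_sub, qam_sub, map_smul, dotProduct_smul, hL, smul_eq_mul]
  set y := output ω.1 i (S.X ω.1 (qam Δ a)) ω.2 t
  have h4 : ‖ω.1 t i ⬝ᵥ S.X ω.1 (qam Δ a) t - ω.1 t i ⬝ᵥ S.X ω.1 (qam Δ a') t‖ < 2 * K := by
    have e : ω.1 t i ⬝ᵥ S.X ω.1 (qam Δ a) t - ω.1 t i ⬝ᵥ S.X ω.1 (qam Δ a') t =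
      (y - ω.1 t i ⬝ᵥ S.X ω.1 (qam Δ a') t) - (y - ω.1 t i ⬝ᵥ S.X ω.1 (qam Δ a) t) := by ring
    rw [e]
    refine (norm_sub_le _ _).trans_lt ?_
    linarith
  rw [h3, norm_mul, Complex.norm_real, Real.norm_eq_abs, abs_of_pos hΔ0] at h4
  set N := ‖ω.1 t i ⬝ᵥ S.X ω.1 (gaussInt fun i k => (((a i k).1.1 : ℤ) - ((a' i k).1.1 : ℤ),
        ((a i k).2.1 : ℤ) - ((a' i k).2.1 : ℤ))) t‖
  have hKpos : (0 : ℝ) < K := by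
    by_contra hK
    have : (K : ℝ) = 0 := le_antisymm (not_lt.1 hK) (Nat.cast_nonneg _)
    rw [this] at ht
    linarith
  have h5 : Δ ≤ Δ * (K * N) := le_mul_of_one_le_right hΔ0.le ht
  nlinarith

end

section

/-! ### Degrees of freedom of linear schemes -/

variable {I : Set (Fin 3)} {T : ℕ} {κ : Fin 3 → ℕ} {μ : Fin 3 → Measure (Fin 3 → ℂ)}
  [∀ i, IsProbabilityMeasure (μ i)]

/-- It suffices to achieve all smaller multiples of a triple for large powers. -/
lemma mem_dofRegion_of_forall_lt {d : Fin 3 → ℝ} (hd : ∀ i, 0 ≤ d i)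
    (h : ∀ δ : ℝ, 0 < δ → δ < 1 → ∀ᶠ P in atTop,
      (fun i => (1 - δ) * d i * Real.log P) ∈ capacityRegion μ I P) : d ∈ dofRegion μ I := by
  classical
  let good : ℝ → ℕ → Prop := fun P k =>
    (fun i => (1 - 1 / ((k : ℝ) + 1)) * d i * Real.log P) ∈ capacityRegion μ I P
  have hgood : ∀ k, ∀ᶠ P in atTop, good P k := fun k => by
    rcases Nat.eq_zero_or_pos k with rfl | hk
    · filter_upwards [eventually_ge_atTop 0] with P hP
      have : (fun i => (1 - 1 / (((0 : ℕ) : ℝ) + 1)) * d i * Real.log P) = 0 := by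
        funext i; simp
      simp only [good, this]
      exact zero_mem_capacityRegion hP
    · refine h _ (by positivity) ?_
      rw [div_lt_one (by positivity)]
      have : (0 : ℝ) < k := by exact_mod_cast hk
      linarith
  -- Diagonal choice: `K P` is the largest `k ≤ P` for which the loss `1 / (k + 1)` is already
  -- achievable at power `P`. For `k = 0` the triple is zero, which covers the powers where no other
  -- `k` works.
  let K : ℝ → ℕ := fun P => Nat.findGreatest (good P) ⌊P⌋₊
  have hK : Tendsto K atTop atTop := by
    refine tendsto_atTop.2 fun k => ?_
    filter_upwards [hgood k, eventually_ge_atTop (k : ℝ)] with P hP hkP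
    exact Nat.le_findGreatest (Nat.le_floor hkP) hP
  refine ⟨hd, fun P i => (1 - 1 / ((K P : ℝ) + 1)) * d i * Real.log P, fun P hP => ?_, fun i => ?_⟩
  · by_cases hK0 : K P = 0
    · have : (fun i => (1 - 1 / ((K P : ℝ) + 1)) * d i * Real.log P) = 0 := by
        funext i; simp [hK0]
      exact (congrArg (· ∈ capacityRegion μ I P) this).mpr (zero_mem_capacityRegion hP.le)
    · exact Nat.findGreatest_of_ne_zero (P := good P) rfl hK0
  · have h1 : Tendsto (fun P => (1 - 1 / ((K P : ℝ) + 1)) * d i) atTop (𝓝 ((1 - 0) * d i)) :=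
      (tendsto_const_nhds.sub (tendsto_one_div_add_atTop_nhds_zero_nat.comp hK)).mul_const _
    rw [sub_zero, one_mul] at h1
    refine h1.congr' ?_
    filter_upwards [eventually_gt_atTop 1] with P hP
    rw [mul_div_cancel_right₀ _ (Real.log_pos hP).ne']

/-- With `Q` slightly below `√P` points per real dimension, the spacing still tends to infinity with
`P` and so exceeds any fixed `2K²`, while each complex symbol carries `2 log Q`, nearly `log P`. One
block thus carries nearly `κ i * log P` for receiver `i` in `T` slots. -/
theorem LinScheme.Resolves.mem_dofRegion {S : LinScheme I T κ} (hT : 0 < T) (hκ : ∀ i, 0 < κ i)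
    (hS : S.Resolves μ) : (fun i => (κ i / T : ℝ)) ∈ dofRegion μ I := by
  refine mem_dofRegion_of_forall_lt (fun i => by positivity) fun δ hδ hδ1 => ?_
  -- The loss `δ` is shared: `1 - 2θ = 1 - δ/3` for the outer code and the factor `1 - δ/3` in the
  -- exponent of the constellation size. Their product exceeds `1 - δ` by more than `δ/3`, which for
  -- large `P` absorbs the terms with `log 2`. The value of `ε` makes `2 * ε ^ θ = 1/2`.
  set θ : ℝ := δ / 6 with hθ
  have hθ0 : 0 < θ := by positivity
  set ε : ℝ≥0∞ := (1 / 4) ^ (1 / θ) with hε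
  have hεθ : 2 * ε ^ θ < 1 := by
    rw [hε, ← ENNReal.rpow_mul, one_div_mul_cancel hθ0.ne', ENNReal.rpow_one]
    rw [← ENNReal.toReal_lt_toReal (by finiteness) (by finiteness)]
    norm_num
  have hε1 : ε ≤ 1 := ENNReal.rpow_le_one (by norm_num) (by positivity)
  have hε0 : 0 < ε := ENNReal.rpow_pos (by norm_num) (by norm_num)
  obtain ⟨K, hK⟩ := hS.normalize.exists_unsafeSet_le hε0
  have hpow : Tendsto (fun P : ℝ => P ^ θ) atTop atTop := tendsto_rpow_atTop hθ0
  have hpow' : Tendsto (fun P : ℝ => P ^ ((1 - δ / 3) / 2)) atTop atTop :=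
    tendsto_rpow_atTop (by linarith)
  filter_upwards [hpow.eventually_ge_atTop (2 * (2 * K * K)), hpow'.eventually_ge_atTop 2,
    Real.tendsto_log_atTop.eventually_gt_atTop (3 * Real.log 2 / (δ / 3)),
    eventually_gt_atTop 1] with P hP1 hP2 hP3 hP4
  set x := P ^ ((1 - δ / 3) / 2) with hx
  set Q := ⌊x⌋₊ with hQ
  have hQ2 : 0 < Q := Nat.floor_pos.2 (by linarith)
  have : NeZero Q := ⟨hQ2.ne'⟩
  have hQ0 : (0 : ℝ) < Q := by exact_mod_cast hQ2
  have hQx : (Q : ℝ) ≤ x := Nat.floor_le (by linarith)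
  have hxQ : x / 2 ≤ Q := by
    have := Nat.lt_floor_add_one x
    linarith
  have hPpos : 0 < P := by linarith
  set Δ := √P / (2 * Q) with hΔ
  have hΔ0 : 0 < Δ := by positivity
  have hΔK : 2 * (K : ℝ) * K ≤ Δ := by
    -- The exponents `δ/6` and `1/2 - δ/6` add up to `1/2`, so the spacing `√P / (2Q)` is at least
    -- `P ^ θ / 2`.
    have h1 : P ^ θ * x = √P := by
      rw [hx, ← Real.rpow_add hPpos, Real.sqrt_eq_rpow, hθ]
      congr 1
      ring
    rw [hΔ, le_div_iff₀ (by positivity), ← h1]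
    have h2 : 0 ≤ 2 * (K : ℝ) * K := by positivity
    nlinarith
  refine mem_capacityRegion_of_innerCode hT (S.normalize.innerCode Q K Δ) hPpos.le
    (fun a H t j => ?_) hθ0 hε1 hεθ (fun a i => (measure_mono
      (S.normalize.innerCode_errSet_subset hΔK hΔ0 a i)).trans hK)
    (fun i => ?_) fun i => ?_
  · have h1 : ‖S.normalize.X H (qam Δ a) t j‖ ≤ Δ * (2 * Q) :=
      (norm_le_pi_norm _ j).trans
        (S.norm_normalize_le H t (by positivity) fun i k => norm_qam_le hΔ0.le a i k)
    rw [hΔ, div_mul_cancel₀ _ (by positivity)] at h1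
    calc _ ≤ √P ^ 2 := by gcongr; exact h1
      _ = P := Real.sq_sqrt hPpos.le
  · have := Real.log_pos hP4
    have : 0 ≤ 1 - δ := by linarith
    positivity
  · have hcard : Real.log (Fintype.card (Alphabet κ Q i)) = κ i * (2 * Real.log Q) := by
      simp only [Fintype.card_pi, Fintype.card_prod, Fintype.card_fin, Finset.prod_const,
        Finset.card_univ, Nat.cast_pow, Nat.cast_mul, Real.log_pow]
      rw [Real.log_mul hQ0.ne' hQ0.ne', two_mul]
    have hlogQ : (1 - δ / 3) / 2 * Real.log P - Real.log 2 ≤ Real.log Q := by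
      rw [← Real.log_rpow hPpos, ← Real.log_div (by positivity) two_ne_zero]
      exact Real.log_le_log (by positivity) hxQ
    have hκ1 : (1 : ℝ) ≤ κ i := by exact_mod_cast hκ i
    have hT' : (0 : ℝ) < T := by exact_mod_cast hT
    rw [div_lt_iff₀ (by positivity)] at hP3
    have e1 : T * ((1 - δ) * (κ i / T : ℝ) * Real.log P) = κ i * ((1 - δ) * Real.log P) := by
      field_simp
    rw [hcard, e1]
    have hl2 := Real.log_pos one_lt_two
    have hlP := Real.log_pos hP4
    have h1 : (1 - δ) * Real.log P + Real.log 2 <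
        (1 - 2 * θ) * (2 * ((1 - δ / 3) / 2 * Real.log P - Real.log 2)) := by
      rw [hθ]
      nlinarith [mul_pos (mul_pos hδ hδ) hlP, mul_pos hδ hl2]
    have h2 : (1 - δ) * Real.log P + Real.log 2 < (1 - 2 * θ) * (2 * Real.log Q) := by
      refine h1.trans_le ?_
      have : 0 ≤ 1 - 2 * θ := by rw [hθ]; linarith
      gcongr
    nlinarith

theorem hybrid_mem_dofRegion (hμ : ∀ i, μ i ≪ volume) :
    (![1, 1 / 3, 1 / 3] : Fin 3 → ℝ) ∈ dofRegion μ {0} := by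
  have := (hybridScheme_resolves hμ).mem_dofRegion (by norm_num)
    fun i => by fin_cases i <;> simp
  convert this using 1
  funext i
  fin_cases i <;> norm_num

theorem delayed_mem_dofRegion (hμ : ∀ i, μ i ≪ volume) :
    (fun _ => 6 / 11 : Fin 3 → ℝ) ∈ dofRegion μ ∅ := by
  have := (delayedScheme_resolves hμ).mem_dofRegion (by norm_num) fun i => by norm_num
  simpa using this

end

/-! ### The complex Gaussian density -/

/-- The density of the complex Gaussian law of variance `v`. -/
noncomputable def gauss (v : ℝ) (z : ℂ) : ℝ := (Real.pi * v)⁻¹ * Real.exp (-v⁻¹ * ‖z‖ ^ 2)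

@[fun_prop]
lemma measurable_gauss (v : ℝ) : Measurable (gauss v) := by
  unfold gauss; fun_prop

lemma gauss_pos {v : ℝ} (hv : 0 < v) (z : ℂ) : 0 < gauss v z := by
  unfold gauss; have := Real.pi_pos; positivity

/-- Unit noise keeps all output densities at most `1`. Differential entropies are then integrals of
nonnegative functions and can be handled in `ℝ≥0∞` without integrability conditions. -/
lemma gauss_le_one {v : ℝ} (hv : 1 ≤ v) (z : ℂ) : gauss v z ≤ 1 := by
  have h1 : (Real.pi * v)⁻¹ ≤ 1 := inv_le_one_of_one_le₀ (by nlinarith [Real.pi_gt_three])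
  have h2 : Real.exp (-v⁻¹ * ‖z‖ ^ 2) ≤ 1 := Real.exp_le_one_iff.2 (by
    have : 0 ≤ v⁻¹ * ‖z‖ ^ 2 := by positivity
    linarith)
  exact mul_le_one₀ h1 (Real.exp_pos _).le h2

lemma neg_log_gauss {v : ℝ} (hv : 0 < v) (z : ℂ) :
    -Real.log (gauss v z) = Real.log Real.pi + Real.log v + v⁻¹ * ‖z‖ ^ 2 := by
  rw [gauss, Real.log_mul (by have := Real.pi_pos; positivity) (Real.exp_pos _).ne', Real.log_exp,
    Real.log_inv, Real.log_mul Real.pi_pos.ne' hv.ne']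
  ring

lemma lintegral_gauss {v : ℝ} (hv : 0 < v) : ∫⁻ z, ENNReal.ofReal (gauss v z) = 1 := by
  have h1 : ∫ z : ℂ, Real.exp (-v⁻¹ * ‖z‖ ^ 2) = Real.pi * v := by
    rw [GaussianFourier.integral_rexp_neg_mul_sq_norm (inv_pos.2 hv), Complex.finrank_real_complex]
    norm_num
  have hpos : 0 < Real.pi * v := mul_pos Real.pi_pos hv
  have h2 : Integrable fun z : ℂ => Real.exp (-v⁻¹ * ‖z‖ ^ 2) :=
    Integrable.of_integral_ne_zero (by rw [h1]; exact hpos.ne')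
  have h3 : ∫ z : ℂ, gauss v z = 1 := by
    unfold gauss
    rw [integral_const_mul, h1, inv_mul_cancel₀ hpos.ne']
  have h4 : Integrable (gauss v) := h2.const_mul _
  rw [← ofReal_integral_eq_lintegral_ofReal h4
    (Eventually.of_forall fun z => (gauss_pos hv z).le), h3, ENNReal.ofReal_one]

lemma isProbabilityMeasure_gauss {v : ℝ} (hv : 0 < v) :
    IsProbabilityMeasure ((volume : Measure ℂ).withDensity fun z => ENNReal.ofReal (gauss v z)) :=
  ⟨by rw [withDensity_apply _ MeasurableSet.univ, Measure.restrict_univ, lintegral_gauss hv]⟩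

lemma complexGaussian_eq_withDensity :
    complexGaussian = volume.withDensity fun z => ENNReal.ofReal (gauss 1 z) := by
  have hv : (1 / 2 : ℝ≥0) ≠ 0 := by norm_num
  have hmp := Complex.volume_preserving_equiv_real_prod.symm
  have hfun : (fun p : ℝ × ℝ => (⟨p.1, p.2⟩ : ℂ)) = Complex.measurableEquivRealProd.symm := rfl
  have hdens : (fun p : ℝ × ℝ => gaussianPDF 0 (1 / 2) p.1 * gaussianPDF 0 (1 / 2) p.2) =
      fun p => ENNReal.ofReal (gauss 1 (Complex.measurableEquivRealProd.symm p)) := by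
    funext p
    rw [gaussianPDF, gaussianPDF, ← ENNReal.ofReal_mul (gaussianPDFReal_nonneg _ _ _)]
    congr 1
    have h2 : √(2 * Real.pi * ((1 / 2 : ℝ≥0) : ℝ)) * √(2 * Real.pi * ((1 / 2 : ℝ≥0) : ℝ))
        = Real.pi := by
      rw [Real.mul_self_sqrt (by positivity)]
      push_cast
      ring
    have h3 : ‖(⟨p.1, p.2⟩ : ℂ)‖ ^ 2 = p.1 ^ 2 + p.2 ^ 2 := by
      rw [← Complex.normSq_eq_norm_sq, Complex.normSq_mk]; ring
    simp only [gaussianPDFReal, gauss, Complex.measurableEquivRealProd_symm_apply, h3]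
    rw [mul_mul_mul_comm, ← mul_inv, h2, ← Real.exp_add]
    push_cast
    congr 2 <;> ring
  rw [complexGaussian, gaussianReal_of_var_ne_zero _ hv,
    prod_withDensity (measurable_gaussianPDF _ _) (measurable_gaussianPDF _ _), hdens, hfun]
  ext s hs
  rw [MeasurableEquiv.map_apply, withDensity_apply _ hs,
    withDensity_apply _ (MeasurableEquiv.measurable _ hs)]
  exact hmp.setLIntegral_comp_preimage_emb (MeasurableEquiv.measurableEmbedding _) (fun z => ENNReal.ofReal (gauss 1 z)) s

lemma map_add_complexGaussian (c : ℂ) :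
    complexGaussian.map (fun z => c + z) =
      volume.withDensity fun z => ENNReal.ofReal (gauss 1 (z - c)) := by
  rw [complexGaussian_eq_withDensity]
  ext s hs
  have hm : Measurable fun z : ℂ => c + z := by fun_prop
  rw [Measure.map_apply hm hs, withDensity_apply _ hs, withDensity_apply _ (hm hs)]
  have := (measurePreserving_add_left (volume : Measure ℂ) c).setLIntegral_comp_preimage hs
    (f := fun z => ENNReal.ofReal (gauss 1 (z - c))) (by fun_prop)
  simpa using this

lemma lintegral_norm_sq_complexGaussian : ∫⁻ z, ENNReal.ofReal (‖z‖ ^ 2) ∂complexGaussian ≤ 4 := by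
  rw [complexGaussian_eq_withDensity,
    lintegral_withDensity_eq_lintegral_mul _ (by fun_prop) (by fun_prop)]
  -- From `s ≤ 2 exp (s / 2)` with `s = ‖z‖ ^ 2`; the exponential turns the density of variance `1`
  -- into twice the density of variance `2`.
  calc _ ≤ ∫⁻ z, 4 * ENNReal.ofReal (gauss 2 z) := by
        refine lintegral_mono fun z => ?_
        simp only [Pi.mul_apply]
        rw [← ENNReal.ofReal_mul (gauss_pos one_pos z).le, show (4 : ℝ≥0∞) = ENNReal.ofReal 4 by simp,
          ← ENNReal.ofReal_mul four_pos.le]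
        apply ENNReal.ofReal_le_ofReal
        have h1 : ‖z‖ ^ 2 ≤ 2 * Real.exp (2⁻¹ * ‖z‖ ^ 2) := by
          have := Real.add_one_le_exp (2⁻¹ * ‖z‖ ^ 2)
          linarith
        have h2 : Real.exp (-1⁻¹ * ‖z‖ ^ 2) * Real.exp (2⁻¹ * ‖z‖ ^ 2)
            = Real.exp (-2⁻¹ * ‖z‖ ^ 2) := by
          rw [← Real.exp_add]; congr 1; ring
        calc gauss 1 z * ‖z‖ ^ 2 ≤ gauss 1 z * (2 * Real.exp (2⁻¹ * ‖z‖ ^ 2)) := by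
              gcongr; exact (gauss_pos one_pos z).le
          _ = 4 * gauss 2 z := by
              simp only [gauss]
              rw [← h2]
              field_simp
              norm_num
    _ = 4 := by rw [lintegral_const_mul _ (by fun_prop), lintegral_gauss two_pos, mul_one]

/-! ### Marginals of product measures -/

section Marginal

variable {ι : Type*} [Fintype ι] [DecidableEq ι]

/-- Coordinates on which the integrand does not depend integrate to `1`, so only those in `A`
remain. -/
lemma lintegral_pi_eq_lmarginal (ν : ι → Measure ℂ) [∀ p, IsProbabilityMeasure (ν p)]
    {Φ : (ι → ℂ) → ℝ≥0∞} (hΦ : Measurable Φ) {A : Finset ι} (hA : DependsOn Φ A) (y : ι → ℂ) :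
    ∫⁻ x, Φ x ∂Measure.pi ν = (∫⋯∫⁻_A, Φ ∂ν) y := by
  have h : ∫⋯∫⁻_(Finset.univ \ A), Φ ∂ν = Φ := by
    funext x
    have : ∀ z : ((i : ↥(Finset.univ \ A)) → ℂ), Φ (Function.updateFinset x _ z) = Φ x := fun z =>
      hA fun p hp => by
        rw [Function.updateFinset, dif_neg (by simpa using hp)]
    simp only [lmarginal, this, lintegral_const, measure_univ, mul_one]
  rw [lintegral_eq_lmarginal_univ y, ← Finset.union_sdiff_of_subset (Finset.subset_univ A),
    lmarginal_union ν Φ hΦ Finset.disjoint_sdiff, h]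

omit [Fintype ι] in
lemma measurable_lintegral_update {Φ : (ι → ℂ) → ℝ≥0∞} (hΦ : Measurable Φ) (a : ι) (ν : Measure ℂ)
    [SFinite ν] : Measurable fun x : ι → ℂ => ∫⁻ z, Φ (Function.update x a z) ∂ν :=
  Measurable.lintegral_prod_right' (f := fun p : (ι → ℂ) × ℂ => Φ (Function.update p.1 a p.2))
    (hΦ.comp measurable_update')

omit [Fintype ι] in
lemma lmarginal_withDensity (q : ι → ℂ → ℝ≥0∞) (hq : ∀ p, Measurable (q p))
    [∀ p, IsProbabilityMeasure ((volume : Measure ℂ).withDensity (q p))] {Φ : (ι → ℂ) → ℝ≥0∞}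
    (hΦ : Measurable Φ) (s : Finset ι) :
    ∫⋯∫⁻_s, Φ ∂(fun p => volume.withDensity (q p)) =
      ∫⋯∫⁻_s, (fun y => (∏ p ∈ s, q p (y p)) * Φ y) ∂fun _ => volume := by
  induction s using Finset.induction generalizing Φ with
  | empty => simp
  | insert a s ha ih =>
    have hm : Measurable fun y : ι → ℂ => (∏ p ∈ insert a s, q p (y p)) * Φ y :=
      (Finset.measurable_prod _ fun p _ => (hq p).comp (measurable_pi_apply p)).mul hΦ
    rw [lmarginal_insert' _ hΦ ha, lmarginal_insert' _ hm ha,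
      ih (measurable_lintegral_update hΦ a _)]
    congr 1
    funext x
    have hup : Measurable fun z => Φ (Function.update x a z) := hΦ.comp (measurable_update x)
    rw [lintegral_withDensity_eq_lintegral_mul _ (hq a) hup,
      ← lintegral_const_mul _ ((hq a).mul hup)]
    refine lintegral_congr fun z => ?_
    rw [Finset.prod_insert ha]
    simp only [Pi.mul_apply, Function.update_self]
    have hs : ∀ p ∈ s, q p (Function.update x a z p) = q p (x p) := fun p hp => by
      rw [Function.update_of_ne (ne_of_mem_of_not_mem hp ha)]
    rw [Finset.prod_congr rfl hs]
    ring

end Marginal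

/-! ### Entropies of Gaussian mixtures -/

section Entropy

variable {W ι : Type*} [Fintype W] [Nonempty W] [Fintype ι] [DecidableEq ι]

/-- The law of the outputs when a uniformly distributed codeword is sent. -/
noncomputable def outLaw (c : W → ι → ℂ) : Measure (ι → ℂ) :=
  (Fintype.card W : ℝ≥0∞)⁻¹ •
    ∑ m, (Measure.pi fun _ : ι => complexGaussian).map fun z => c m + z

lemma card_inv_mul_card : (Fintype.card W : ℝ≥0∞)⁻¹ * Fintype.card W = 1 :=
  ENNReal.inv_mul_cancel (by simp) (by simp)

omit [Nonempty W] [DecidableEq ι] in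
lemma lintegral_outLaw (c : W → ι → ℂ) {Φ : (ι → ℂ) → ℝ≥0∞} (hΦ : Measurable Φ) :
    ∫⁻ y, Φ y ∂outLaw c = (Fintype.card W : ℝ≥0∞)⁻¹ *
      ∑ m, ∫⁻ z, Φ (c m + z) ∂Measure.pi fun _ : ι => complexGaussian := by
  rw [outLaw, lintegral_smul_measure, lintegral_finsetSum_measure, smul_eq_mul]
  congr 1
  exact Finset.sum_congr rfl fun m _ => lintegral_map hΦ (by fun_prop)

omit [DecidableEq ι] in
instance (c : W → ι → ℂ) : IsProbabilityMeasure (outLaw c) := by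
  constructor
  rw [← lintegral_one, lintegral_outLaw c measurable_const]
  simp [card_inv_mul_card]

/-- The density of the outputs in the coordinates in `A`. -/
noncomputable def dens (c : W → ι → ℂ) (A : Finset ι) (y : ι → ℂ) : ℝ :=
  (Fintype.card W : ℝ)⁻¹ * ∑ m, ∏ p ∈ A, gauss 1 (y p - c m p)

omit [Fintype ι] [DecidableEq ι] in
lemma dens_pos (c : W → ι → ℂ) (A : Finset ι) (y : ι → ℂ) : 0 < dens c A y := by
  have : (0 : ℝ) < Fintype.card W := by exact_mod_cast Fintype.card_pos
  refine mul_pos (by positivity) (Finset.sum_pos (fun m _ => ?_) Finset.univ_nonempty)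
  exact Finset.prod_pos fun p _ => gauss_pos one_pos _

omit [Fintype ι] [DecidableEq ι] in
lemma dens_le_one (c : W → ι → ℂ) (A : Finset ι) (y : ι → ℂ) : dens c A y ≤ 1 := by
  have h0 : (0 : ℝ) < Fintype.card W := by exact_mod_cast Fintype.card_pos
  have : ∑ m, ∏ p ∈ A, gauss 1 (y p - c m p) ≤ ∑ _m : W, (1 : ℝ) :=
    Finset.sum_le_sum fun m _ => Finset.prod_le_one (fun p _ => (gauss_pos one_pos _).le)
      fun p _ => gauss_le_one le_rfl _
  rw [dens, inv_mul_le_iff₀ h0]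
  simpa using this

omit [Nonempty W] [Fintype ι] [DecidableEq ι] in
lemma dens_congr {c c' : W → ι → ℂ} {A : Finset ι} {y y' : ι → ℂ}
    (hc : ∀ m, ∀ p ∈ A, c m p = c' m p) (hy : ∀ p ∈ A, y p = y' p) :
    dens c A y = dens c' A y' := by
  unfold dens
  congr 1
  refine Finset.sum_congr rfl fun m _ => Finset.prod_congr rfl fun p hp => ?_
  rw [hc m p hp, hy p hp]

omit [Nonempty W] [Fintype ι] [DecidableEq ι] in
lemma dependsOn_dens (c : W → ι → ℂ) (A : Finset ι) : DependsOn (dens c A) A :=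
  fun _ _ h => dens_congr (fun _ _ _ => rfl) h

omit [Nonempty W] [Fintype ι] [DecidableEq ι] in
lemma measurable_dens_comp {α : Type*} [MeasurableSpace α] {c : α → W → ι → ℂ} {y : α → ι → ℂ}
    (hc : ∀ m p, Measurable fun x => c x m p) (hy : ∀ p, Measurable fun x => y x p)
    (A : Finset ι) : Measurable fun x => dens (c x) A (y x) := by
  unfold dens
  exact (Finset.measurable_sum _ fun m _ => Finset.measurable_prod _ fun p _ =>
    (measurable_gauss 1).comp ((hy p).sub (hc m p))).const_mul _

omit [Nonempty W] [Fintype ι] [DecidableEq ι] in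
@[fun_prop]
lemma measurable_dens (c : W → ι → ℂ) (A : Finset ι) : Measurable (dens c A) := by
  unfold dens
  exact (Finset.measurable_sum _ fun m _ => Finset.measurable_prod _ fun p _ =>
    (measurable_gauss 1).comp ((measurable_pi_apply p).sub measurable_const)).const_mul _

omit [Nonempty W] [Fintype ι] [DecidableEq ι] in
lemma ofReal_dens (c : W → ι → ℂ) (A : Finset ι) (y : ι → ℂ) :
    ENNReal.ofReal (dens c A y) = (Fintype.card W : ℝ≥0∞)⁻¹ *
      ∑ m, ∏ p ∈ A, ENNReal.ofReal (gauss 1 (y p - c m p)) := by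
  have hnn : ∀ m, 0 ≤ ∏ p ∈ A, gauss 1 (y p - c m p) := fun m =>
    Finset.prod_nonneg fun p _ => (gauss_pos one_pos _).le
  rcases isEmpty_or_nonempty W with hW | hW
  · simp [dens]
  have h0 : (0 : ℝ) < Fintype.card W := by exact_mod_cast Fintype.card_pos
  rw [dens, ENNReal.ofReal_mul (by positivity), ENNReal.ofReal_inv_of_pos h0,
    ENNReal.ofReal_natCast, ENNReal.ofReal_sum_of_nonneg fun m _ => hnn m]
  congr 1
  exact Finset.sum_congr rfl fun m _ =>
    ENNReal.ofReal_prod_of_nonneg fun p _ => (gauss_pos one_pos _).le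

omit [Nonempty W] in
/-- The density `dens c A` describes the law of the coordinates in `A`. -/
lemma lintegral_outLaw_eq_lmarginal (c : W → ι → ℂ) {A : Finset ι} {Φ : (ι → ℂ) → ℝ≥0∞}
    (hΦ : Measurable Φ) (hA : DependsOn Φ A) (y : ι → ℂ) :
    ∫⁻ x, Φ x ∂outLaw c =
      (∫⋯∫⁻_A, (fun x => ENNReal.ofReal (dens c A x) * Φ x) ∂fun _ => volume) y := by
  let q : W → ι → ℂ → ℝ≥0∞ := fun m p z => ENNReal.ofReal (gauss 1 (z - c m p))
  have hq : ∀ m p, Measurable (q m p) := fun m p => by fun_prop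
  have hmap : ∀ m p, (volume : Measure ℂ).withDensity (q m p) =
      complexGaussian.map fun z => c m p + z := fun m p => (map_add_complexGaussian _).symm
  have hprob : ∀ m p, IsProbabilityMeasure ((volume : Measure ℂ).withDensity (q m p)) :=
    fun m p => by
      rw [hmap]
      exact Measure.isProbabilityMeasure_map (by fun_prop)
  have hterm : ∀ m, ∫⁻ z, Φ (c m + z) ∂(Measure.pi fun _ : ι => complexGaussian) =
      (∫⋯∫⁻_A, (fun x => (∏ p ∈ A, q m p (x p)) * Φ x) ∂fun _ => volume) y := by
    intro m
    have h1 : (Measure.pi fun _ : ι => complexGaussian).map (fun z => c m + z) =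
        Measure.pi fun p => (volume : Measure ℂ).withDensity (q m p) := by
      have : ∀ p, SigmaFinite (complexGaussian.map fun z => c m p + z) := fun p => by
        rw [← hmap]; infer_instance
      simp only [hmap]
      exact Measure.pi_map_pi (μ := fun _ => complexGaussian) (f := fun p z => c m p + z)
        fun p => (by fun_prop : Measurable fun z => c m p + z).aemeasurable
    rw [← lmarginal_withDensity (q m) (hq m) hΦ A, ← lintegral_pi_eq_lmarginal _ hΦ hA y, ← h1,
      lintegral_map hΦ (by fun_prop)]
  have hmeas : ∀ m, Measurable fun x : ι → ℂ => (∏ p ∈ A, q m p (x p)) * Φ x := fun m =>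
    (Finset.measurable_prod _ fun p _ => (hq m p).comp (measurable_pi_apply p)).mul hΦ
  rw [lintegral_outLaw c hΦ]
  simp only [hterm, lmarginal]
  have hm : ∀ m, Measurable fun z : A → ℂ =>
      (∏ p ∈ A, q m p (Function.updateFinset y A z p)) * Φ (Function.updateFinset y A z) :=
    fun m => (hmeas m).comp measurable_updateFinset
  calc _ = (Fintype.card W : ℝ≥0∞)⁻¹ * ∫⁻ z : A → ℂ, ∑ m,
        (∏ p ∈ A, q m p (Function.updateFinset y A z p)) * Φ (Function.updateFinset y A z)
          ∂Measure.pi fun _ => volume := by rw [lintegral_finsetSum _ fun m _ => hm m]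
    _ = _ := by
      rw [← lintegral_const_mul _ (Finset.measurable_fun_sum _ fun m _ => hm m)]
      refine lintegral_congr fun z => ?_
      rw [ofReal_dens, ← Finset.sum_mul, ← mul_assoc]

/-- The differential entropy of the outputs in the coordinates in `A`. -/
noncomputable def ent (c : W → ι → ℂ) (A : Finset ι) : ℝ≥0∞ :=
  ∫⁻ y, ENNReal.ofReal (-Real.log (dens c A y)) ∂outLaw c

omit [Nonempty W] [DecidableEq ι] in
lemma ent_eq (c : W → ι → ℂ) (A : Finset ι) : ent c A = (Fintype.card W : ℝ≥0∞)⁻¹ *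
    ∑ m, ∫⁻ z, ENNReal.ofReal (-Real.log (dens c A (c m + z)))
      ∂Measure.pi fun _ : ι => complexGaussian :=
  lintegral_outLaw c (by fun_prop)

omit [Nonempty W] [DecidableEq ι] in
lemma ent_congr {c c' : W → ι → ℂ} {A : Finset ι} (h : ∀ m, ∀ p ∈ A, c m p = c' m p) :
    ent c A = ent c' A := by
  rw [ent_eq, ent_eq]
  congr 1
  refine Finset.sum_congr rfl fun m _ => lintegral_congr fun z => ?_
  rw [dens_congr (y := c m + z) (y' := c' m + z) h fun p hp => by
    simp only [Pi.add_apply, h m p hp]]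

omit [DecidableEq ι] in
lemma ent_empty (c : W → ι → ℂ) : ent c ∅ = 0 := by
  have : (Fintype.card W : ℝ) ≠ 0 := by exact_mod_cast Fintype.card_ne_zero
  simp [ent, dens, this]

omit [Nonempty W] in
/-- Relabelling the coordinates. -/
lemma ent_image (c : W → ι → ℂ) (σ : Equiv.Perm ι) (A : Finset ι) :
    ent (fun m p => c m (σ p)) A = ent c (A.image σ) := by
  have hd : ∀ y : ι → ℂ, dens (fun m p => c m (σ p)) A (fun p => y (σ p)) = dens c (A.image σ) y := by
    intro y
    unfold dens
    congr 1
    refine Finset.sum_congr rfl fun m _ => ?_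
    rw [Finset.prod_image fun _ _ _ _ h => σ.injective h]
  rw [ent_eq, ent_eq]
  congr 1
  refine Finset.sum_congr rfl fun m _ => ?_
  have := (pi_map_comp_injective complexGaussian σ.injective).lintegral_comp
    (f := fun z => ENNReal.ofReal (-Real.log (dens (fun m p => c m (σ p)) A
      ((fun p => c m (σ p)) + z)))) (by fun_prop)
  rw [← this]
  refine lintegral_congr fun z => ?_
  rw [← hd]
  rfl

/-! ### Gibbs inequalities -/

/-- This is the form in which `log x ≤ x - 1` is used: `r` is a ratio of densities with mean at most
`1`. Keeping `1` on both sides avoids subtraction in `ℝ≥0∞`, so `F` and `G` may have infinite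
integrals. -/
lemma lintegral_le_of_add_one_le {α : Type*} [MeasurableSpace α] {P : Measure α}
    [IsProbabilityMeasure P] {F G r : α → ℝ≥0∞} (hr : Measurable r) (hr1 : ∫⁻ x, r x ∂P ≤ 1)
    (h : ∀ x, F x + 1 ≤ G x + r x) : ∫⁻ x, F x ∂P ≤ ∫⁻ x, G x ∂P := by
  have h1 : ∫⁻ x, F x ∂P + 1 ≤ ∫⁻ x, G x ∂P + 1 :=
    calc ∫⁻ x, F x ∂P + 1 = ∫⁻ x, (F x + 1) ∂P := by
          rw [lintegral_add_right _ measurable_const]; simp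
      _ ≤ ∫⁻ x, (G x + r x) ∂P := lintegral_mono h
      _ = ∫⁻ x, G x ∂P + ∫⁻ x, r x ∂P := lintegral_add_right _ hr
      _ ≤ _ := by gcongr
  exact (ENNReal.add_le_add_iff_right ENNReal.one_ne_top).1 h1

lemma neg_log_add_one_le {a b : ℝ} (ha : 0 < a) (hb : 0 < b) :
    -Real.log a + 1 ≤ -Real.log b + b / a := by
  have := Real.add_one_le_exp (Real.log (b / a))
  rw [Real.exp_log (div_pos hb ha), Real.log_div hb.ne' ha.ne'] at this
  linarith

lemma lmarginal_dens (c : W → ι → ℂ) (A : Finset ι) (y : ι → ℂ) :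
    (∫⋯∫⁻_A, (fun x => ENNReal.ofReal (dens c A x)) ∂fun _ => volume) y = 1 := by
  have := lintegral_outLaw_eq_lmarginal c (A := A) (Φ := fun _ => 1) measurable_const
    (fun _ _ _ => rfl) y
  simpa using this.symm

omit [Nonempty W] [Fintype ι] in
lemma lintegral_dens_insert (c : W → ι → ℂ) {A : Finset ι} {a : ι} (ha : a ∉ A) (y : ι → ℂ) :
    ∫⁻ z, ENNReal.ofReal (dens c (insert a A) (Function.update y a z)) =
      ENNReal.ofReal (dens c A y) := by
  have hg : ∀ m, ∫⁻ z, ENNReal.ofReal (gauss 1 (z - c m a)) = 1 := fun m => by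
    have := lintegral_sub_right_eq_self (μ := (volume : Measure ℂ))
      (fun z => ENNReal.ofReal (gauss 1 z)) (c m a)
    rw [this, lintegral_gauss one_pos]
  have hprod : ∀ m z, ∏ p ∈ insert a A, ENNReal.ofReal (gauss 1 (Function.update y a z p - c m p)) =
      ENNReal.ofReal (gauss 1 (z - c m a)) * ∏ p ∈ A, ENNReal.ofReal (gauss 1 (y p - c m p)) := by
    intro m z
    rw [Finset.prod_insert ha, Function.update_self]
    congr 1
    refine Finset.prod_congr rfl fun p hp => ?_
    rw [Function.update_of_ne (ne_of_mem_of_not_mem hp ha)]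
  simp only [ofReal_dens, hprod]
  rw [lintegral_const_mul _ (by fun_prop), lintegral_finsetSum _ fun m _ => by fun_prop]
  congr 1
  refine Finset.sum_congr rfl fun m _ => ?_
  rw [lintegral_mul_const _ (by fun_prop), hg, one_mul]

/-- Conditioning reduces entropy. -/
lemma ent_submodular (c : W → ι → ℂ) {B C : Finset ι} (hCB : C ⊆ B) {a : ι} (ha : a ∉ B) :
    ent c (insert a B) + ent c C ≤ ent c B + ent c (insert a C) := by
  have haC : a ∉ C := fun h => ha (hCB h)
  -- The numerator over `dens c C` is the density on `insert a B` that would hold if coordinate `a`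
  -- were independent of `B` given `C`. Integrating out `a` first shows that it has total mass `1`,
  -- and Gibbs' inequality against the true density is the claim.
  let r : (ι → ℂ) → ℝ≥0∞ := fun y => ENNReal.ofReal
    (dens c B y * dens c (insert a C) y / (dens c C y * dens c (insert a B) y))
  have hr : Measurable r := by fun_prop
  have hdep : DependsOn r ↑(insert a B) := by
    intro x y h
    have hB : ∀ p ∈ B, x p = y p := fun p hp => h p (Finset.mem_insert_of_mem hp)
    have hC : ∀ p ∈ C, x p = y p := fun p hp => hB p (hCB hp)
    have ha' : ∀ p ∈ insert a C, x p = y p := fun p hp =>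
      h p (Finset.insert_subset_insert a hCB hp)
    simp only [r]
    rw [dependsOn_dens c B hB, dependsOn_dens c C hC, dependsOn_dens c _ ha', dependsOn_dens c _ h]
  have hr1 : ∫⁻ y, r y ∂outLaw c ≤ 1 := by
    rw [lintegral_outLaw_eq_lmarginal c hr hdep 0]
    have e1 : (fun x => ENNReal.ofReal (dens c (insert a B) x) * r x) = fun x =>
        ENNReal.ofReal (dens c B x) * (ENNReal.ofReal (dens c C x))⁻¹ *
          ENNReal.ofReal (dens c (insert a C) x) := by
      funext x
      have p1 := dens_pos c (insert a B) x
      have p2 := dens_pos c C x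
      have p3 := dens_pos c B x
      rw [← ENNReal.ofReal_mul p1.le, ← ENNReal.ofReal_inv_of_pos p2, ← ENNReal.ofReal_mul p3.le,
        ← ENNReal.ofReal_mul (by positivity)]
      congr 1
      field_simp
    rw [e1, lmarginal_insert' _ (by fun_prop) ha]
    have e2 : (fun x : ι → ℂ => ∫⁻ z, ENNReal.ofReal (dens c B (Function.update x a z)) *
        (ENNReal.ofReal (dens c C (Function.update x a z)))⁻¹ *
          ENNReal.ofReal (dens c (insert a C) (Function.update x a z))) = fun x =>
        ENNReal.ofReal (dens c B x) := by
      funext x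
      have u1 : ∀ z, dens c B (Function.update x a z) = dens c B x := fun z =>
        dependsOn_dens c B fun p hp => Function.update_of_ne (ne_of_mem_of_not_mem hp ha) _ _
      have u2 : ∀ z, dens c C (Function.update x a z) = dens c C x := fun z =>
        dependsOn_dens c C fun p hp => Function.update_of_ne (ne_of_mem_of_not_mem hp haC) _ _
      simp only [u1, u2]
      rw [lintegral_const_mul _ (by
        exact ((measurable_dens c _).comp (measurable_update x)).ennreal_ofReal),
        lintegral_dens_insert c haC, mul_assoc, ENNReal.inv_mul_cancel, mul_one]
      · exact (ENNReal.ofReal_pos.2 (dens_pos c C x)).ne'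
      · exact ENNReal.ofReal_ne_top
    rw [e2, lmarginal_dens]
  have key := lintegral_le_of_add_one_le hr hr1
    (F := fun y => ENNReal.ofReal (-Real.log (dens c (insert a B) y)) +
      ENNReal.ofReal (-Real.log (dens c C y)))
    (G := fun y => ENNReal.ofReal (-Real.log (dens c B y)) +
      ENNReal.ofReal (-Real.log (dens c (insert a C) y))) fun y => by
    have hl : ∀ A, 0 ≤ -Real.log (dens c A y) := fun A =>
      neg_nonneg.2 (Real.log_nonpos (dens_pos c A y).le (dens_le_one c A y))
    have p1 := dens_pos c (insert a B) y
    have p2 := dens_pos c C y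
    have p3 := dens_pos c B y
    have p4 := dens_pos c (insert a C) y
    have hp := neg_log_add_one_le (mul_pos p2 p1) (mul_pos p3 p4)
    rw [Real.log_mul p2.ne' p1.ne', Real.log_mul p3.ne' p4.ne'] at hp
    simp only [r]
    rw [← ENNReal.ofReal_one, ← ENNReal.ofReal_add (hl _) (hl _),
      ← ENNReal.ofReal_add (add_nonneg (hl _) (hl _)) zero_le_one,
      ← ENNReal.ofReal_add (hl _) (hl _),
      ← ENNReal.ofReal_add (add_nonneg (hl _) (hl _)) (by positivity)]
    exact ENNReal.ofReal_le_ofReal (by linarith)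
  rwa [lintegral_add_left (by fun_prop), lintegral_add_left (by fun_prop)] at key

/-- Gaussian densities with given variances bound the entropy. -/
lemma ent_le (c : W → ι → ℂ) (A : Finset ι) (v : ι → ℝ) (hv : ∀ p, 1 ≤ v p) :
    ent c A ≤ ∑ p ∈ A, ∫⁻ y, ENNReal.ofReal (-Real.log (gauss (v p) (y p))) ∂outLaw c := by
  have hv0 : ∀ p, 0 < v p := fun p => one_pos.trans_le (hv p)
  -- Gibbs' inequality against the product of centered Gaussians.
  let g : (ι → ℂ) → ℝ := fun y => ∏ p ∈ A, gauss (v p) (y p)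
  have hg : Measurable g := Finset.measurable_prod _ fun p _ => by fun_prop
  have hg0 : ∀ y, 0 < g y := fun y => Finset.prod_pos fun p _ => gauss_pos (hv0 p) _
  have hr1 : ∫⁻ y, ENNReal.ofReal (g y / dens c A y) ∂outLaw c ≤ 1 := by
    rw [lintegral_outLaw_eq_lmarginal c (by fun_prop) (fun x y h => ?_) 0]
    · have e1 : (fun x => ENNReal.ofReal (dens c A x) * ENNReal.ofReal (g x / dens c A x)) =
          fun x => (∏ p ∈ A, ENNReal.ofReal (gauss (v p) (x p))) * 1 := by
        funext x
        rw [← ENNReal.ofReal_mul (dens_pos c A x).le, mul_div_cancel₀ _ (dens_pos c A x).ne',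
          mul_one, ENNReal.ofReal_prod_of_nonneg fun p _ => (gauss_pos (hv0 p) _).le]
      have := fun p => isProbabilityMeasure_gauss (hv0 p)
      rw [e1, ← lmarginal_withDensity (fun p z => ENNReal.ofReal (gauss (v p) z))
        (fun p => by fun_prop) (Φ := fun _ => 1) measurable_const]
      simp [lmarginal]
    · have h1 : g x = g y := Finset.prod_congr rfl fun p hp => by rw [h p hp]
      simp only [h1, dependsOn_dens c A h]
  have key := lintegral_le_of_add_one_le (P := outLaw c) (by fun_prop) hr1
    (F := fun y => ENNReal.ofReal (-Real.log (dens c A y)))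
    (G := fun y => ∑ p ∈ A, ENNReal.ofReal (-Real.log (gauss (v p) (y p)))) fun y => by
    have hp := neg_log_add_one_le (dens_pos c A y) (hg0 y)
    have hlog : -Real.log (g y) = ∑ p ∈ A, -Real.log (gauss (v p) (y p)) := by
      rw [Real.log_prod fun p _ => (gauss_pos (hv0 p) _).ne', Finset.sum_neg_distrib]
    have hnn : ∀ p ∈ A, 0 ≤ -Real.log (gauss (v p) (y p)) := fun p _ =>
      neg_nonneg.2 (Real.log_nonpos (gauss_pos (hv0 p) _).le (gauss_le_one (hv p) _))
    rw [← ENNReal.ofReal_sum_of_nonneg hnn, ← hlog, ← ENNReal.ofReal_one,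
      ← ENNReal.ofReal_add (neg_nonneg.2 (Real.log_nonpos (dens_pos c A y).le (dens_le_one c A y)))
        zero_le_one, ← ENNReal.ofReal_add (hlog ▸ Finset.sum_nonneg hnn)
        (div_pos (hg0 y) (dens_pos c A y)).le]
    exact ENNReal.ofReal_le_ofReal hp
  rwa [lintegral_finsetSum _ fun p _ => by fun_prop] at key

end Entropy

/-! ### Statistically equivalent outputs -/

section Rows

variable {n : ℕ}

/-- The outputs of the receivers in `S` in the first `k` slots. -/
def rows (n k : ℕ) (S : Finset (Fin 3)) : Finset (Fin n × Fin 3) :=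
  Finset.univ.filter fun p => p.1.val < k ∧ p.2 ∈ S

@[simp]
lemma mem_rows {k : ℕ} {S : Finset (Fin 3)} {p : Fin n × Fin 3} :
    p ∈ rows n k S ↔ p.1.val < k ∧ p.2 ∈ S := by simp [rows]

@[simp]
lemma rows_zero (S : Finset (Fin 3)) : rows n 0 S = ∅ := by ext; simp

/-- Relabelling the receivers in slot `t`. -/
def relabel (t : Fin n) (π : Equiv.Perm (Fin 3)) : Equiv.Perm (Fin n × Fin 3) where
  toFun p := (p.1, if p.1 = t then π p.2 else p.2)
  invFun p := (p.1, if p.1 = t then π.symm p.2 else p.2)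
  left_inv p := by by_cases h : p.1 = t <;> simp [h, Prod.ext_iff]
  right_inv p := by by_cases h : p.1 = t <;> simp [h, Prod.ext_iff]

/-- A submodular function that does not see which receivers it looks at in the last slot. -/
structure IsSymmSubmodular (h : Finset (Fin n × Fin 3) → ℝ) : Prop where
  empty : h ∅ = 0
  submodular : ∀ {B C : Finset (Fin n × Fin 3)} {a : Fin n × Fin 3}, C ⊆ B → a ∉ B →
    h (insert a B) + h C ≤ h B + h (insert a C)
  symm : ∀ (t : Fin n) (π : Equiv.Perm (Fin 3)) {A : Finset (Fin n × Fin 3)},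
    (∀ p ∈ A, p.1 ≤ t) → h (A.image (relabel t π)) = h A

namespace IsSymmSubmodular

variable {h : Finset (Fin n × Fin 3) → ℝ}

/-- Swapping the two receivers in slot `t` moves one new output to the other and fixes the outputs
of earlier slots. -/
lemma insert_eq (hh : IsSymmSubmodular h) (t : Fin n) (S : Finset (Fin 3)) (i j : Fin 3) :
    h (insert (t, i) (rows n t S)) = h (insert (t, j) (rows n t S)) := by
  have h1 : (insert (t, j) (rows n t S)).image (relabel t (Equiv.swap i j)) =
      insert (t, i) (rows n t S) := by
    rw [Finset.image_insert]
    congr 1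
    · simp [relabel]
    · refine (Finset.image_congr fun p hp => ?_).trans Finset.image_id
      have : p.1 ≠ t := fun h => by simp [h] at hp
      simp [relabel, this]
  rw [← h1, hh.symm]
  intro p hp
  rcases Finset.mem_insert.1 hp with rfl | hp
  · exact le_rfl
  · exact (mem_rows.1 hp).1.le

lemma insert_insert_eq (hh : IsSymmSubmodular h) (t : Fin n) (S : Finset (Fin 3)) {i j k : Fin 3}
    (hij : i ≠ j) (hik : i ≠ k) :
    h (insert (t, j) (insert (t, i) (rows n t S))) =
      h (insert (t, k) (insert (t, i) (rows n t S))) := by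
  have h1 : (insert (t, k) (insert (t, i) (rows n t S))).image (relabel t (Equiv.swap j k)) =
      insert (t, j) (insert (t, i) (rows n t S)) := by
    rw [Finset.image_insert, Finset.image_insert]
    congr 1
    · simp [relabel]
    congr 1
    · simp [relabel, Equiv.swap_apply_of_ne_of_ne hij hik]
    · refine (Finset.image_congr fun p hp => ?_).trans Finset.image_id
      have : p.1 ≠ t := fun h => by simp [h] at hp
      simp [relabel, this]
  rw [← h1, hh.symm]
  intro p hp
  rcases Finset.mem_insert.1 hp with rfl | hp
  · exact le_rfl
  rcases Finset.mem_insert.1 hp with rfl | hp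
  · exact le_rfl
  · exact (mem_rows.1 hp).1.le

lemma rows_succ_one (t : Fin n) (a : Fin 3) :
    rows n (t + 1) {a} = insert (t, a) (rows n t {a}) := by
  ext ⟨s, i⟩
  simp only [mem_rows, Finset.mem_insert, Finset.mem_singleton, Prod.mk.injEq, Fin.ext_iff]
  omega

lemma rows_succ_two (t : Fin n) (a b : Fin 3) :
    rows n (t + 1) {a, b} = insert (t, b) (insert (t, a) (rows n t {a, b})) := by
  ext ⟨s, i⟩
  simp only [mem_rows, Finset.mem_insert, Finset.mem_singleton, Prod.mk.injEq, Fin.ext_iff]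
  omega

lemma rows_succ_three (t : Fin n) (a b c : Fin 3) :
    rows n (t + 1) {a, b, c} =
      insert (t, c) (insert (t, b) (insert (t, a) (rows n t {a, b, c}))) := by
  ext ⟨s, i⟩
  simp only [mem_rows, Finset.mem_insert, Finset.mem_singleton, Prod.mk.injEq, Fin.ext_iff]
  omega

lemma rows_mono {k : ℕ} {S S' : Finset (Fin 3)} (h : S ⊆ S') : rows n k S ⊆ rows n k S' :=
  fun _ hp => mem_rows.2 ⟨(mem_rows.1 hp).1, h (mem_rows.1 hp).2⟩

/-- The inequality holds for the increment of every slot. Given the past of both receivers, the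
second new output adds at most what it would add alone, which by symmetry is what the first adds;
and the first adds at most its increment given only the past of `a`. -/
lemma rows_two_le (hh : IsSymmSubmodular h) {a b : Fin 3} (hab : a ≠ b) :
    ∀ k ≤ n, h (rows n k {a, b}) ≤ 2 * h (rows n k {a})
  | 0, _ => by simp [hh.empty]
  | k + 1, hk => by
    have ih := rows_two_le hh hab k (by omega)
    let t : Fin n := ⟨k, by omega⟩
    have e1 := rows_succ_one t a
    have e2 := rows_succ_two t a b
    have s1 := hh.submodular (a := (t, b)) (C := rows n t {a, b})
      (B := insert (t, a) (rows n t {a, b})) (Finset.subset_insert _ _) (by simp [hab.symm])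
    have s2 := hh.submodular (a := (t, a)) (C := rows n t {a}) (B := rows n t {a, b})
      (rows_mono (by simp)) (by simp)
    rw [← e2, hh.insert_eq t _ b a] at s1
    rw [← e1] at s2
    simp only [t] at s1 s2
    linarith

/-- Given the past of all three receivers, the new outputs of one slot add `x₁ ≥ x₂ ≥ x₃` by
submodularity and symmetry, so `2 (x₁ + x₂ + x₃) ≤ 3 (x₁ + x₂)`. Forgetting the past of `c` only
increases `x₁` and `x₂`. Summation over the slots gives the claim. -/
lemma rows_three_le (hh : IsSymmSubmodular h) {a b c : Fin 3} (hab : a ≠ b) (hac : a ≠ c)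
    (hbc : b ≠ c) : ∀ k ≤ n, 2 * h (rows n k {a, b, c}) ≤ 3 * h (rows n k {a, b})
  | 0, _ => by simp [hh.empty]
  | k + 1, hk => by
    have ih := rows_three_le hh hab hac hbc k (by omega)
    let t : Fin n := ⟨k, by omega⟩
    have e2 := rows_succ_two t a b
    have e3 := rows_succ_three t a b c
    have s1 := hh.submodular (a := (t, c)) (C := insert (t, a) (rows n t {a, b, c}))
      (B := insert (t, b) (insert (t, a) (rows n t {a, b, c}))) (Finset.subset_insert _ _)
      (by simp [hac.symm, hbc.symm])
    have s2 := hh.submodular (a := (t, b)) (C := rows n t {a, b, c})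
      (B := insert (t, a) (rows n t {a, b, c})) (Finset.subset_insert _ _) (by simp [hab.symm])
    have hsub : rows n t {a, b} ⊆ rows n t {a, b, c} :=
      rows_mono (by intro; simp only [Finset.mem_insert, Finset.mem_singleton]; tauto)
    have s3 := hh.submodular (a := (t, a)) hsub (by simp)
    have s4 := hh.submodular (a := (t, b)) (Finset.insert_subset_insert (t, a) hsub)
      (by simp [hab.symm])
    rw [← e3, hh.insert_insert_eq t _ hac hab] at s1
    rw [hh.insert_eq t _ b a] at s2
    rw [← e2] at s4
    simp only [t] at s1 s2 s3 s4
    linarith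

end IsSymmSubmodular

end Rows

/-! ### Mean entropies -/

section MeanEntropy

variable {W : Type*} [Fintype W] {n : ℕ} {μ : Fin 3 → Measure (Fin 3 → ℂ)}

/-- The noise-free outputs of all receivers. -/
def codebook (e : W → Chan n → Fin n → Fin 3 → ℂ) (H : Chan n) (m : W) (p : Fin n × Fin 3) : ℂ :=
  H p.1 p.2 ⬝ᵥ e m H p.1

omit [Fintype W] in
lemma measurable_codebook {e : W → Chan n → Fin n → Fin 3 → ℂ} (he : ∀ m, Measurable (e m))
    (m : W) (p : Fin n × Fin 3) : Measurable fun H => codebook e H m p := by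
  have := he m
  unfold codebook
  exact measurable_dotProduct (by fun_prop) (by fun_prop)

/-- The entropy of the outputs in `A`, given the channels. -/
noncomputable def meanEnt (μ : Fin 3 → Measure (Fin 3 → ℂ)) (e : W → Chan n → Fin n → Fin 3 → ℂ)
    (A : Finset (Fin n × Fin 3)) : ℝ≥0∞ :=
  ∫⁻ H, ent (codebook e H) A ∂channelLaw μ n

lemma measurable_ent {e : W → Chan n → Fin n → Fin 3 → ℂ} (he : ∀ m, Measurable (e m))
    (A : Finset (Fin n × Fin 3)) : Measurable fun H => ent (codebook e H) A := by
  simp only [ent_eq]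
  refine (Finset.measurable_fun_sum _ fun m _ => ?_).const_mul _
  refine Measurable.lintegral_prod_right' (f := fun x : Chan n × (Fin n × Fin 3 → ℂ) =>
    ENNReal.ofReal (-Real.log (dens (codebook e x.1) A (codebook e x.1 m + x.2)))) ?_
  refine (Real.measurable_log.comp (measurable_dens_comp (fun m p =>
    (measurable_codebook he m p).comp measurable_fst) (fun p => ?_) A)).neg.ennreal_ofReal
  exact ((measurable_codebook he m p).comp measurable_fst).add
    ((measurable_pi_apply p).comp measurable_snd)

lemma meanEnt_submodular [Nonempty W] {e : W → Chan n → Fin n → Fin 3 → ℂ}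
    (he : ∀ m, Measurable (e m)) {B C : Finset (Fin n × Fin 3)} (hCB : C ⊆ B)
    {a : Fin n × Fin 3} (ha : a ∉ B) :
    meanEnt μ e (insert a B) + meanEnt μ e C ≤ meanEnt μ e B + meanEnt μ e (insert a C) := by
  unfold meanEnt
  rw [← lintegral_add_left (measurable_ent he _), ← lintegral_add_left (measurable_ent he _)]
  exact lintegral_mono fun H => ent_submodular _ hCB ha

lemma meanEnt_empty [Nonempty W] (e : W → Chan n → Fin n → Fin 3 → ℂ) : meanEnt μ e ∅ = 0 := by
  simp [meanEnt, ent_empty]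

/-- With delayed CSIT and statistically equivalent receivers, the outputs in the last slot may be
permuted. -/
lemma meanEnt_relabel [∀ i, IsProbabilityMeasure (μ i)] (hμ : ∀ i j, μ i = μ j)
    {e : W → Chan n → Fin n → Fin 3 → ℂ} (he : ∀ m, Measurable (e m))
    (hc : ∀ m, RespectsCSIT ∅ (e m)) (t : Fin n) (π : Equiv.Perm (Fin 3))
    {A : Finset (Fin n × Fin 3)} (hA : ∀ p ∈ A, p.1 ≤ t) :
    meanEnt μ e (A.image (relabel t π)) = meanEnt μ e A := by
  -- Permuting the receivers' channels in slot `t` preserves the law because the channel vectors of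
  -- a slot are i.i.d. across receivers.
  have hmp : MeasurePreserving (fun (H : Chan n) s i => H s (if s = t then π i else i))
      (channelLaw μ n) (channelLaw μ n) := by
    refine measurePreserving_pi (f := fun (s : Fin n) (h : Fin 3 → Fin 3 → ℂ) i =>
      h (if s = t then π i else i)) (fun _ : Fin n => Measure.pi μ) (fun _ => Measure.pi μ)
      fun s => ?_
    have hμ' : μ = fun _ => μ 0 := funext fun i => hμ i 0
    rw [hμ']
    by_cases hs : s = t
    · simpa [hs] using pi_map_comp_injective (μ 0) π.injective
    · simp only [hs, if_false]
      exact MeasurePreserving.id _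
  unfold meanEnt
  rw [← hmp.lintegral_comp (measurable_ent he A)]
  refine lintegral_congr fun H => ?_
  rw [← ent_image]
  refine ent_congr fun m p hp => ?_
  -- Only inputs of slots up to `t` enter, and with delayed CSIT these do not depend on the channels
  -- of slot `t`.
  have h1 : e m (fun s i => H s (if s = t then π i else i)) p.1 = e m H p.1 := by
    refine hc m p.1 _ _ (by simp) fun i s hs => ?_
    rw [if_neg (hs.trans_le (hA p hp)).ne]
  simp only [codebook, relabel, Equiv.coe_fn_mk, h1]

lemma isSymmSubmodular_meanEnt [∀ i, IsProbabilityMeasure (μ i)] [Nonempty W]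
    (hμ : ∀ i j, μ i = μ j) {e : W → Chan n → Fin n → Fin 3 → ℂ} (he : ∀ m, Measurable (e m))
    (hc : ∀ m, RespectsCSIT ∅ (e m)) (hfin : ∀ A, meanEnt μ e A ≠ ∞) :
    IsSymmSubmodular fun A => (meanEnt μ e A).toReal where
  empty := by simp [meanEnt_empty]
  submodular {B C a} hCB ha := by
    rw [← ENNReal.toReal_add (hfin _) (hfin _), ← ENNReal.toReal_add (hfin _) (hfin _)]
    exact ENNReal.toReal_mono (ENNReal.add_ne_top.2 ⟨hfin _, hfin _⟩)
      (meanEnt_submodular he hCB ha)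
  symm t π A hA := by rw [meanEnt_relabel hμ he hc t π hA]

/-! ### Power bounds the entropy -/

lemma norm_sq_dotProduct_le (h x : Fin 3 → ℂ) :
    ‖h ⬝ᵥ x‖ ^ 2 ≤ 3 * ‖h‖ ^ 2 * ∑ j, ‖x j‖ ^ 2 := by
  have h1 : ‖h ⬝ᵥ x‖ ≤ ‖h‖ * ∑ j, ‖x j‖ := by
    rw [dotProduct, Finset.mul_sum]
    refine (norm_sum_le _ _).trans (Finset.sum_le_sum fun j _ => ?_)
    rw [norm_mul]
    gcongr
    exact norm_le_pi_norm h j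
  have h2 : (∑ j, ‖x j‖) ^ 2 ≤ 3 * ∑ j, ‖x j‖ ^ 2 := by
    simpa using sq_sum_le_card_mul_sum_sq (s := Finset.univ) (f := fun j => ‖x j‖)
  calc ‖h ⬝ᵥ x‖ ^ 2 ≤ (‖h‖ * ∑ j, ‖x j‖) ^ 2 := by gcongr
    _ = ‖h‖ ^ 2 * (∑ j, ‖x j‖) ^ 2 := by ring
    _ ≤ ‖h‖ ^ 2 * (3 * ∑ j, ‖x j‖ ^ 2) := by gcongr
    _ = _ := by ring

/-- Gaussian bound for one output. -/
lemma lintegral_neg_log_gauss_le [Nonempty W] {ι : Type*} [Fintype ι] (c : W → ι → ℂ) (p : ι)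
    {v : ℝ} (hv : 1 ≤ v) :
    ∫⁻ y, ENNReal.ofReal (-Real.log (gauss v (y p))) ∂outLaw c ≤
      ENNReal.ofReal (Real.log Real.pi + Real.log v + 8) +
        (Fintype.card W : ℝ≥0∞)⁻¹ * ∑ m, ENNReal.ofReal (2 * v⁻¹ * ‖c m p‖ ^ 2) := by
  have hv0 : 0 < v := one_pos.trans_le hv
  have hπ : 0 ≤ Real.log Real.pi := Real.log_nonneg (by linarith [Real.pi_gt_three])
  have hlv : 0 ≤ Real.log v := Real.log_nonneg hv
  have hpt : ∀ m, ∫⁻ z, ENNReal.ofReal (-Real.log (gauss v (c m p + z p)))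
      ∂(Measure.pi fun _ : ι => complexGaussian) ≤
      ENNReal.ofReal (Real.log Real.pi + Real.log v + 8) +
        ENNReal.ofReal (2 * v⁻¹ * ‖c m p‖ ^ 2) := by
    intro m
    have hmp := measurePreserving_eval (fun _ : ι => complexGaussian) p
    have e1 := hmp.lintegral_comp (f := fun z => ENNReal.ofReal (-Real.log (gauss v (c m p + z))))
      (by fun_prop)
    simp only [Function.eval] at e1
    rw [e1]
    calc ∫⁻ z, ENNReal.ofReal (-Real.log (gauss v (c m p + z))) ∂complexGaussian
        ≤ ∫⁻ z, (ENNReal.ofReal (Real.log Real.pi + Real.log v + 2 * v⁻¹ * ‖c m p‖ ^ 2) +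
            2 * ENNReal.ofReal (‖z‖ ^ 2)) ∂complexGaussian := by
          refine lintegral_mono fun z => ?_
          rw [show (2 : ℝ≥0∞) = ENNReal.ofReal 2 by simp, ← ENNReal.ofReal_mul zero_le_two,
            ← ENNReal.ofReal_add (by positivity) (by positivity), neg_log_gauss hv0]
          refine ENNReal.ofReal_le_ofReal ?_
          have h1 : ‖c m p + z‖ ^ 2 ≤ 2 * ‖c m p‖ ^ 2 + 2 * ‖z‖ ^ 2 := by
            have := norm_add_le (c m p) z
            nlinarith [sq_nonneg (‖c m p‖ - ‖z‖), norm_nonneg (c m p + z), norm_nonneg (c m p),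
              norm_nonneg z]
          have h2 : v⁻¹ * ‖c m p + z‖ ^ 2 ≤ v⁻¹ * (2 * ‖c m p‖ ^ 2 + 2 * ‖z‖ ^ 2) := by gcongr
          have h3 : v⁻¹ * ‖z‖ ^ 2 ≤ 1 * ‖z‖ ^ 2 := by
            gcongr
            exact inv_le_one_of_one_le₀ hv
          linarith
      _ = ENNReal.ofReal (Real.log Real.pi + Real.log v + 2 * v⁻¹ * ‖c m p‖ ^ 2) +
            2 * ∫⁻ z, ENNReal.ofReal (‖z‖ ^ 2) ∂complexGaussian := by
          rw [lintegral_add_left measurable_const, lintegral_const_mul _ (by fun_prop)]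
          simp
      _ ≤ ENNReal.ofReal (Real.log Real.pi + Real.log v + 2 * v⁻¹ * ‖c m p‖ ^ 2) + 2 * 4 := by
          gcongr
          exact lintegral_norm_sq_complexGaussian
      _ = _ := by
          rw [show (2 * 4 : ℝ≥0∞) = ENNReal.ofReal 8 by norm_num,
            ← ENNReal.ofReal_add (by positivity) (by positivity),
            ← ENNReal.ofReal_add (by positivity) (by positivity)]
          congr 1
          ring
  rw [lintegral_outLaw c (by fun_prop)]
  calc _ ≤ (Fintype.card W : ℝ≥0∞)⁻¹ * ∑ m,
        (ENNReal.ofReal (Real.log Real.pi + Real.log v + 8) +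
          ENNReal.ofReal (2 * v⁻¹ * ‖c m p‖ ^ 2)) := by
        gcongr with m
        exact hpt m
    _ = _ := by
        rw [Finset.sum_add_distrib, mul_add, Finset.sum_const, Finset.card_univ, nsmul_eq_mul,
          ← mul_assoc, card_inv_mul_card, one_mul]

/-- The entropy of outputs of power at most `P`. -/
lemma meanEnt_le [∀ i, IsProbabilityMeasure (μ i)] [Nonempty W]
    (hint : ∀ i, Integrable (fun h => Real.log (1 + ‖h‖)) (μ i))
    {e : W → Chan n → Fin n → Fin 3 → ℂ} (he : ∀ m, Measurable (e m)) {P : ℝ} (hP0 : 0 ≤ P)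
    (hP : ∀ t j, (Fintype.card W : ℝ≥0∞)⁻¹ * ∑ m, ∫⁻ H, ‖e m H t j‖ₑ ^ 2 ∂channelLaw μ n ≤
      ENNReal.ofReal P) (A : Finset (Fin n × Fin 3)) :
    meanEnt μ e A ≤ A.card * ENNReal.ofReal (Real.log (1 + P) +
      (Real.log Real.pi + 26 + 2 * ∑ i, ∫ h, Real.log (1 + ‖h‖) ∂μ i)) := by
  have hlog0 : ∀ h : Fin 3 → ℂ, 0 ≤ Real.log (1 + ‖h‖) := fun h =>
    Real.log_nonneg (by linarith [norm_nonneg h])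
  have hπ : 0 ≤ Real.log Real.pi := Real.log_nonneg (by linarith [Real.pi_gt_three])
  have hlP : 0 ≤ Real.log (1 + P) := Real.log_nonneg (by linarith)
  set L := ∑ i, ∫ h, Real.log (1 + ‖h‖) ∂μ i with hL
  have hLi : ∀ i, ∫ h, Real.log (1 + ‖h‖) ∂μ i ≤ L := fun i =>
    Finset.single_le_sum (f := fun i => ∫ h, Real.log (1 + ‖h‖) ∂μ i)
      (fun i _ => integral_nonneg fun h => hlog0 h) (Finset.mem_univ i)
  have hL0 : 0 ≤ L := Finset.sum_nonneg fun i _ => integral_nonneg fun h => hlog0 h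
  let D : ℝ := Real.log Real.pi + Real.log (1 + P) + 8
  have hD : 0 ≤ D := by positivity
  let κ : ℝ≥0∞ := ENNReal.ofReal (6 * (1 + P)⁻¹)
  have hpt : ∀ H : Chan n, ent (codebook e H) A ≤ ∑ p ∈ A, (ENNReal.ofReal D +
      2 * ENNReal.ofReal (Real.log (1 + ‖H p.1 p.2‖)) +
      κ * ∑ j, (Fintype.card W : ℝ≥0∞)⁻¹ * ∑ m, ‖e m H p.1 j‖ₑ ^ 2) := by
    intro H
    -- The comparison variance is adapted to the realized channel. Its logarithm brings in only `log
    -- (1 + ‖H‖)`, and in the quadratic term the channel norm cancels, so no independence of input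
    -- and channel is needed.
    have hv : ∀ p : Fin n × Fin 3, 1 ≤ (1 + P) * (1 + ‖H p.1 p.2‖) ^ 2 := fun p =>
      one_le_mul_of_one_le_of_one_le (by linarith)
        (one_le_pow₀ (by linarith [norm_nonneg (H p.1 p.2)]))
    refine (ent_le _ A (fun p => (1 + P) * (1 + ‖H p.1 p.2‖) ^ 2) hv).trans
      (Finset.sum_le_sum fun p _ => (lintegral_neg_log_gauss_le _ p (hv p)).trans ?_)
    have hH1 : 0 < 1 + ‖H p.1 p.2‖ := by linarith [norm_nonneg (H p.1 p.2)]
    refine add_le_add ?_ ?_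
    · rw [show (2 : ℝ≥0∞) = ENNReal.ofReal 2 by simp, ← ENNReal.ofReal_mul zero_le_two,
        ← ENNReal.ofReal_add hD (mul_nonneg zero_le_two (hlog0 _)),
        Real.log_mul (by positivity) (by positivity), Real.log_pow]
      refine ENNReal.ofReal_le_ofReal (le_of_eq ?_)
      simp only [D]
      push_cast
      ring
    · rw [← Finset.mul_sum, Finset.sum_comm, mul_left_comm]
      gcongr
      rw [Finset.mul_sum]
      refine Finset.sum_le_sum fun m _ => ?_
      simp only [κ, ← ofReal_norm, ← ENNReal.ofReal_pow (norm_nonneg _)]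
      rw [← ENNReal.ofReal_sum_of_nonneg fun _ _ => by positivity,
        ← ENNReal.ofReal_mul (by positivity)]
      refine ENNReal.ofReal_le_ofReal ?_
      have h1 := norm_sq_dotProduct_le (H p.1 p.2) (e m H p.1)
      have h2 : ‖H p.1 p.2‖ ^ 2 ≤ (1 + ‖H p.1 p.2‖) ^ 2 := by gcongr; linarith
      set S := ∑ j, ‖e m H p.1 j‖ ^ 2
      have hS : 0 ≤ S := Finset.sum_nonneg fun _ _ => by positivity
      calc 2 * ((1 + P) * (1 + ‖H p.1 p.2‖) ^ 2)⁻¹ * ‖codebook e H m p‖ ^ 2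
          ≤ 2 * ((1 + P) * (1 + ‖H p.1 p.2‖) ^ 2)⁻¹ * (3 * (1 + ‖H p.1 p.2‖) ^ 2 * S) := by
            gcongr
            exact h1.trans (by gcongr)
        _ = 6 * (1 + P)⁻¹ * S := by
            field_simp
            ring
  have hlogm : ∀ p : Fin n × Fin 3,
      ∫⁻ H, ENNReal.ofReal (Real.log (1 + ‖H p.1 p.2‖)) ∂channelLaw μ n ≤ ENNReal.ofReal L := by
    intro p
    have h1 := (measurePreserving_eval μ p.2).comp
      (measurePreserving_eval (fun _ : Fin n => Measure.pi μ) p.1)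
    have h2 := h1.lintegral_comp (f := fun h => ENNReal.ofReal (Real.log (1 + ‖h‖))) (by fun_prop)
    refine (le_of_eq h2).trans ?_
    rw [← ofReal_integral_eq_lintegral_ofReal (hint _) (ae_of_all _ hlog0)]
    exact ENNReal.ofReal_le_ofReal (hLi _)
  have hmeas : ∀ m t j, Measurable fun H => ‖e m H t j‖ₑ ^ 2 := fun m t j => by
    have := he m
    fun_prop
  calc meanEnt μ e A ≤ ∫⁻ H, ∑ p ∈ A, (ENNReal.ofReal D +
      2 * ENNReal.ofReal (Real.log (1 + ‖H p.1 p.2‖)) +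
      κ * ∑ j, (Fintype.card W : ℝ≥0∞)⁻¹ * ∑ m, ‖e m H p.1 j‖ₑ ^ 2) ∂channelLaw μ n :=
        lintegral_mono hpt
    _ = ∑ p ∈ A, (ENNReal.ofReal D +
          2 * ∫⁻ H, ENNReal.ofReal (Real.log (1 + ‖H p.1 p.2‖)) ∂channelLaw μ n +
          κ * ∑ j, (Fintype.card W : ℝ≥0∞)⁻¹ * ∑ m, ∫⁻ H, ‖e m H p.1 j‖ₑ ^ 2 ∂channelLaw μ n) := by
        have hm1 : ∀ (t : Fin n) (j : Fin 3), Measurable fun H =>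
            (Fintype.card W : ℝ≥0∞)⁻¹ * ∑ m, ‖e m H t j‖ₑ ^ 2 := fun t j =>
          (Finset.measurable_fun_sum _ fun m _ => hmeas m t j).const_mul _
        have hm2 : ∀ t : Fin n, Measurable fun H =>
            ∑ j, (Fintype.card W : ℝ≥0∞)⁻¹ * ∑ m, ‖e m H t j‖ₑ ^ 2 := fun t =>
          Finset.measurable_fun_sum _ fun j _ => hm1 t j
        rw [lintegral_finsetSum _ fun p _ => by
          exact Measurable.add (by fun_prop) ((hm2 p.1).const_mul _)]
        refine Finset.sum_congr rfl fun p _ => ?_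
        rw [lintegral_add_right _ ((hm2 p.1).const_mul _), lintegral_add_left measurable_const,
          lintegral_const_mul _ (by fun_prop), lintegral_const_mul _ (hm2 p.1),
          lintegral_finsetSum _ fun j _ => hm1 p.1 j]
        congr 2
        · simp
        · refine Finset.sum_congr rfl fun j _ => ?_
          rw [lintegral_const_mul _ (Finset.measurable_fun_sum _ fun m _ => hmeas m p.1 j),
            lintegral_finsetSum _ fun m _ => hmeas m p.1 j]
    _ ≤ ∑ p ∈ A, ENNReal.ofReal (Real.log (1 + P) + (Real.log Real.pi + 26 + 2 * L)) := by
        refine Finset.sum_le_sum fun p _ => ?_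
        calc _ ≤ ENNReal.ofReal D + 2 * ENNReal.ofReal L + κ * ∑ _j : Fin 3, ENNReal.ofReal P := by
              gcongr with j
              · exact hlogm p
              · exact hP p.1 j
          _ = ENNReal.ofReal (D + 2 * L + 6 * (1 + P)⁻¹ * (3 * P)) := by
              rw [show (2 : ℝ≥0∞) = ENNReal.ofReal 2 by simp, ← ENNReal.ofReal_mul zero_le_two,
                ← ENNReal.ofReal_add hD (by positivity), Finset.sum_const, Finset.card_univ,
                Fintype.card_fin, nsmul_eq_mul,
                show ((3 : ℕ) : ℝ≥0∞) = ENNReal.ofReal 3 by simp,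
                ← ENNReal.ofReal_mul (by norm_num), ← ENNReal.ofReal_mul (by positivity),
                ← ENNReal.ofReal_add (by positivity) (by positivity)]
          _ ≤ _ := by
              refine ENNReal.ofReal_le_ofReal ?_
              -- The three antennas contribute at most `18`; with the `8` from the noise this is the
              -- constant `26`.
              have : 6 * (1 + P)⁻¹ * (3 * P) ≤ 18 := by
                rw [show 6 * (1 + P)⁻¹ * (3 * P) = 18 * P / (1 + P) by ring,
                  div_le_iff₀ (by linarith)]
                linarith
              simp only [D]
              linarith
    _ = _ := by rw [Finset.sum_const, nsmul_eq_mul]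

/-- Fixing some messages can destroy the bound on the average power, but any finite bound gives
finite entropy; here the sum of all powers serves. -/
lemma meanEnt_ne_top [∀ i, IsProbabilityMeasure (μ i)] [Nonempty W]
    (hint : ∀ i, Integrable (fun h => Real.log (1 + ‖h‖)) (μ i))
    {e : W → Chan n → Fin n → Fin 3 → ℂ} (he : ∀ m, Measurable (e m))
    (hfin : ∀ m t j, ∫⁻ H, ‖e m H t j‖ₑ ^ 2 ∂channelLaw μ n ≠ ∞) (A : Finset (Fin n × Fin 3)) :
    meanEnt μ e A ≠ ∞ := by
  let S : Fin n → Fin 3 → ℝ≥0∞ := fun t j =>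
    (Fintype.card W : ℝ≥0∞)⁻¹ * ∑ m, ∫⁻ H, ‖e m H t j‖ₑ ^ 2 ∂channelLaw μ n
  have hS : ∀ t j, S t j ≠ ∞ := fun t j =>
    ENNReal.mul_ne_top (by simp) (ENNReal.sum_ne_top.2 fun m _ => hfin m t j)
  have hS2 : ∑ t, ∑ j, S t j ≠ ∞ :=
    ENNReal.sum_ne_top.2 fun t _ => ENNReal.sum_ne_top.2 fun j _ => hS t j
  refine ne_top_of_le_ne_top (ENNReal.mul_ne_top (by simp) ENNReal.ofReal_ne_top)
    (meanEnt_le hint he (P := (∑ t, ∑ j, S t j).toReal) ENNReal.toReal_nonneg (fun t j => ?_) A)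
  rw [ENNReal.ofReal_toReal hS2]
  exact (Finset.single_le_sum (f := fun j => S t j) (fun _ _ => zero_le) (Finset.mem_univ j)).trans
    (Finset.single_le_sum (f := fun t => ∑ j, S t j) (fun _ _ => zero_le) (Finset.mem_univ t))

end MeanEntropy

/-! ### Fano's inequality -/

section Fano

variable {κ : Type*} [Fintype κ] [DecidableEq κ] {β : κ → Type*} [∀ i, Fintype (β i)]

/-- Exchanging the entries outside `K` between `m₀` and `m` is an involution of pairs of message
tuples. In probabilistic terms, resampling the messages outside `K` keeps the tuple uniform. -/
lemma sum_piecewise (K : Finset κ) (G : (∀ i, β i) → ℝ≥0∞) :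
    ∑ m₀, ∑ m, G (K.piecewise m₀ m) = Fintype.card (∀ i, β i) * ∑ m, G m := by
  let σ : Equiv.Perm ((∀ i, β i) × ∀ i, β i) :=
    Function.Involutive.toPerm (fun x => (K.piecewise x.1 x.2, K.piecewise x.2 x.1)) fun x => by
      ext i <;> by_cases hi : i ∈ K <;> simp [hi]
  rw [← Fintype.sum_prod_type' (f := fun m₀ m => G (K.piecewise m₀ m))]
  calc ∑ x : (∀ i, β i) × ∀ i, β i, G (K.piecewise x.1 x.2) = ∑ x, G (σ x).1 := rfl
    _ = ∑ x : (∀ i, β i) × ∀ i, β i, G x.1 := Equiv.sum_comp σ fun x => G x.1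
    _ = _ := by
      rw [Fintype.sum_prod_type]
      simp [Finset.mul_sum]

lemma sum_update (i : κ) (G : (∀ i, β i) → ℝ≥0∞) :
    ∑ m, ∑ w, G (Function.update m i w) = Fintype.card (β i) * ∑ m, G m := by
  let σ : Equiv.Perm ((∀ i, β i) × β i) :=
    Function.Involutive.toPerm (fun x => (Function.update x.1 i x.2, x.1 i)) fun x => by simp
  rw [← Fintype.sum_prod_type' (f := fun m w => G (Function.update m i w))]
  calc ∑ x : (∀ i, β i) × β i, G (Function.update x.1 i x.2) = ∑ x, G (σ x).1 := rfl
    _ = ∑ x : (∀ i, β i) × β i, G x.1 := Equiv.sum_comp σ fun x => G x.1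
    _ = _ := by
      rw [Fintype.sum_prod_type]
      simp [Finset.mul_sum]

variable {ι : Type*} [Fintype ι]

/-- Expectation over uniformly distributed messages and the outputs. -/
noncomputable def mean (c : (∀ i, β i) → ι → ℂ) (Φ : (∀ i, β i) → (ι → ℂ) → ℝ≥0∞) : ℝ≥0∞ :=
  (Fintype.card (∀ i, β i) : ℝ≥0∞)⁻¹ *
    ∑ m, ∫⁻ z, Φ m (c m + z) ∂Measure.pi fun _ : ι => complexGaussian

lemma mean_mono {c : (∀ i, β i) → ι → ℂ} {Φ Ψ : (∀ i, β i) → (ι → ℂ) → ℝ≥0∞}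
    (h : ∀ m y, Φ m y ≤ Ψ m y) : mean c Φ ≤ mean c Ψ := by
  unfold mean
  gcongr
  exact h _ _

lemma mean_add {c : (∀ i, β i) → ι → ℂ} {Φ Ψ : (∀ i, β i) → (ι → ℂ) → ℝ≥0∞}
    (h : ∀ m, Measurable (Ψ m)) :
    mean c (fun m y => Φ m y + Ψ m y) = mean c Φ + mean c Ψ := by
  unfold mean
  rw [← mul_add, ← Finset.sum_add_distrib]
  congr 1
  refine Finset.sum_congr rfl fun m _ => ?_
  have := h m
  exact lintegral_add_right _ (by fun_prop)

lemma mean_const [Nonempty (∀ i, β i)] (c : (∀ i, β i) → ι → ℂ) (a : ℝ≥0∞) :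
    mean c (fun _ _ => a) = a := by
  simp [mean, ← mul_assoc, card_inv_mul_card, -Fintype.card_pi]

/-- Conditioning on the messages in `K`. -/
lemma mean_eq_outLaw [Nonempty (∀ i, β i)] (c : (∀ i, β i) → ι → ℂ) (K : Finset κ)
    {Φ : (∀ i, β i) → (ι → ℂ) → ℝ≥0∞} (hΦ : ∀ m, Measurable (Φ m))
    (hK : ∀ m m', Φ (K.piecewise m m') = Φ m) :
    mean c Φ = (Fintype.card (∀ i, β i) : ℝ≥0∞)⁻¹ *
      ∑ m₀, ∫⁻ y, Φ m₀ y ∂outLaw fun m => c (K.piecewise m₀ m) := by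
  have h := sum_piecewise K fun m => ∫⁻ z, Φ m (c m + z) ∂Measure.pi fun _ : ι => complexGaussian
  simp only [hK] at h
  simp only [fun m₀ => lintegral_outLaw (fun m => c (K.piecewise m₀ m)) (hΦ m₀)]
  rw [← Finset.mul_sum, h, ← mul_assoc _ _ (Finset.sum _ _), card_inv_mul_card, one_mul]
  rfl

/-- The density of the outputs in `A` given the messages in `K`. -/
noncomputable def condDens (c : (∀ i, β i) → ι → ℂ) (K : Finset κ) (A : Finset ι) (m : ∀ i, β i) :
    (ι → ℂ) → ℝ := dens (fun m' => c (K.piecewise m m')) A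

omit [Fintype ι] in
lemma condDens_congr (c : (∀ i, β i) → ι → ℂ) (K : Finset κ) (A : Finset ι) {m m' : ∀ i, β i}
    (h : ∀ i ∈ K, m i = m' i) : condDens c K A m = condDens c K A m' := by
  have : ∀ x : ∀ i, β i, K.piecewise m x = K.piecewise m' x := fun x => by
    ext i
    by_cases hi : i ∈ K <;> simp [hi, h]
  simp only [condDens, this]

/-- The entropy of the outputs in `A` given the messages in `K`. -/
noncomputable def condEnt (c : (∀ i, β i) → ι → ℂ) (K : Finset κ) (A : Finset ι) : ℝ≥0∞ :=
  mean c fun m y => ENNReal.ofReal (-Real.log (condDens c K A m y))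

lemma condEnt_eq [Nonempty (∀ i, β i)] (c : (∀ i, β i) → ι → ℂ) (K : Finset κ) (A : Finset ι) :
    condEnt c K A = (Fintype.card (∀ i, β i) : ℝ≥0∞)⁻¹ *
      ∑ m₀, ent (fun m => c (K.piecewise m₀ m)) A :=
  mean_eq_outLaw c K (fun m => by unfold condDens; fun_prop) fun m m' => by
    rw [condDens_congr c K A (m := K.piecewise m m') (m' := m) fun i hi => by simp [hi]]

/-- A receiver that sees the outputs in `A` and the messages in `K` decodes message `i`. -/
lemma condEnt_insert_add_log_card_le [DecidableEq ι] [Nonempty (∀ i, β i)]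
    [∀ i, DecidableEq (β i)] (c : (∀ i, β i) → ι → ℂ)
    {K : Finset κ} {i : κ} (hi : i ∉ K) {A : Finset ι} {dec : (ι → ℂ) → β i}
    (hdec : ∀ w, MeasurableSet {y | dec y = w}) (hA : DependsOn dec A) :
    condEnt c (insert i K) A + ENNReal.ofReal (Real.log (Fintype.card (β i))) ≤
      condEnt c K A + (ENNReal.ofReal (Real.log 2) + ENNReal.ofReal (Real.log (Fintype.card (β i))) *
        ((Fintype.card (∀ i, β i) : ℝ≥0∞)⁻¹ *
          ∑ m, (Measure.pi fun _ : ι => complexGaussian) {z | dec (c m + z) ≠ m i})) := by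
  classical
  have hβ : Nonempty (β i) := ⟨Classical.arbitrary (∀ i, β i) i⟩
  set M : ℝ := (Fintype.card (β i) : ℝ) with hM
  have hM1 : 1 ≤ M := by
    rw [hM]
    exact_mod_cast Fintype.card_pos (α := β i)
  have hM0 : 0 < M := one_pos.trans_le hM1
  have hlM : 0 ≤ Real.log M := Real.log_nonneg hM1
  -- A guess for the law of message `i` given the outputs: half the mass on the decoded message,
  -- half spread uniformly. Its negative logarithm is at most `log 2` if decoding is correct and
  -- equals `log 2 + log M` otherwise, which gives Fano's inequality directly.
  let q : β i → (ι → ℂ) → ℝ := fun w y => (if dec y = w then 1 / 2 else 0) + 1 / (2 * M)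
  have hqm : ∀ w, Measurable (q w) := fun w =>
    (Measurable.ite (hdec w) measurable_const measurable_const).add_const _
  have hq0 : ∀ w y, 0 < q w y := fun w y => by
    simp only [q]; split_ifs <;> positivity
  have hqs : ∀ y, ∑ w, q w y = 1 := fun y => by
    simp only [q, Finset.sum_add_distrib, Finset.sum_ite_eq, Finset.mem_univ, if_true,
      Finset.sum_const, Finset.card_univ, nsmul_eq_mul, ← hM]
    field_simp
    norm_num
  let f₀ := condDens c K A
  let f₁ := condDens c (insert i K) A
  have hf0 : ∀ m y, 0 < f₀ m y := fun m y => dens_pos _ _ _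
  have hf1 : ∀ m y, 0 < f₁ m y := fun m y => dens_pos _ _ _
  have hm0 : ∀ m, Measurable (f₀ m) := fun m => measurable_dens _ _
  have hm1 : ∀ m, Measurable (f₁ m) := fun m => measurable_dens _ _
  -- The ratio of the guessed to the true joint density of message `i` and outputs, given the
  -- messages in `K`; the factor `M` comes from the uniform law of message `i`.
  let r : (∀ i, β i) → (ι → ℂ) → ℝ≥0∞ := fun m y =>
    ENNReal.ofReal (M * (f₀ m y * q (m i) y) / f₁ m y)
  have hr : ∀ m, Measurable (r m) := fun m => by
    have := hm0 m; have := hm1 m; have := hqm (m i)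
    fun_prop
  have hfun : ∀ m, (fun x => ENNReal.ofReal (f₁ m x) * r m x) =
      fun x => ENNReal.ofReal M * ENNReal.ofReal (q (m i) x) * ENNReal.ofReal (f₀ m x) := by
    intro m
    funext x
    have h1 := hf1 m x
    have h0 := hf0 m x
    have hq := hq0 (m i) x
    simp only [r]
    rw [← ENNReal.ofReal_mul h1.le, ← ENNReal.ofReal_mul hM0.le,
      ← ENNReal.ofReal_mul (by positivity)]
    congr 1
    field_simp
  have hrdep : ∀ m, DependsOn (r m) A := by
    intro m x y h
    simp only [r, q, f₀, f₁, condDens]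
    rw [dependsOn_dens _ A h, dependsOn_dens _ A h, hA h]
  have hr1 : mean c r ≤ 1 := by
    rw [mean_eq_outLaw c (insert i K) hr fun m m' => by
      funext y
      simp only [r, f₀, f₁]
      rw [condDens_congr c K A (m := (insert i K).piecewise m m') (m' := m) fun j hj => by simp [hj],
        condDens_congr c (insert i K) A (m := (insert i K).piecewise m m') (m' := m)
          fun j hj => Finset.piecewise_eq_of_mem _ _ _ hj]
      simp]
    have e1 : ∀ m₀, ∫⁻ y, r m₀ y ∂outLaw (fun m => c ((insert i K).piecewise m₀ m)) =
        ∫⁻ z : A → ℂ, ENNReal.ofReal M * ENNReal.ofReal (q (m₀ i) (Function.updateFinset 0 A z)) *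
          ENNReal.ofReal (f₀ m₀ (Function.updateFinset 0 A z)) ∂Measure.pi fun _ => volume := by
      intro m₀
      rw [lintegral_outLaw_eq_lmarginal _ (hr m₀) (hrdep m₀) 0]
      have := hfun m₀
      simp only [f₁, condDens] at this
      rw [this]
      rfl
    have hmq : ∀ m : ∀ i, β i, Measurable fun z : A → ℂ => ENNReal.ofReal M *
        ENNReal.ofReal (q (m i) (Function.updateFinset 0 A z)) *
          ENNReal.ofReal (f₀ m (Function.updateFinset 0 A z)) := fun m =>
      (((hqm (m i)).comp measurable_updateFinset).ennreal_ofReal.const_mul _).mul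
        ((hm0 m).comp measurable_updateFinset).ennreal_ofReal
    have hmf : ∀ m : ∀ i, β i, Measurable fun z : A → ℂ =>
        ENNReal.ofReal (f₀ m (Function.updateFinset 0 A z)) := fun m =>
      ((hm0 m).comp measurable_updateFinset).ennreal_ofReal
    -- Averaging over message `i` alone: `f₀` does not depend on it because `i ∉ K`, and the guesses
    -- `q` sum to `1`.
    have e2 : ∀ y, ∑ m : ∀ i, β i, ENNReal.ofReal M * ENNReal.ofReal (q (m i) y) *
        ENNReal.ofReal (f₀ m y) = ∑ m, ENNReal.ofReal (f₀ m y) := by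
      intro y
      have h1 := sum_update i fun m : ∀ i, β i =>
        ENNReal.ofReal (q (m i) y) * ENNReal.ofReal (f₀ m y)
      have h2 : ∀ (m : ∀ i, β i) w, f₀ (Function.update m i w) = f₀ m := fun m w =>
        condDens_congr c K A fun j hj => Function.update_of_ne (ne_of_mem_of_not_mem hj hi) _ _
      simp only [Function.update_self, h2, ← Finset.sum_mul] at h1
      rw [← ENNReal.ofReal_sum_of_nonneg fun w _ => (hq0 w y).le, hqs, ENNReal.ofReal_one] at h1
      simp only [one_mul] at h1
      rw [h1, Finset.mul_sum, hM, ENNReal.ofReal_natCast]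
      exact Finset.sum_congr rfl fun m _ => by rw [mul_assoc]
    have e3 : ∀ m, ∫⁻ z : A → ℂ, ENNReal.ofReal (f₀ m (Function.updateFinset 0 A z))
        ∂Measure.pi (fun _ => volume) = 1 := fun m => lmarginal_dens _ A 0
    simp only [e1]
    rw [← lintegral_finsetSum _ fun m _ => hmq m]
    simp only [e2]
    rw [lintegral_finsetSum _ fun m _ => hmf m]
    simp [e3, card_inv_mul_card, -Fintype.card_pi]
  let F : (∀ i, β i) → (ι → ℂ) → ℝ≥0∞ := fun m y =>
    ENNReal.ofReal (-Real.log (f₁ m y)) + ENNReal.ofReal (Real.log M)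
  let G : (∀ i, β i) → (ι → ℂ) → ℝ≥0∞ := fun m y => ENNReal.ofReal (-Real.log (f₀ m y)) +
    (ENNReal.ofReal (Real.log 2) + ENNReal.ofReal (Real.log M) * (if dec y ≠ m i then 1 else 0))
  have hpt : ∀ m y, F m y + 1 ≤ G m y + r m y := by
    intro m y
    have hl1 : 0 ≤ -Real.log (f₁ m y) :=
      neg_nonneg.2 (Real.log_nonpos (hf1 m y).le (dens_le_one _ _ _))
    have hl0 : 0 ≤ -Real.log (f₀ m y) :=
      neg_nonneg.2 (Real.log_nonpos (hf0 m y).le (dens_le_one _ _ _))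
    have h2 : 0 ≤ Real.log 2 := Real.log_nonneg one_le_two
    have hp := neg_log_add_one_le (hf1 m y) (mul_pos hM0 (mul_pos (hf0 m y) (hq0 (m i) y)))
    rw [Real.log_mul hM0.ne' (mul_pos (hf0 m y) (hq0 (m i) y)).ne',
      Real.log_mul (hf0 m y).ne' (hq0 (m i) y).ne'] at hp
    have hlq : -Real.log (q (m i) y) ≤ Real.log 2 + Real.log M * (if dec y ≠ m i then 1 else 0) := by
      by_cases hd : dec y = m i
      · have : (2 : ℝ)⁻¹ ≤ q (m i) y := by
          have : 0 < 1 / (2 * M) := by positivity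
          simp only [q, hd, if_true]; linarith
        have := Real.log_le_log (by norm_num) this
        rw [Real.log_inv] at this
        simp [hd]; linarith
      · simp only [q, hd, if_false, ne_eq, not_false_eq_true, if_true, zero_add, one_div,
          Real.log_inv, neg_neg, mul_one]
        rw [Real.log_mul two_ne_zero hM0.ne']
    have hite : (if dec y ≠ m i then 1 else 0 : ℝ≥0∞) =
        ENNReal.ofReal (if dec y ≠ m i then 1 else 0) := by split_ifs <;> simp
    have hin : (0 : ℝ) ≤ if dec y ≠ m i then 1 else 0 := by split_ifs <;> simp
    have hrn : 0 ≤ M * (f₀ m y * q (m i) y) / f₁ m y := by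
      have := hf0 m y; have := hf1 m y; have := hq0 (m i) y
      positivity
    simp only [F, G, r]
    rw [hite, ← ENNReal.ofReal_mul hlM, ← ENNReal.ofReal_add h2 (mul_nonneg hlM hin),
      ← ENNReal.ofReal_add hl1 hlM, ← ENNReal.ofReal_one,
      ← ENNReal.ofReal_add (add_nonneg hl1 hlM) zero_le_one,
      ← ENNReal.ofReal_add hl0 (add_nonneg h2 (mul_nonneg hlM hin)),
      ← ENNReal.ofReal_add (add_nonneg hl0 (add_nonneg h2 (mul_nonneg hlM hin))) hrn]
    exact ENNReal.ofReal_le_ofReal (by linarith)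
  have hFG : mean c F ≤ mean c G := by
    have : mean c F + 1 ≤ mean c G + 1 :=
      calc mean c F + 1 = mean c fun m y => F m y + 1 := by
            rw [mean_add (Φ := F) (Ψ := fun _ _ => 1) fun _ => measurable_const, mean_const]
        _ ≤ mean c fun m y => G m y + r m y := mean_mono hpt
        _ = mean c G + mean c r := mean_add hr
        _ ≤ _ := by gcongr
    exact (ENNReal.add_le_add_iff_right ENNReal.one_ne_top).1 this
  have hset : ∀ m : ∀ i, β i, MeasurableSet {y | dec y ≠ m i} := fun m => (hdec (m i)).compl
  have hind : ∀ m : ∀ i, β i, Measurable fun y => (if dec y ≠ m i then 1 else 0 : ℝ≥0∞) := fun m =>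
    Measurable.ite (hset m) measurable_const measurable_const
  have hF : mean c F = condEnt c (insert i K) A + ENNReal.ofReal (Real.log M) := by
    simp only [F]
    rw [mean_add fun _ => measurable_const, mean_const]
    rfl
  have hG : mean c G = condEnt c K A + (ENNReal.ofReal (Real.log 2) + ENNReal.ofReal (Real.log M) *
      ((Fintype.card (∀ i, β i) : ℝ≥0∞)⁻¹ *
          ∑ m, (Measure.pi fun _ : ι => complexGaussian) {z | dec (c m + z) ≠ m i})) := by
    simp only [G]
    rw [mean_add fun m => ((hind m).const_mul _).const_add _, mean_add fun m => (hind m).const_mul _,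
      mean_const]
    congr 2
    unfold mean
    conv_rhs => rw [mul_left_comm, Finset.mul_sum]
    congr 1
    refine Finset.sum_congr rfl fun m _ => ?_
    have hs : MeasurableSet {z : ι → ℂ | dec (c m + z) ≠ m i} :=
      (by fun_prop : Measurable fun z : ι → ℂ => c m + z) (hset m)
    rw [← lintegral_indicator_one hs, ← lintegral_const_mul _ (measurable_one.indicator hs)]
    refine lintegral_congr fun z => ?_
    simp [Set.indicator_apply]
  rwa [hF, hG] at hFG

end Fano

/-! ### The converse -/

section Converse

variable {n : ℕ} {μ : Fin 3 → Measure (Fin 3 → ℂ)} {I : Set (Fin 3)}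

lemma Code.M_pos (c : Code I n) (i : Fin 3) : 0 < c.M i :=
  (Nat.zero_le _).trans_lt (c.dec i (0, 0)).isLt

lemma Code.nonempty_messages (c : Code I n) : Nonempty (∀ i, Fin (c.M i)) :=
  ⟨fun i => ⟨0, c.M_pos i⟩⟩

/-- The entropy of the outputs in `A` given the channels and the messages of the receivers
in `K`. -/
noncomputable def Code.condEnt (c : Code I n) (μ : Fin 3 → Measure (Fin 3 → ℂ))
    (K : Finset (Fin 3)) (A : Finset (Fin n × Fin 3)) : ℝ≥0∞ :=
  ∫⁻ H, MISO.condEnt (codebook c.enc H) K A ∂channelLaw μ n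

lemma Code.condEnt_eq (c : Code I n) (K : Finset (Fin 3)) (A : Finset (Fin n × Fin 3)) :
    c.condEnt μ K A = (Fintype.card (∀ i, Fin (c.M i)) : ℝ≥0∞)⁻¹ *
      ∑ m₀, meanEnt μ (fun m => c.enc (K.piecewise m₀ m)) A := by
  have := c.nonempty_messages
  have hm : ∀ m₀, Measurable fun H => ent (codebook (fun m => c.enc (K.piecewise m₀ m)) H) A :=
    fun m₀ => measurable_ent (fun m => c.enc_measurable _) A
  unfold Code.condEnt meanEnt
  rw [← lintegral_finsetSum _ fun m₀ _ => hm m₀,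
    ← lintegral_const_mul _ (Finset.measurable_fun_sum _ fun m₀ _ => hm m₀)]
  exact lintegral_congr fun H => MISO.condEnt_eq _ K A

lemma Code.condEnt_empty (c : Code I n) (A : Finset (Fin n × Fin 3)) :
    c.condEnt μ ∅ A = meanEnt μ c.enc A := by
  have := c.nonempty_messages
  rw [c.condEnt_eq]
  simp [← mul_assoc, card_inv_mul_card, -Fintype.card_pi]

lemma Code.lintegral_enc_ne_top {c : Code I n} {P : ℝ} (hP : c.PowerLE μ P)
    (m : ∀ i, Fin (c.M i)) (t : Fin n) (j : Fin 3) :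
    ∫⁻ H, ‖c.enc m H t j‖ₑ ^ 2 ∂channelLaw μ n ≠ ∞ := by
  have h1 := ne_top_of_le_ne_top ENNReal.ofReal_ne_top (hP t j)
  rw [← card_messages] at h1
  have h2 : ∑ m, ∫⁻ H, ‖c.enc m H t j‖ₑ ^ 2 ∂channelLaw μ n ≠ ∞ := fun h => by
    rw [h, ENNReal.top_div_of_ne_top (ENNReal.natCast_ne_top _)] at h1
    exact h1 rfl
  exact ENNReal.sum_ne_top.1 h2 m (Finset.mem_univ m)

variable [∀ i, IsProbabilityMeasure (μ i)]

lemma Code.meanEnt_piecewise_ne_top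
    (hint : ∀ i, Integrable (fun h => Real.log (1 + ‖h‖)) (μ i)) {c : Code I n} {P : ℝ}
    (hP : c.PowerLE μ P) (K : Finset (Fin 3)) (m₀ : ∀ i, Fin (c.M i))
    (A : Finset (Fin n × Fin 3)) :
    meanEnt μ (fun m => c.enc (K.piecewise m₀ m)) A ≠ ∞ :=
  have := c.nonempty_messages
  meanEnt_ne_top hint (fun _ => c.enc_measurable _) (fun _ => c.lintegral_enc_ne_top hP _) A

lemma Code.condEnt_ne_top (hint : ∀ i, Integrable (fun h => Real.log (1 + ‖h‖)) (μ i))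
    {c : Code I n} {P : ℝ} (hP : c.PowerLE μ P) (K : Finset (Fin 3))
    (A : Finset (Fin n × Fin 3)) : c.condEnt μ K A ≠ ∞ := by
  have := c.nonempty_messages
  rw [c.condEnt_eq]
  exact ENNReal.mul_ne_top (by simp [Finset.prod_eq_zero_iff, (c.M_pos _).ne'])
    (ENNReal.sum_ne_top.2 fun m₀ _ => meanEnt_piecewise_ne_top hint hP K m₀ A)

lemma Code.toReal_condEnt (hint : ∀ i, Integrable (fun h => Real.log (1 + ‖h‖)) (μ i))
    {c : Code I n} {P : ℝ} (hP : c.PowerLE μ P) (K : Finset (Fin 3))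
    (A : Finset (Fin n × Fin 3)) :
    (c.condEnt μ K A).toReal = (Fintype.card (∀ i, Fin (c.M i)) : ℝ)⁻¹ *
      ∑ m₀, (meanEnt μ (fun m => c.enc (K.piecewise m₀ m)) A).toReal := by
  rw [c.condEnt_eq, ENNReal.toReal_mul,
    ENNReal.toReal_sum fun m₀ _ => meanEnt_piecewise_ne_top hint hP K m₀ A]
  simp

lemma Code.isSymmSubmodular (hμ : ∀ i j, μ i = μ j)
    (hint : ∀ i, Integrable (fun h => Real.log (1 + ‖h‖)) (μ i)) {c : Code ∅ n} {P : ℝ}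
    (hP : c.PowerLE μ P) (K : Finset (Fin 3)) (m₀ : ∀ i, Fin (c.M i)) :
    IsSymmSubmodular fun A => (meanEnt μ (fun m => c.enc (K.piecewise m₀ m)) A).toReal :=
  have := c.nonempty_messages
  isSymmSubmodular_meanEnt hμ (fun _ => c.enc_measurable _) (fun _ => c.enc_causal _)
    fun A => meanEnt_piecewise_ne_top hint hP K m₀ A

lemma Code.condEnt_rows_two_le (hμ : ∀ i j, μ i = μ j)
    (hint : ∀ i, Integrable (fun h => Real.log (1 + ‖h‖)) (μ i)) {c : Code ∅ n} {P : ℝ}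
    (hP : c.PowerLE μ P) (K : Finset (Fin 3)) {i j : Fin 3} (hij : i ≠ j) :
    (c.condEnt μ K (rows n n {i, j})).toReal ≤ 2 * (c.condEnt μ K (rows n n {i})).toReal := by
  rw [toReal_condEnt hint hP, toReal_condEnt hint hP, mul_left_comm (2 : ℝ),
    Finset.mul_sum _ _ (2 : ℝ)]
  refine mul_le_mul_of_nonneg_left (Finset.sum_le_sum fun m₀ _ => ?_) (by positivity)
  exact (isSymmSubmodular hμ hint hP K m₀).rows_two_le hij n le_rfl

lemma Code.condEnt_rows_three_le (hμ : ∀ i j, μ i = μ j)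
    (hint : ∀ i, Integrable (fun h => Real.log (1 + ‖h‖)) (μ i)) {c : Code ∅ n} {P : ℝ}
    (hP : c.PowerLE μ P) (K : Finset (Fin 3)) {i j k : Fin 3} (hij : i ≠ j) (hik : i ≠ k)
    (hjk : j ≠ k) :
    2 * (c.condEnt μ K (rows n n {i, j, k})).toReal ≤
      3 * (c.condEnt μ K (rows n n {i, j})).toReal := by
  rw [toReal_condEnt hint hP, toReal_condEnt hint hP, mul_left_comm (2 : ℝ),
    mul_left_comm (3 : ℝ), Finset.mul_sum _ _ (2 : ℝ), Finset.mul_sum _ _ (3 : ℝ)]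
  refine mul_le_mul_of_nonneg_left (Finset.sum_le_sum fun m₀ _ => ?_) (by positivity)
  exact (isSymmSubmodular hμ hint hP K m₀).rows_three_le hij hik hjk n le_rfl

omit [∀ i, IsProbabilityMeasure (μ i)] in
-- The entropies use one noise vector for all receivers, the error probability only that of receiver
-- `i`. Decoding sees just the coordinates `(t, i)`, whose marginal is `noiseLaw`, so the two
-- descriptions agree.
lemma Code.lintegral_error (c : Code I n) (i : Fin 3) :
    ∫⁻ H, ((Fintype.card (∀ i, Fin (c.M i)) : ℝ≥0∞)⁻¹ *
      ∑ m, (Measure.pi fun _ : Fin n × Fin 3 => complexGaussian)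
        {z | c.dec i (H, fun t => (codebook c.enc H m + z) (t, i)) ≠ m i}) ∂channelLaw μ n =
      c.errProb μ i := by
  have hs : ∀ m : ∀ i, Fin (c.M i), MeasurableSet
      {ω : Chan n × (Fin n → ℂ) | c.dec i (ω.1, output ω.1 i (c.enc m ω.1) ω.2) ≠ m i} := by
    intro m
    have hm : Measurable fun ω : Chan n × (Fin n → ℂ) =>
        c.dec i (ω.1, output ω.1 i (c.enc m ω.1) ω.2) := by
      refine (c.dec_measurable i).comp (measurable_fst.prodMk (measurable_pi_lambda _ fun t => ?_))
      exact ((measurable_codebook c.enc_measurable m (t, i)).comp measurable_fst).add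
        ((measurable_pi_apply t).comp measurable_snd)
    exact (hm (measurableSet_singleton (m i))).compl
  have hpre : ∀ m H, (Measure.pi fun _ : Fin n × Fin 3 => complexGaussian)
      {z | c.dec i (H, fun t => (codebook c.enc H m + z) (t, i)) ≠ m i} =
      noiseLaw n (Prod.mk H ⁻¹'
        {ω : Chan n × (Fin n → ℂ) | c.dec i (ω.1, output ω.1 i (c.enc m ω.1) ω.2) ≠ m i}) := by
    intro m H
    have hinj : Function.Injective fun t : Fin n => (t, i) := fun s t h => (Prod.ext_iff.1 h).1
    exact (pi_map_comp_injective complexGaussian hinj).measure_preimage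
      (measurable_prodMk_left (hs m)).nullMeasurableSet
  simp only [hpre]
  have hmeas : ∀ m : ∀ i, Fin (c.M i), Measurable fun H : Chan n => noiseLaw n (Prod.mk H ⁻¹'
        {ω : Chan n × (Fin n → ℂ) | c.dec i (ω.1, output ω.1 i (c.enc m ω.1) ω.2) ≠ m i}) :=
    fun m => measurable_measure_prodMk_left (hs m)
  rw [lintegral_const_mul _ (Finset.measurable_fun_sum _ fun m _ => hmeas m),
    lintegral_finsetSum _ fun m _ => hmeas m, Code.errProb, ENNReal.div_eq_inv_mul, card_messages]
  congr 1
  exact Finset.sum_congr rfl fun m _ => (Measure.prod_apply (hs m)).symm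

lemma Code.errProb_ne_top (c : Code I n) (i : Fin 3) : c.errProb μ i ≠ ∞ :=
  ENNReal.div_ne_top (ENNReal.sum_ne_top.2 fun _ _ => measure_ne_top _ _)
    (Finset.prod_ne_zero_iff.2 fun i _ => by simpa using (c.M_pos i).ne')

lemma Code.condEnt_insert_add_log_le (c : Code I n) {K : Finset (Fin 3)} {i : Fin 3} (hi : i ∉ K)
    {S : Finset (Fin 3)} (hS : i ∈ S) :
    c.condEnt μ (insert i K) (rows n n S) + ENNReal.ofReal (Real.log (c.M i)) ≤
      c.condEnt μ K (rows n n S) + (ENNReal.ofReal (Real.log 2) +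
        ENNReal.ofReal (Real.log (c.M i)) * c.errProb μ i) := by
  have := c.nonempty_messages
  have hmc : ∀ K, Measurable fun H => MISO.condEnt (codebook c.enc H) K (rows n n S) := fun K => by
    simp only [MISO.condEnt_eq]
    exact (Finset.measurable_fun_sum _ fun m₀ _ => measurable_ent
      (e := fun m => c.enc (K.piecewise m₀ m)) (fun m => c.enc_measurable _) _).const_mul _
  have key : ∀ H : Chan n, _ := fun H => condEnt_insert_add_log_card_le (codebook c.enc H) hi
    (A := rows n n S) (dec := fun y => c.dec i (H, fun t => y (t, i)))
    (fun w => by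
      have : Measurable fun y : Fin n × Fin 3 → ℂ => c.dec i (H, fun t => y (t, i)) :=
        (c.dec_measurable i).comp (by fun_prop)
      exact this (measurableSet_singleton w))
    (fun x y h => by
      have : (fun t => x (t, i)) = fun t => y (t, i) := funext fun t => h _ (by simp [hS])
      simp only [this])
  simp only [Fintype.card_fin] at key
  have hint := lintegral_mono (μ := channelLaw μ n) key
  rw [lintegral_add_right _ measurable_const, lintegral_add_left (hmc K),
    lintegral_add_left measurable_const, lintegral_const_mul' _ _ ENNReal.ofReal_ne_top,
    c.lintegral_error i] at hint
  simpa [Code.condEnt] using hint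

lemma Code.toReal_condEnt_insert_add_log_le
    (hint : ∀ i, Integrable (fun h => Real.log (1 + ‖h‖)) (μ i)) {c : Code I n} {P : ℝ}
    (hP : c.PowerLE μ P) {K : Finset (Fin 3)} {i : Fin 3} (hi : i ∉ K) {S : Finset (Fin 3)}
    (hS : i ∈ S) :
    (c.condEnt μ (insert i K) (rows n n S)).toReal + Real.log (c.M i) ≤
      (c.condEnt μ K (rows n n S)).toReal +
        (Real.log 2 + Real.log (c.M i) * (c.errProb μ i).toReal) := by
  have hM : 0 ≤ Real.log (c.M i) := Real.log_natCast_nonneg _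
  have h2 : 0 ≤ Real.log 2 := Real.log_nonneg one_le_two
  have h1 := c.condEnt_ne_top hint hP K (rows n n S)
  have h3 : ENNReal.ofReal (Real.log (c.M i)) * c.errProb μ i ≠ ∞ :=
    ENNReal.mul_ne_top ENNReal.ofReal_ne_top (c.errProb_ne_top i)
  have h4 : ENNReal.ofReal (Real.log 2) + ENNReal.ofReal (Real.log (c.M i)) * c.errProb μ i ≠ ∞ :=
    ENNReal.add_ne_top.2 ⟨ENNReal.ofReal_ne_top, h3⟩
  have := ENNReal.toReal_mono (ENNReal.add_ne_top.2 ⟨h1, h4⟩)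
    (c.condEnt_insert_add_log_le (μ := μ) hi hS)
  rwa [ENNReal.toReal_add (c.condEnt_ne_top hint hP _ _) ENNReal.ofReal_ne_top,
    ENNReal.toReal_add h1 h4, ENNReal.toReal_add ENNReal.ofReal_ne_top h3, ENNReal.toReal_mul,
    ENNReal.toReal_ofReal hM, ENNReal.toReal_ofReal h2] at this

/-- The outer bound for a single code. -/
lemma Code.log_card_le (hμ : ∀ i j, μ i = μ j)
    (hint : ∀ i, Integrable (fun h => Real.log (1 + ‖h‖)) (μ i)) {c : Code ∅ n} {P : ℝ}
    (hP0 : 0 ≤ P) (hP : c.PowerLE μ P) {i j k : Fin 3} (hij : i ≠ j) (hik : i ≠ k) (hjk : j ≠ k) :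
    Real.log (c.M i) + Real.log (c.M j) / 2 + Real.log (c.M k) / 3 ≤
      n * (Real.log (1 + P) +
        (Real.log Real.pi + 26 + 2 * ∑ i, ∫ h, Real.log (1 + ‖h‖) ∂μ i)) + 2 * Real.log 2 +
      (Real.log (c.M i) * (c.errProb μ i).toReal + Real.log (c.M j) * (c.errProb μ j).toReal +
        Real.log (c.M k) * (c.errProb μ k).toReal) := by
  have := c.nonempty_messages
  have hC : 0 ≤ Real.log (1 + P) +
        (Real.log Real.pi + 26 + 2 * ∑ i, ∫ h, Real.log (1 + ‖h‖) ∂μ i) := by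
    have h1 : 0 ≤ Real.log (1 + P) := Real.log_nonneg (by linarith)
    have h2 : 0 ≤ Real.log Real.pi := Real.log_nonneg (by linarith [Real.pi_gt_three])
    have h3 : 0 ≤ ∑ i, ∫ h, Real.log (1 + ‖h‖) ∂μ i := Finset.sum_nonneg fun i _ =>
      integral_nonneg fun h => Real.log_nonneg (by linarith [norm_nonneg h])
    linarith
  have hcard : (rows n n {i}).card = n := by
    have : rows n n {i} = Finset.univ.image fun t : Fin n => (t, i) := by
      ext ⟨s, l⟩
      simp [eq_comm]
    rw [this, Finset.card_image_of_injective _ fun s t h => (Prod.ext_iff.1 h).1,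
      Finset.card_univ, Fintype.card_fin]
  have hup : (c.condEnt μ ∅ (rows n n {i})).toReal ≤ n * (Real.log (1 + P) +
        (Real.log Real.pi + 26 + 2 * ∑ i, ∫ h, Real.log (1 + ‖h‖) ∂μ i)) := by
    have h1 := meanEnt_le hint c.enc_measurable hP0 (fun t l => by
      rw [← ENNReal.div_eq_inv_mul, card_messages]
      exact hP t l) (rows n n {i})
    rw [c.condEnt_empty]
    refine (ENNReal.toReal_mono (ENNReal.mul_ne_top (by simp) ENNReal.ofReal_ne_top) h1).trans ?_
    rw [ENNReal.toReal_mul, ENNReal.toReal_ofReal hC, hcard]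
    simp
  -- These three Fano bounds are added with weights `1`, `1/2`, `1/3`. By `g1` and `g2` the entropy
  -- gained at each step is at most the one lost at the step before. The last conditional entropy is
  -- nonnegative and dropped, and `1 + 1/2 + 1/3 ≤ 2` bounds the terms with `log 2`.
  have f1 := toReal_condEnt_insert_add_log_le hint hP (K := ∅) (i := i) (S := {i}) (by simp)
    (by simp)
  have f2 := toReal_condEnt_insert_add_log_le hint hP (K := insert i ∅) (i := j) (S := {i, j})
    (by simp [hij.symm]) (by simp)
  have f3 := toReal_condEnt_insert_add_log_le hint hP (K := insert j (insert i ∅)) (i := k)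
    (S := {i, j, k}) (by simp [hik.symm, hjk.symm]) (by simp)
  have g1 := condEnt_rows_two_le hμ hint hP (insert i ∅) hij
  have g2 := condEnt_rows_three_le hμ hint hP (insert j (insert i ∅)) hij hik hjk
  have p3 : 0 ≤ (c.condEnt μ (insert k (insert j (insert i ∅))) (rows n n {i, j, k})).toReal :=
    ENNReal.toReal_nonneg
  have h2 : 0 ≤ Real.log 2 := Real.log_nonneg one_le_two
  have e2 : 0 ≤ Real.log (c.M j) * (c.errProb μ j).toReal :=
    mul_nonneg (Real.log_natCast_nonneg _) ENNReal.toReal_nonneg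
  have e3 : 0 ≤ Real.log (c.M k) * (c.errProb μ k).toReal :=
    mul_nonneg (Real.log_natCast_nonneg _) ENNReal.toReal_nonneg
  linarith

/-- After division by `n` the Fano terms are convergent rates times vanishing error probabilities,
so they disappear in the limit. -/
lemma capacityRegion_le (hμ : ∀ i j, μ i = μ j)
    (hint : ∀ i, Integrable (fun h => Real.log (1 + ‖h‖)) (μ i)) {P : ℝ} (hP0 : 0 ≤ P)
    {R : Fin 3 → ℝ} (hR : R ∈ capacityRegion μ ∅ P) {i j k : Fin 3} (hij : i ≠ j) (hik : i ≠ k)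
    (hjk : j ≠ k) :
    R i + R j / 2 + R k / 3 ≤ Real.log (1 + P) +
      (Real.log Real.pi + 26 + 2 * ∑ i, ∫ h, Real.log (1 + ‖h‖) ∂μ i) := by
  obtain ⟨c, hc, hr, he⟩ := hR
  set C := Real.log (1 + P) + (Real.log Real.pi + 26 + 2 * ∑ i, ∫ h, Real.log (1 + ‖h‖) ∂μ i)
  have he' : ∀ i, Tendsto (fun n => ((c n).errProb μ i).toReal) atTop (𝓝 0) := fun i => by
    have := (ENNReal.tendsto_toReal ENNReal.zero_ne_top).comp (he i)
    rwa [ENNReal.toReal_zero] at this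
  have h1 := ((hr i).add ((hr j).div_const 2)).add ((hr k).div_const 3)
  have h2 : Tendsto (fun n : ℕ => C + 2 * Real.log 2 / n +
      (Real.log ((c n).M i) / n * ((c n).errProb μ i).toReal +
        Real.log ((c n).M j) / n * ((c n).errProb μ j).toReal +
        Real.log ((c n).M k) / n * ((c n).errProb μ k).toReal)) atTop
      (𝓝 (C + 0 + (R i * 0 + R j * 0 + R k * 0))) :=
    (tendsto_const_nhds.add (tendsto_const_div_atTop_nhds_zero_nat _)).add
      ((((hr i).mul (he' i)).add ((hr j).mul (he' j))).add ((hr k).mul (he' k)))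
  simp only [mul_zero, add_zero] at h2
  refine le_of_tendsto_of_tendsto h1 h2 ?_
  filter_upwards [eventually_gt_atTop 0] with n hn
  have hn' : (0 : ℝ) < n := by exact_mod_cast hn
  have := div_le_div_of_nonneg_right
    (Code.log_card_le hμ hint hP0 (hc n) hij hik hjk) hn'.le
  refine (le_of_eq ?_).trans (this.trans (le_of_eq ?_))
  · ring
  · simp only [C]
    field_simp

lemma dofRegion_le (hμ : ∀ i j, μ i = μ j)
    (hint : ∀ i, Integrable (fun h => Real.log (1 + ‖h‖)) (μ i)) {d : Fin 3 → ℝ}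
    (hd : d ∈ dofRegion μ ∅) {i j k : Fin 3} (hij : i ≠ j) (hik : i ≠ k) (hjk : j ≠ k) :
    d i + d j / 2 + d k / 3 ≤ 1 := by
  obtain ⟨-, R, hR, hlim⟩ := hd
  set C := Real.log Real.pi + 26 + 2 * ∑ i, ∫ h, Real.log (1 + ‖h‖) ∂μ i
  have h1 := ((hlim i).add ((hlim j).div_const 2)).add ((hlim k).div_const 3)
  have h2 : Tendsto (fun P => 1 + (Real.log 2 + C) / Real.log P) atTop (𝓝 (1 + 0)) :=
    tendsto_const_nhds.add (Real.tendsto_log_atTop.const_div_atTop _)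
  rw [add_zero] at h2
  refine le_of_tendsto_of_tendsto h1 h2 ?_
  filter_upwards [eventually_gt_atTop 1] with P hP
  have hlog : 0 < Real.log P := Real.log_pos hP
  have h3 := capacityRegion_le hμ hint (by linarith) (hR P (by linarith)) hij hik hjk
  have h4 : Real.log (1 + P) ≤ Real.log 2 + Real.log P := by
    rw [← Real.log_mul two_ne_zero (by linarith)]
    exact Real.log_le_log (by linarith) (by linarith)
  have h5 : R P i + R P j / 2 + R P k / 3 ≤ Real.log P + (Real.log 2 + C) := by linarith
  have := div_le_div_of_nonneg_right h5 hlog.le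
  refine (le_of_eq ?_).trans (this.trans (le_of_eq ?_))
  · ring
  · field_simp

/-- With delayed CSIT the sum of the degrees of freedom is at most `18 / 11`. -/
theorem sum_le_of_mem_dofRegion (hμ : ∀ i j, μ i = μ j)
    (hint : ∀ i, Integrable (fun h => Real.log (1 + ‖h‖)) (μ i)) {d : Fin 3 → ℝ}
    (hd : d ∈ dofRegion μ ∅) : ∑ i, d i ≤ 18 / 11 := by
  -- Over the three cyclic orders each `d i` receives total weight `1 + 1/2 + 1/3 = 11/6`, against
  -- the bound `3`.
  have h1 := dofRegion_le hμ hint hd (i := 0) (j := 1) (k := 2) (by decide) (by decide) (by decide)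
  have h2 := dofRegion_le hμ hint hd (i := 1) (j := 2) (k := 0) (by decide) (by decide) (by decide)
  have h3 := dofRegion_le hμ hint hd (i := 2) (j := 0) (k := 1) (by decide) (by decide) (by decide)
  rw [Fin.sum_univ_three]
  linarith

end Converse

end MISO

/-! ### Assembly of the theorem. -/

theorem mainTheorem4
    (μ : Fin 3 → Measure (Fin 3 → ℂ)) [∀ i, IsProbabilityMeasure (μ i)]
    (hμ : ∀ i, μ i ≪ volume) :
    -- the two explicit six-slot linear schemes, for every choice of zero-forcing directions
    (∀ b : MISO.Beams, ∀ X ∈ ({MISO.scheme₁ b, MISO.scheme₂ b} : Set MISO.Scheme),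
      X.IsLinear ∧ (∀ s, MISO.RespectsCSIT {0} (fun H => X H s)) ∧ X.Decodable μ) ∧
    -- the triple is achievable with instantaneous CSIT of receiver 1 and delayed CSIT of 2 and 3
    (![1, 1 / 3, 1 / 3] : Fin 3 → ℝ) ∈ MISO.dofRegion μ {0} ∧
    (∑ i, (![1, 1 / 3, 1 / 3] : Fin 3 → ℝ) i = 5 / 3) ∧
    -- comparison with delayed CSIT of all three receivers
    (18 / 11 : ℝ) < 5 / 3 ∧
    (∃ d ∈ MISO.dofRegion μ ∅, ∑ i, d i = 18 / 11) ∧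
    ((∀ i j, μ i = μ j) → (∀ i, Integrable (fun h => Real.log (1 + ‖h‖)) (μ i)) →
      ∀ d ∈ MISO.dofRegion μ ∅, ∑ i, d i ≤ 18 / 11) := by
  refine ⟨MISO.six_slot_schemes hμ, MISO.hybrid_mem_dofRegion hμ, ?_, by norm_num,
    ⟨_, MISO.delayed_mem_dofRegion hμ, ?_⟩, ?_⟩
  · simp [Fin.sum_univ_three]
    norm_num
  · simp
    norm_num
  · exact fun hs hint d hd => MISO.sum_le_of_mem_dofRegion hs hint hd
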